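/- Let $r\ge 1$, $q=e^{\pi \mathsf i/r}$, $q^{1/2}=e^{\pi\mathsf i/2r}$, $\{x\}=q^x-q^{-x}$, $[x]=\{x\}/\{1\}$ (read $[x]=0$ if $r=1$), $\{a\}!=\{a\}\cdots\{1\}$. Let $D$ be the Hopf algebra over $\mathbb C$ generated by $E,F,k^{\pm1}$ with relations $E^r=F^r=0$, $k^{4r}=1$, $kE=qEk$, $kF=q^{-1}Fk$, $[E,F]=(k^2-k^{-2})/(q-q^{-1})$ and coproduct $\Delta E=1\otimes E+E\otimes k^2$, $\Delta F=k^{-2}\otimes F+F\otimes 1$, $\Delta k=k\otimes k$. For $\alpha\in\{\pm1,\pm\mathsf i\}$ let $\mathsf V_{r-1}^\alpha$ be the $D$-module with basis $u_0,\dots,u_{r-1}$ and $$E u_m=u_{m-1},\qquad F u_m=\alpha^2[m+1][r-1-m]\,u_{m+1},\qquad k u_m=\alpha q^{(r-1-2m)/2}u_m \qquad (u_{-1}=u_r=0),$$ and put $\mathsf V_{r-1}=\mathsf V_{r-1}^1$. For $0\le i\le r-2$ and $i'=r-2-i$ let $\mathsf P_i^\alpha$ be the $2r$-dimensional indecomposable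 projective $D$-module with basis $w^H_m,w^S_m$ $(0\le m\le i)$, $w^L_m,w^R_m$ $(0\le m\le i')$ on which, with $\gamma_{a,m}=[m][a-m+1]$ and vectors $w^X_m$, $X\in\{H,S,L,R\}$, with an index out of range read as $0$ unless indicated otherwise, $E$ acts by $$E w_0^H=w_{i'}^R,\quad E w_m^H=\gamma_{i,m}w_{m-1}^H+w_{m-1}^S\ (m\ge 1),\quad E w^S_m=\gamma_{i,m}w^S_{m-1},\quad E w_0^L=w_i^S,\quad E w_m^L=-\gamma_{i',m}w^L_{m-1}\ (m\ge1),\quad E w_m^R=w_{m-1}^R,$$ $\alpha^{-2}F$ acts by $$w_m^H\mapsto w_{m+1}^H\ (m<i),\quad w_i^H\mapsto w_0^L,\quad w_m^S\mapsto w_{m+1}^S,\quad w_m^L\mapsto w_{m+1}^L,\quad w_m^R\mapsto -\gamma_{i',m+1}w_{m+1}^R\ (m<i'),\quad w_{i'}^R\mapsto w_0^S,$$ and $\alpha^{-1}k$ is diagonal with eigenvalues $q^{(i-2m)/2}$ on $w_m^H,w_m^S$, $q^{-(i+2+2m)/2}$ on $w_m^L$, and $q^{(i'+r-2m)/2}$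 on $w_m^R$. We call $w_0^H$ the dominant head vector and $w_0^S$ the socle highest weight vector of $\mathsf P_i^\alpha$. Let $n\ge1$. Put $\mathsf R=q^{-(r-1)^2/2}\,\tau\circ R$ on $\mathsf V_{r-1}^{\otimes 2}$, where $\tau$ is the flip and $$R=\frac1{4r}\sum_{a=0}^{r-1}\ \sum_{m,m'=0}^{4r-1}\frac{\{1\}^{2a}}{\{a\}!}\,q^{a(a-1)/2+a(m-m')-mm'/2}\,E^ak^m\otimes F^ak^{m'} .$$ Let $\boldsymbol V_{n,\ell}$ be the span of the vectors $u_{\varepsilon_1}\otimes\cdots\otimes u_{\varepsilon_n}$ with $\varepsilon_1+\dots+\varepsilon_n=\ell$; equivalently, the $(n(r-1)-2\ell)$-eigenspace in $\mathsf V_{r-1}^{\otimes n}$ of the operator $H_n$ that multiplies $u_{\varepsilon_1}\otimes\cdots\otimes u_{\varepsilon_n}$ by $\sum_t (r-1-2\varepsilon_t)$. Put $$\boldsymbol W_{n,\ell}=\ker E\cap \boldsymbol V_{n,\ell},\qquad \boldsymbol N_{n,\ell}=\ker (FE)^2\cap \boldsymbol V_{n,\ell},\qquad d_{n,\ell}=\dim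 \boldsymbol W_{n,\ell}.$$ **Theorem.** Let $n,r\ge 1$ and $0\le \ell<r$, and let $0\le j\le r-1$ be the solution of $j\equiv n+2(\ell-1) \pmod r$. The operators $\sigma_t=\mathbb 1^{\otimes t-1}\otimes\mathsf R\otimes\mathbb 1^{\otimes n-t-1}$, $1\le t\le n-1$, define a representation of the braid group $B_n$ on $\mathsf V_{r-1}^{\otimes n}$, and $\boldsymbol W_{n,\ell}$ and $\boldsymbol N_{n,\ell}$ are subrepresentations. 1. If $j\ge\ell$, then $\boldsymbol N_{n,\ell}=\boldsymbol W_{n,\ell}$ (as $B_n$-modules). 2. If $j<\ell$, put $\ell'=\ell-1-j$. The $D$-module $\mathsf V_{r-1}^{\otimes n}$ has a decomposition as a finite direct sum of copies of modules $\mathsf V_{r-1}^\alpha$ and $\mathsf P_i^\alpha$ in which the generator $u_0$, respectively $w_0^H$, of each summand lies in some $\boldsymbol V_{n,m}$. For every such decomposition, let $\boldsymbol S_{n,\ell}$ be the span of the socle highest weight vectors $w_0^S$ of the summands $\mathsf P_i^\alpha$ that lie in $\boldsymbol V_{n,\ell}$, and let $\boldsymbol H_{n,\ell}$ be the span of the dominant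 head vectors $w_0^H$ of the summands $\mathsf P_i^\alpha$ with $w_0^S\in\boldsymbol S_{n,\ell}$. Then, as vector spaces, $$\boldsymbol N_{n,\ell}=\boldsymbol W_{n,\ell}\oplus \boldsymbol H_{n,\ell},\qquad \dim\boldsymbol H_{n,\ell}=\dim\boldsymbol S_{n,\ell}=\dim \boldsymbol W_{n,\ell'} .$$ Consequently, in a suitable basis, the $B_n$-representation $\boldsymbol N_{n,\ell}$ is given by a homomorphism $\rho^{\boldsymbol N}_{n,\ell}\colon B_n\to \mathrm{GL}(d_{n,\ell}+d_{n,\ell'},\mathbb C)$. -/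

import Mathlib

noncomputable section

namespace SteinbergBraid

/-! ### Quantum numbers at `q = exp(π i / r)` -/

/-- `q^{1/2} = exp(π i / (2 r))`. -/
def qHalf (r : ℕ) : ℂ := Complex.exp (Real.pi * Complex.I / (2 * r))

/-- `q = exp(π i / r)`. -/
def q (r : ℕ) : ℂ := Complex.exp (Real.pi * Complex.I / r)

/-- `{x} = q^x - q^{-x}`. -/
def qCurly (r : ℕ) (x : ℤ) : ℂ := q r ^ x - q r ^ (-x)

/-- `[x] = {x} / {1}`. -/
def qInt (r : ℕ) (x : ℤ) : ℂ := qCurly r x / qCurly r 1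

/-- `{n}! = {n} {n-1} ⋯ {1}`. -/
def qCurlyFactorial (r n : ℕ) : ℂ := ∏ m ∈ Finset.Icc 1 n, qCurly r m

/-! ### Modules over the Hopf algebra `D`

`D` is the complex algebra generated by `E, F, k, k⁻¹` with relations
`E^r = F^r = 0`, `k^{4r} = 1`, `k E = q E k`, `k F = q⁻¹ F k`,
`[E, F] = (k^2 - k^{-2}) / (q - q⁻¹)`, and coproduct
`Δ E = 1 ⊗ E + E ⊗ k^2`, `Δ F = k^{-2} ⊗ F + F ⊗ 1`, `Δ k = k ⊗ k`.
A `D`-module is recorded by the operators by which the generators act. -/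

/-- The operators by which the generators `E`, `F`, `k` of `D` act on a vector space. -/
structure DAction (M : Type*) [AddCommMonoid M] [Module ℂ M] where
  /-- the action of `E` -/
  E : Module.End ℂ M
  /-- the action of `F` -/
  F : Module.End ℂ M
  /-- the action of `k` -/
  k : Module.End ℂ M

/-- `f` is a homomorphism of `D`-modules. -/
structure DAction.IsHom {M N : Type*} [AddCommMonoid M] [Module ℂ M] [AddCommMonoid N] [Module ℂ N]
    (A : DAction M) (B : DAction N) (f : M →ₗ[ℂ] N) : Prop where
  map_E : ∀ x, f (A.E x) = B.E (f x)
  map_F : ∀ x, f (A.F x) = B.F (f x)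
  map_k : ∀ x, f (A.k x) = B.k (f x)

/-! ### The Steinberg modules `V_{r-1}^α` -/

/-- The underlying `r`-dimensional space of `V_{r-1}^α`, with basis `u_0, …, u_{r-1}`. -/
abbrev V (r : ℕ) : Type := Fin r → ℂ

/-- The vector `u_m`, with the convention `u_m = 0` for `m ≥ r`. -/
def u (r m : ℕ) : V r := if h : m < r then Pi.single ⟨m, h⟩ 1 else 0

/-- The simple projective module `V_{r-1}^α`:
`E u_m = u_{m-1}`, `F u_m = α^2 [m+1] [r-1-m] u_{m+1}`, `k u_m = α q^{(r-1-2m)/2} u_m`,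
where `u_{-1} = u_r = 0`. -/
def steinberg (r : ℕ) (α : ℂ) : DAction (V r) where
  E := (Pi.basisFun ℂ (Fin r)).constr ℂ fun m : Fin r => if (m : ℕ) = 0 then 0 else u r (m - 1)
  F := (Pi.basisFun ℂ (Fin r)).constr ℂ fun m : Fin r =>
    (α ^ 2 * qInt r (m + 1) * qInt r (r - 1 - m)) • u r (m + 1)
  k := (Pi.basisFun ℂ (Fin r)).constr ℂ fun m : Fin r =>
    (α * qHalf r ^ ((r : ℤ) - 1 - 2 * m)) • u r m

/-- The operator `H` on `V_{r-1} = V_{r-1}^1`: `u_m` has strong weight `r - 1 - 2 m`. -/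
def H₁ (r : ℕ) : Module.End ℂ (V r) :=
  (Pi.basisFun ℂ (Fin r)).constr ℂ fun m : Fin r => ((r : ℂ) - 1 - 2 * m) • u r m

/-! ### The indecomposable projective modules `P_i^α`, `0 ≤ i ≤ r - 2` -/

/-- Labels of the basis `w_m^H, w_m^S` (`0 ≤ m ≤ i`) and `w_m^L, w_m^R` (`0 ≤ m ≤ j`)
of `P_i^α`, where `j = r - 2 - i`. -/
inductive PIndex (r i : ℕ) : Type
  | H (m : Fin (i + 1))
  | S (m : Fin (i + 1))
  | L (m : Fin (r - 2 - i + 1))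
  | R (m : Fin (r - 2 - i + 1))

/-- The underlying `2r`-dimensional space of `P_i^α` (for `i + 2 ≤ r`). -/
abbrev P (r i : ℕ) : Type := PIndex r i →₀ ℂ

/-- The basis vector `w_m^H`; it is `0` for `m > i`. -/
def wH (r i m : ℕ) : P r i := if h : m < i + 1 then Finsupp.single (.H ⟨m, h⟩) 1 else 0

/-- The basis vector `w_m^S`; it is `0` for `m > i`. -/
def wS (r i m : ℕ) : P r i := if h : m < i + 1 then Finsupp.single (.S ⟨m, h⟩) 1 else 0

/-- The basis vector `w_m^L`; it is `0` for `m > r - 2 - i`. -/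
def wL (r i m : ℕ) : P r i := if h : m < r - 2 - i + 1 then Finsupp.single (.L ⟨m, h⟩) 1 else 0

/-- The basis vector `w_m^R`; it is `0` for `m > r - 2 - i`. -/
def wR (r i m : ℕ) : P r i := if h : m < r - 2 - i + 1 then Finsupp.single (.R ⟨m, h⟩) 1 else 0

/-- `γ_{a,m} = [m] [a - m + 1]`. -/
def gam (r a m : ℕ) : ℂ := qInt r m * qInt r ((a : ℤ) - m + 1)

/-- The module `P_i^α = V_0^α ⊗ P_i`: here `V_0^α` is one-dimensional with `E = F = 0`, `k = α`,
so that by the coproduct `E` acts as on `P_i`, `F` as `α^{-2} F = α^2 F`, and `k` as `α k`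
(recall `α^4 = 1`). -/
def proj (r i : ℕ) (α : ℂ) : DAction (P r i) where
  E := Finsupp.linearCombination ℂ fun
    | .H m => if (m : ℕ) = 0 then wR r i (r - 2 - i)
        else gam r i m • wH r i (m - 1) + wS r i (m - 1)
    | .S m => if (m : ℕ) = 0 then 0 else gam r i m • wS r i (m - 1)
    | .L m => if (m : ℕ) = 0 then wS r i i else -gam r (r - 2 - i) m • wL r i (m - 1)
    | .R m => if (m : ℕ) = 0 then 0 else wR r i (m - 1)
  F := α ^ 2 • Finsupp.linearCombination ℂ fun
    | .H m => if (m : ℕ) = i then wL r i 0 else wH r i (m + 1)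
    | .S m => wS r i (m + 1)
    | .L m => wL r i (m + 1)
    | .R m => if (m : ℕ) = r - 2 - i then wS r i 0
        else -gam r (r - 2 - i) (m + 1) • wR r i (m + 1)
  k := α • Finsupp.linearCombination ℂ fun
    | .H m => qHalf r ^ ((i : ℤ) - 2 * m) • wH r i m
    | .S m => qHalf r ^ ((i : ℤ) - 2 * m) • wS r i m
    | .L m => qHalf r ^ (-((i : ℤ) + 2 + 2 * m)) • wL r i m
    | .R m => qHalf r ^ (((r - 2 - i : ℕ) : ℤ) + r - 2 * m) • wR r i m

/-! ### The tensor power `V_{r-1}^{⊗ n}` -/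

/-- The underlying space of `V_{r-1}^{⊗ n}`. -/
abbrev TP (r n : ℕ) : Type := PiTensorProduct ℂ fun _ : Fin n => V r

/-- The `D`-module `V_{r-1}^{⊗ n}`; the generators act through the iterated coproduct:
`E` by `∑_t 1 ⊗ ⋯ ⊗ 1 ⊗ E ⊗ k^2 ⊗ ⋯ ⊗ k^2`,
`F` by `∑_t k^{-2} ⊗ ⋯ ⊗ k^{-2} ⊗ F ⊗ 1 ⊗ ⋯ ⊗ 1` (with `E`, `F` in position `t`),
and `k` by `k ⊗ ⋯ ⊗ k`; `k^{-1}` is written as `k^{4r-1}`. -/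
def tensorPower (r n : ℕ) : DAction (TP r n) where
  E := ∑ t : Fin n, PiTensorProduct.map fun p : Fin n =>
    if p < t then 1 else if p = t then (steinberg r 1).E else (steinberg r 1).k ^ 2
  F := ∑ t : Fin n, PiTensorProduct.map fun p : Fin n =>
    if p < t then ((steinberg r 1).k ^ (4 * r - 1)) ^ 2
    else if p = t then (steinberg r 1).F else 1
  k := PiTensorProduct.map fun _ : Fin n => (steinberg r 1).k

/-- `H_n = ∑_t 1 ⊗ ⋯ ⊗ 1 ⊗ H ⊗ 1 ⊗ ⋯ ⊗ 1` on `V_{r-1}^{⊗ n}`. -/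
def Hn (r n : ℕ) : Module.End ℂ (TP r n) :=
  ∑ t : Fin n, PiTensorProduct.map fun p : Fin n => if p = t then H₁ r else 1

/-- The strong weight space `V_{n,ℓ} = ker (H_n - (n (r-1) - 2 ℓ))`. -/
def strongWeightSpace (r n l : ℕ) : Submodule ℂ (TP r n) :=
  LinearMap.ker (Hn r n - ((n : ℂ) * ((r : ℂ) - 1) - 2 * l) • (1 : Module.End ℂ (TP r n)))

/-- The highest strong weight space `W_{n,ℓ} = ker E ∩ V_{n,ℓ}`. -/
def Wspace (r n l : ℕ) : Submodule ℂ (TP r n) :=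
  LinearMap.ker (tensorPower r n).E ⊓ strongWeightSpace r n l

/-- The dominant space `N_{n,ℓ} = ker (F E)^2 ∩ V_{n,ℓ}`. -/
def Nspace (r n l : ℕ) : Submodule ℂ (TP r n) :=
  LinearMap.ker (((tensorPower r n).F * (tensorPower r n).E) ^ 2) ⊓ strongWeightSpace r n l

/-! ### The braid group and its action on `V_{r-1}^{⊗ n}` -/

/-- Artin's relations between the generators `σ_0, …, σ_{m-1}`. -/
def braidRels (m : ℕ) : Set (FreeGroup (Fin m)) :=
  {x | ∃ a b : Fin m, (a : ℕ) + 1 = b ∧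
      x = .of a * .of b * .of a * (.of b * .of a * .of b)⁻¹} ∪
  {x | ∃ a b : Fin m, (a : ℕ) + 1 < b ∧ x = .of a * .of b * (.of b * .of a)⁻¹}

/-- The braid group `B_n` on `n ≥ 1` strands. -/
abbrev BraidGroup (n : ℕ) : Type := PresentedGroup (braidRels (n - 1))

/-- The generator of `B_n` that braids the strands in positions `t` and `t + 1`
(positions are counted from `0`). -/
def braidGen (n : ℕ) (t : Fin (n - 1)) : BraidGroup n := PresentedGroup.of t

/-- The position `t` of a tensor power, for `t < n - 1`. -/
def leftPos {n : ℕ} (t : Fin (n - 1)) : Fin n := ⟨t, by omega⟩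

/-- The position `t + 1` of a tensor power, for `t < n - 1`. -/
def rightPos {n : ℕ} (t : Fin (n - 1)) : Fin n := ⟨t + 1, by omega⟩

/-- The universal `R`-matrix
`(1/4r) ∑_{a<r} ∑_{m,m'<4r} ({1}^{2a} / {a}!) q^{a(a-1)/2 + a(m-m') - m m'/2} E^a k^m ⊗ F^a k^{m'}`
acting on the tensor factors in positions `t` and `t + 1` of `V_{r-1}^{⊗ n}`. -/
def RMatrixAt (r n : ℕ) (t : Fin (n - 1)) : Module.End ℂ (TP r n) :=
  (1 / (4 * r : ℂ)) • ∑ a ∈ Finset.range r, ∑ m ∈ Finset.range (4 * r),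
    ∑ m' ∈ Finset.range (4 * r),
      (qCurly r 1 ^ (2 * a) / qCurlyFactorial r a *
        qHalf r ^ ((a : ℤ) * (a - 1) + 2 * a * (m - m') - m * m')) •
      PiTensorProduct.map fun p : Fin n =>
        if p = leftPos t then (steinberg r 1).E ^ a * (steinberg r 1).k ^ m
        else if p = rightPos t then (steinberg r 1).F ^ a * (steinberg r 1).k ^ m'
        else 1

/-- The flip of the tensor factors in positions `t` and `t + 1`. -/
def flipAt (r n : ℕ) (t : Fin (n - 1)) : Module.End ℂ (TP r n) :=
  (PiTensorProduct.reindex ℂ (fun _ : Fin n => V r)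
    (Equiv.swap (leftPos t) (rightPos t))).toLinearMap

/-- The operator `1 ⊗ ⋯ ⊗ 1 ⊗ 𝖱 ⊗ 1 ⊗ ⋯ ⊗ 1` with
`𝖱 = q^{-(r-1)^2/2} (flip ∘ R)` in positions `t` and `t + 1`. -/
def braidOp (r n : ℕ) (t : Fin (n - 1)) : Module.End ℂ (TP r n) :=
  qHalf r ^ (-((r : ℤ) - 1) ^ 2) • (flipAt r n t * RMatrixAt r n t)

/-! ### Decompositions of `V_{r-1}^{⊗ n}` into indecomposable projective modules -/

/-- A decomposition of the `D`-module `V_{r-1}^{⊗ n}` as a direct sum of finitely many copies of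
the indecomposable projective modules `V_{r-1}^α` and `P_i^α`
(`α ∈ {1, -1, i, -i}`, `0 ≤ i ≤ r - 2`), compatible with strong weights: the generating vectors
`u_0^α`, respectively `w_0^H`, of all summands have a strong weight. -/
structure Decomposition (r n : ℕ) where
  /-- number of summands of the form `V_{r-1}^α` -/
  numSt : ℕ
  /-- number of summands of the form `P_i^α` -/
  numPr : ℕ
  αSt : Fin numSt → ℂ
  αSt_pow : ∀ a, αSt a ^ 4 = 1
  αPr : Fin numPr → ℂ
  αPr_pow : ∀ b, αPr b ^ 4 = 1
  /-- the index `i` of a summand `P_i^α` -/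
  idx : Fin numPr → ℕ
  idx_le : ∀ b, idx b + 2 ≤ r
  /-- the embeddings of the summands -/
  st : Fin numSt → (V r →ₗ[ℂ] TP r n)
  pr : ∀ b : Fin numPr, P r (idx b) →ₗ[ℂ] TP r n
  st_hom : ∀ a, (steinberg r (αSt a)).IsHom (tensorPower r n) (st a)
  pr_hom : ∀ b, (proj r (idx b) (αPr b)).IsHom (tensorPower r n) (pr b)
  st_inj : ∀ a, Function.Injective (st a)
  pr_inj : ∀ b, Function.Injective (pr b)
  indep : iSupIndep (Sum.elim (fun a => LinearMap.range (st a)) fun b => LinearMap.range (pr b))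
  spans : (⨆ c, Sum.elim (fun a => LinearMap.range (st a)) (fun b => LinearMap.range (pr b)) c) = ⊤
  st_weight : ∀ a, ∃ m, st a (u r 0) ∈ strongWeightSpace r n m
  pr_weight : ∀ b, ∃ m, pr b (wH r (idx b) 0) ∈ strongWeightSpace r n m

/-- The space `S_{n,ℓ}` spanned by the socle highest weight vectors `u_0^α ⊗ w_0^S` of the
summands `P_i^α` that lie in `V_{n,ℓ}`. -/
def Decomposition.socleSpace {r n : ℕ} (𝒟 : Decomposition r n) (l : ℕ) : Submodule ℂ (TP r n) :=
  Submodule.span ℂ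
    {v | ∃ b, 𝒟.pr b (wS r (𝒟.idx b) 0) ∈ strongWeightSpace r n l ∧
      v = 𝒟.pr b (wS r (𝒟.idx b) 0)}

/-- The space `H_{n,ℓ}`, the preimage of `S_{n,ℓ}` under the bijection `u_0^α ⊗ w_0^H ↦
u_0^α ⊗ w_0^S`: it is spanned by the dominant head vectors `u_0^α ⊗ w_0^H` of the summands `P_i^α`
whose socle highest weight vector `u_0^α ⊗ w_0^S` belongs to `S_{n,ℓ}`. -/
def Decomposition.headSpace {r n : ℕ} (𝒟 : Decomposition r n) (l : ℕ) : Submodule ℂ (TP r n) :=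
  Submodule.span ℂ
    {v | ∃ b, 𝒟.pr b (wS r (𝒟.idx b) 0) ∈ 𝒟.socleSpace l ∧
      v = 𝒟.pr b (wH r (𝒟.idx b) 0)}

end SteinbergBraid

end

noncomputable section

namespace SteinbergBraid

section

/-! ### Quantum numbers at a root of unity -/

/-! The braid part is the quantum-group argument. The R-matrix is a Cartan factor `cartan`, acting
as q to half the product of the two weights, times a truncated q-exponential `theta`. The q-binomial
theorem makes `theta` multiplicative (`theta_mul_theta`), and commuting E past powers of F makes it
intertwine coproducts (`theta_intertwine`). Together these give the Yang–Baxter equation and show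
that every `braidOp` commutes with E, F and H_n; hence W and N are invariant.

The rest is governed by the Casimir operator C, which on level l is FE plus the scalar `casScalar r
n l`. Thus N_{n,l} is the level-l part of a generalized eigenspace of C (`WeightSystem.A`). Put d =
`wall r n l`, which is r - 1 - j under the congruence. If d ≠ 0, the levels with the same scalar as
l are spaced alternately by d and r - d. On a fixed level F^s E^s and E^s F^s are polynomials in C,
so they are injective on the generalized eigenspace as long as no coincidence of scalars is met
(`WeightSystem.E_eq_zero`). If l < r - d = j + 1, then E^(r-d) leads to a negative level and is
zero, which forces Ev = 0 on N_{n,l}: the first case.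

For j < l let a decomposition be given. The weight of a head at level l determines the index i = d -
1 of its summand. In P_i^α only basis vectors of index 0 span the kernel of (FE)^2. Of these w_0^S
and w_0^R are killed by E, w_0^L lies at level at least r > l, and w_0^H is the new direction; E
w_0^H = w_{i'}^R ≠ 0 makes the sum direct. The vectors w_0^R of the summands with head at level l
lie at level l', and since l < r nothing else there is killed by E. So they form a basis of
W_{n,l'}, in bijection with the heads (`WeightSystem.Splitting.finrank_headSpan_eq`).

Existence of a decomposition rests on freeness: kernel of E equals image of E^(r-1), and likewise
for F (`tensorPower_E_exact`, `tensorPower_F_exact`), seen by grading with a single tensor factor.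
Freeness yields exactness of the complex formed by the spaces A at successive walls
(`WeightSystem.exists_of_FE_eq_zero`). In each A at a level with d ≠ 0 choose a complement of the
kernel of FE; each of its basis vectors is the head of a copy of P_i^α (`WeightSystem.headHom`). If
d = 0, each basis vector of A is the highest weight vector of a Steinberg module. Independence is
tested on the kernel of E (`WeightSystem.socle_independent`), and exactness shows that these
summands generate everything (`WeightSystem.eq_top_of_stable`). -/

lemma qHalf_ne_zero (r : ℕ) : qHalf r ≠ 0 := Complex.exp_ne_zero _

lemma q_ne_zero (r : ℕ) : q r ≠ 0 := Complex.exp_ne_zero _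

lemma q_eq_qHalf_sq (r : ℕ) : q r = qHalf r ^ (2 : ℤ) := by
  rw [q, qHalf, ← Complex.exp_int_mul]
  congr 1
  by_cases h : (r : ℂ) = 0
  · simp [h]
  · field_simp
    push_cast
    ring

lemma q_zpow_eq (r : ℕ) (x : ℤ) : q r ^ x = qHalf r ^ (2 * x) := by
  rw [q_eq_qHalf_sq, zpow_mul]

lemma isPrimitiveRoot_qHalf {r : ℕ} (hr : 1 ≤ r) : IsPrimitiveRoot (qHalf r) (4 * r) := by
  have h := Complex.isPrimitiveRoot_exp (4 * r) (by omega)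
  convert h using 1
  rw [qHalf]
  congr 1
  have : (r : ℂ) ≠ 0 := by exact_mod_cast (by omega : r ≠ 0)
  push_cast
  field_simp
  ring

lemma qHalf_zpow_eq_one_iff {r : ℕ} (hr : 1 ≤ r) (x : ℤ) :
    qHalf r ^ x = 1 ↔ (4 * r : ℤ) ∣ x := by
  have := (isPrimitiveRoot_qHalf hr).zpow_eq_one_iff_dvd x
  simpa using this

lemma qHalf_zpow_eq_iff {r : ℕ} (hr : 1 ≤ r) (x y : ℤ) :
    qHalf r ^ x = qHalf r ^ y ↔ (4 * r : ℤ) ∣ x - y := by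
  rw [← qHalf_zpow_eq_one_iff hr, zpow_sub₀ (qHalf_ne_zero r),
    div_eq_one_iff_eq (zpow_ne_zero _ (qHalf_ne_zero r))]

/-- The symbol {x} vanishes exactly when q^(2x) = 1, and q² has order r. -/
lemma qCurly_eq_zero_iff {r : ℕ} (hr : 1 ≤ r) (x : ℤ) : qCurly r x = 0 ↔ (r : ℤ) ∣ x := by
  rw [qCurly, sub_eq_zero, q_zpow_eq, q_zpow_eq, qHalf_zpow_eq_iff hr]
  rw [show 2 * x - 2 * -x = 4 * x by ring]
  exact mul_dvd_mul_iff_left (by norm_num)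

lemma qCurly_one_ne_zero {r : ℕ} (hr : 2 ≤ r) : qCurly r 1 ≠ 0 := by
  rw [Ne, qCurly_eq_zero_iff (by omega)]
  intro h
  have := Int.le_of_dvd (by norm_num) h
  omega

lemma qInt_eq_zero_iff {r : ℕ} (hr : 2 ≤ r) (x : ℤ) : qInt r x = 0 ↔ (r : ℤ) ∣ x := by
  rw [qInt, div_eq_zero_iff, qCurly_eq_zero_iff (by omega)]
  simp [qCurly_one_ne_zero hr]

lemma qCurly_zero (r : ℕ) : qCurly r 0 = 0 := by simp [qCurly]

lemma qCurly_neg (r : ℕ) (x : ℤ) : qCurly r (-x) = -qCurly r x := by simp [qCurly]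

lemma qInt_neg (r : ℕ) (x : ℤ) : qInt r (-x) = -qInt r x := by simp [qInt, qCurly_neg, neg_div]

lemma q_pow_r {r : ℕ} (hr : 1 ≤ r) : q r ^ (r : ℤ) = -1 := by
  have : (r : ℂ) ≠ 0 := by exact_mod_cast (by omega : r ≠ 0)
  rw [q, ← Complex.exp_int_mul]
  push_cast
  rw [mul_div_cancel₀ _ this, Complex.exp_pi_mul_I]

/-- Since q^r = -1, the shift by r changes the sign of {·}, and so does replacing x by -x. -/
lemma qInt_sub {r : ℕ} (hr : 1 ≤ r) (x : ℤ) : qInt r (r - x) = qInt r x := by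
  have h := q_ne_zero r
  rw [qInt, qInt, qCurly, qCurly, zpow_sub₀ h, neg_sub, zpow_sub₀ h, q_pow_r hr, zpow_neg]
  have := zpow_ne_zero x h
  rw [qCurly, zpow_neg]
  congr 1
  field_simp
  ring

/-- The coefficient of `E^a ⊗ F^a` in the nilpotent part of the `R`-matrix. -/
def thetaCoeff (r a : ℕ) : ℂ :=
  qCurly r 1 ^ (2 * a) / qCurlyFactorial r a * qHalf r ^ ((a : ℤ) * (a - 1))

lemma thetaCoeff_zero (r : ℕ) : thetaCoeff r 0 = 1 := by
  simp [thetaCoeff, qCurlyFactorial]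

/-- This recursion drives both the q-binomial theorem and the intertwining property. It stops at a +
1 < r because {r} = 0. -/
lemma thetaCoeff_succ {r a : ℕ} (ha : a + 1 < r) :
    thetaCoeff r (a + 1) * qCurly r (a + 1) = thetaCoeff r a * qCurly r 1 ^ 2 * q r ^ (a : ℤ) := by
  have h1 : qCurly r (a + 1) ≠ 0 := by
    rw [Ne, qCurly_eq_zero_iff (by omega)]
    intro h
    have := Int.le_of_dvd (by omega) h
    omega
  have h2 : qCurlyFactorial r (a + 1) = qCurlyFactorial r a * qCurly r (a + 1) := by
    rw [qCurlyFactorial, Finset.prod_Icc_succ_top (by omega)]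
    simp [qCurlyFactorial]
  have h3 : qHalf r ^ (((a + 1 : ℕ) : ℤ) * (((a + 1 : ℕ) : ℤ) - 1)) =
      qHalf r ^ ((a : ℤ) * (a - 1)) * q r ^ (a : ℤ) := by
    rw [q_zpow_eq, ← zpow_add₀ (qHalf_ne_zero r)]
    congr 1
    push_cast
    ring
  rw [thetaCoeff, thetaCoeff, h2, h3]
  have h4 : ∀ x y : ℂ, x / (y * qCurly r (a + 1)) * qCurly r (a + 1) = x / y := by
    intro x y
    rw [div_mul_eq_mul_div, mul_div_mul_right _ _ h1]
  rw [mul_right_comm, h4, mul_add, pow_add]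
  ring

lemma thetaCoeff_ne_zero {r a : ℕ} (ha : a < r) : thetaCoeff r a ≠ 0 := by
  by_cases hr : 2 ≤ r
  · refine mul_ne_zero (div_ne_zero (pow_ne_zero _ (qCurly_one_ne_zero hr)) ?_)
      (zpow_ne_zero _ (qHalf_ne_zero r))
    rw [qCurlyFactorial, Finset.prod_ne_zero_iff]
    intro m hm
    rw [Finset.mem_Icc] at hm
    rw [Ne, qCurly_eq_zero_iff (by omega)]
    intro h
    have := Int.le_of_dvd (by omega) h
    omega
  · obtain rfl : a = 0 := by omega
    simp [thetaCoeff_zero]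

/-! ### The truncated `q`-exponential -/

section QExp

variable {A : Type*} [Ring A] [Algebra ℂ A]

lemma mul_pow_of_mul_eq_smul {x y : A} {c : ℂ} (h : x * y = c • (y * x)) (m : ℕ) :
    x * y ^ m = c ^ m • (y ^ m * x) := by
  induction m with
  | zero => simp
  | succ m ih =>
    rw [pow_succ, ← mul_assoc, ih, smul_mul_assoc, mul_assoc, h, mul_smul_comm, smul_smul,
      pow_succ, mul_assoc]

/-- `∑_{a + b = N} c_a c_b X^a Y^b`. -/
def qExpTerm (r : ℕ) (X Y : A) (N : ℕ) : A :=
  ∑ p ∈ Finset.HasAntidiagonal.antidiagonal N, (thetaCoeff r p.1 * thetaCoeff r p.2) • (X ^ p.1 * Y ^ p.2)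

/-- One multiplication by X + Y in the q-binomial theorem. The two pure powers are kept apart from
the mixed terms so that the formula still holds when N + 2 = r, where the coefficient recursion for
index N + 2 is no longer available; that boundary case gives the Frobenius property. -/
lemma qExpTerm_step {r : ℕ} {X Y : A} (h : Y * X = q r ^ (-2 : ℤ) • (X * Y)) {N : ℕ}
    (hN : N + 1 < r) :
    qCurly r 1 ^ 2 • ((X + Y) * qExpTerm r X Y (N + 1)) =
      (qCurly r 1 ^ 2 * thetaCoeff r (N + 1)) • (X ^ (N + 2) + Y ^ (N + 2)) +
      (qCurly r (N + 2) * q r ^ (-((N : ℤ) + 1))) • ∑ p ∈ Finset.HasAntidiagonal.antidiagonal N,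
        (thetaCoeff r (p.1 + 1) * thetaCoeff r (p.2 + 1)) • (X ^ (p.1 + 1) * Y ^ (p.2 + 1)) := by
  have hq := q_ne_zero r
  have e1 : X * qExpTerm r X Y (N + 1) = thetaCoeff r (N + 1) • X ^ (N + 2) +
      ∑ p ∈ Finset.HasAntidiagonal.antidiagonal N,
        (thetaCoeff r p.1 * thetaCoeff r (p.2 + 1)) • (X ^ (p.1 + 1) * Y ^ (p.2 + 1)) := by
    rw [qExpTerm, Finset.Nat.sum_antidiagonal_succ']
    simp only [mul_add, thetaCoeff_zero, mul_one, pow_zero, mul_smul_comm, ← pow_succ',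
      Finset.mul_sum, ← mul_assoc]
  have e2 : Y * qExpTerm r X Y (N + 1) = thetaCoeff r (N + 1) • Y ^ (N + 2) +
      ∑ p ∈ Finset.HasAntidiagonal.antidiagonal N,
        ((q r ^ (-2 : ℤ)) ^ (p.1 + 1) * (thetaCoeff r (p.1 + 1) * thetaCoeff r p.2)) •
          (X ^ (p.1 + 1) * Y ^ (p.2 + 1)) := by
    rw [qExpTerm, Finset.Nat.sum_antidiagonal_succ]
    simp only [mul_add, thetaCoeff_zero, one_mul, pow_zero, mul_smul_comm, ← pow_succ',
      Finset.mul_sum, ← mul_assoc, mul_pow_of_mul_eq_smul h, smul_mul_assoc, smul_smul]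
    congr 1
    refine Finset.sum_congr rfl fun p _ => ?_
    rw [mul_assoc (X ^ _), ← pow_succ', mul_comm, mul_assoc]
  rw [add_mul, e1, e2, Finset.smul_sum]
  simp only [smul_add, smul_smul, Finset.smul_sum]
  rw [add_add_add_comm, ← Finset.sum_add_distrib]
  congr 1
  refine Finset.sum_congr rfl fun p hp => ?_
  rw [Finset.HasAntidiagonal.mem_antidiagonal] at hp
  rw [← add_smul]
  congr 1
  have ha := thetaCoeff_succ (r := r) (a := p.1) (by omega)
  have hb := thetaCoeff_succ (r := r) (a := p.2) (by omega)
  have ha' : thetaCoeff r p.1 * qCurly r 1 ^ 2 =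
      thetaCoeff r (p.1 + 1) * qCurly r (p.1 + 1) * q r ^ (-(p.1 : ℤ)) := by
    rw [ha, mul_assoc _ (q r ^ _), ← zpow_add₀ hq]; simp
  have hb' : thetaCoeff r p.2 * qCurly r 1 ^ 2 =
      thetaCoeff r (p.2 + 1) * qCurly r (p.2 + 1) * q r ^ (-(p.2 : ℤ)) := by
    rw [hb, mul_assoc _ (q r ^ _), ← zpow_add₀ hq]; simp
  -- The q-Pascal identity: with N = p.1 + p.2 the right side telescopes.
  have hs : qCurly r (N + 2) * q r ^ (-((N : ℤ) + 1)) =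
      qCurly r (p.1 + 1) * q r ^ (-(p.1 : ℤ)) +
      (q r ^ (-2 : ℤ)) ^ (p.1 + 1) * (qCurly r (p.2 + 1) * q r ^ (-(p.2 : ℤ))) := by
    have : (N : ℤ) = p.1 + p.2 + 1 - 1 + 0 := by omega
    rw [← zpow_natCast, ← zpow_mul]
    simp only [qCurly, sub_mul, mul_sub, ← zpow_add₀ hq]
    have hN : (N : ℤ) = p.1 + p.2 := by omega
    rw [hN]
    push_cast
    ring_nf
  calc _ = (thetaCoeff r p.1 * qCurly r 1 ^ 2) * thetaCoeff r (p.2 + 1) +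
        (q r ^ (-2 : ℤ)) ^ (p.1 + 1) * thetaCoeff r (p.1 + 1) *
          (thetaCoeff r p.2 * qCurly r 1 ^ 2) := by ring
    _ = _ := by
      rw [ha', hb', hs]
      ring

/-- The `q`-binomial theorem in terms of the coefficients of the `R`-matrix. -/
lemma thetaCoeff_smul_add_pow {r : ℕ} {X Y : A} (h : Y * X = q r ^ (-2 : ℤ) • (X * Y)) {N : ℕ}
    (hN : N < r) : thetaCoeff r N • (X + Y) ^ N = qExpTerm r X Y N := by
  induction N with
  | zero => simp [qExpTerm, thetaCoeff_zero]
  | succ N ih =>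
    have hq := q_ne_zero r
    have h1 := qCurly_one_ne_zero (r := r) (by omega)
    -- The step formula produces exponents from 2 on, so exponent 1 is treated directly.
    cases N with
    | zero =>
      rw [qExpTerm, Finset.Nat.sum_antidiagonal_succ]
      simp [thetaCoeff_zero, add_comm, smul_add]
    | succ N =>
      have ih := ih (by omega)
      have hc := thetaCoeff_succ (r := r) (a := N + 1) hN
      have hc' : qCurly r 1 ^ 2 * thetaCoeff r (N + 1) =
          (qCurly r (N + 2) * q r ^ (-((N : ℤ) + 1))) * thetaCoeff r (N + 2) := by
        have : q r ^ (-((N : ℤ) + 1)) * q r ^ ((N : ℤ) + 1) = 1 := by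
          rw [← zpow_add₀ hq]; simp
        push_cast at hc
        have e : ((N : ℤ) + 1 + 1) = N + 2 := by ring
        rw [e] at hc
        linear_combination (-q r ^ (-((N : ℤ) + 1))) * hc -
          qCurly r 1 ^ 2 * thetaCoeff r (N + 1) * this
      have hs := qExpTerm_step h (N := N) (by omega)
      have hne : qCurly r (N + 2) * q r ^ (-((N : ℤ) + 1)) ≠ 0 := by
        refine mul_ne_zero ?_ (zpow_ne_zero _ hq)
        rw [Ne, qCurly_eq_zero_iff (by omega)]
        intro h
        have := Int.le_of_dvd (by omega) h
        omega
      have hS : qExpTerm r X Y (N + 2) = thetaCoeff r (N + 2) • (X ^ (N + 2) + Y ^ (N + 2)) +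
          ∑ p ∈ Finset.HasAntidiagonal.antidiagonal N,
          (thetaCoeff r (p.1 + 1) * thetaCoeff r (p.2 + 1)) •
            (X ^ (p.1 + 1) * Y ^ (p.2 + 1)) := by
        rw [qExpTerm, Finset.Nat.sum_antidiagonal_succ, Finset.Nat.sum_antidiagonal_succ']
        simp only [thetaCoeff_zero, one_mul, mul_one, pow_zero, smul_add]
        abel
      rw [← smul_right_injective A hne |>.eq_iff]
      rw [smul_smul, ← hc', ← smul_smul, pow_succ' (X + Y), ← mul_smul_comm, ih, hs, hc',
        ← smul_smul, ← smul_add, ← hS]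

/-- The Frobenius property of `q`-commuting elements at a root of unity. -/
lemma add_pow_of_qcomm {r : ℕ} (hr : 1 ≤ r) {X Y : A} (h : Y * X = q r ^ (-2 : ℤ) • (X * Y)) :
    (X + Y) ^ r = X ^ r + Y ^ r := by
  obtain rfl | ⟨N, rfl⟩ : r = 1 ∨ ∃ N, r = N + 2 := by
    rcases r with _ | _ | N
    · omega
    · simp
    · exact Or.inr ⟨N, rfl⟩
  · simp
  · have h1 := qCurly_one_ne_zero (r := N + 2) (by omega)
    have hs := qExpTerm_step h (N := N) (by omega)
    -- Here the exponent reached is r itself: all mixed terms carry the factor {r} = 0 and only the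
    -- pure powers survive.
    have h0 : qCurly (N + 2) (N + 2) = 0 := by
      rw [qCurly_eq_zero_iff (by omega)]
      push_cast
      exact dvd_rfl
    rw [← thetaCoeff_smul_add_pow h (by omega), mul_smul_comm, ← pow_succ', smul_smul, h0,
      zero_mul, zero_smul, add_zero] at hs
    exact smul_right_injective A
      (mul_ne_zero (pow_ne_zero 2 h1) (thetaCoeff_ne_zero (by omega : N + 1 < N + 2))) hs

/-- The nilpotent part `∑_a c_a e^a f^a` of the `R`-matrix. -/
def theta (r : ℕ) (e f : A) : A := ∑ a ∈ Finset.range r, thetaCoeff r a • (e ^ a * f ^ a)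

/-- Multiplicativity of the `q`-exponential. -/
lemma theta_mul_theta {r : ℕ} {x y f : A} (hxy : y * x = q r ^ (-2 : ℤ) • (x * y))
    (hx : Commute x f) (hy : Commute y f) (hf : f ^ r = 0) :
    theta r x f * theta r y f = theta r (x + y) f := by
  have hXY : (y * f) * (x * f) = q r ^ (-2 : ℤ) • ((x * f) * (y * f)) := by
    calc (y * f) * (x * f) = (y * x) * (f * f) := by
          rw [mul_assoc, ← mul_assoc f, hx.symm.eq]; simp only [mul_assoc]
      _ = q r ^ (-2 : ℤ) • ((x * y) * (f * f)) := by rw [hxy, smul_mul_assoc]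
      _ = _ := by
        congr 1
        rw [mul_assoc x f, ← mul_assoc f y, hy.symm.eq]; simp only [mul_assoc]
  have hterm : ∀ a b, (x ^ a * f ^ a) * (y ^ b * f ^ b) = x ^ a * y ^ b * f ^ (a + b) := by
    intro a b
    rw [mul_assoc, ← mul_assoc (f ^ a), ((hy.pow_pow b a).symm).eq, pow_add]
    simp only [mul_assoc]
  have hR : ∀ N ∈ Finset.range r, thetaCoeff r N • ((x + y) ^ N * f ^ N) =
      ∑ p ∈ Finset.HasAntidiagonal.antidiagonal N, (thetaCoeff r p.1 * thetaCoeff r p.2) •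
        (x ^ p.1 * y ^ p.2 * f ^ (p.1 + p.2)) := by
    intro N hN
    rw [← smul_mul_assoc, thetaCoeff_smul_add_pow hxy (Finset.mem_range.1 hN), qExpTerm,
      Finset.sum_mul]
    refine Finset.sum_congr rfl fun p hp => ?_
    rw [Finset.HasAntidiagonal.mem_antidiagonal] at hp
    rw [hp, smul_mul_assoc]
  rw [theta, theta, theta, Finset.sum_mul_sum, Finset.sum_congr rfl hR,
    ← Finset.sum_product', Finset.sum_sigma']
  symm
  refine Finset.sum_of_injOn (fun s => s.2) ?_ ?_ ?_ ?_
  · rintro ⟨N, p⟩ h1 ⟨N', p'⟩ h2 h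
    simp only [Finset.coe_sigma, Set.mem_sigma_iff, Finset.mem_coe, Finset.HasAntidiagonal.mem_antidiagonal] at h1 h2
    dsimp at h
    subst h
    obtain rfl : N = N' := by omega
    rfl
  · rintro ⟨N, p⟩ h1
    simp only [Finset.coe_sigma, Set.mem_sigma_iff, Finset.mem_coe, Finset.HasAntidiagonal.mem_antidiagonal,
      Finset.mem_range, Finset.coe_product, Set.mem_prod] at h1 ⊢
    omega
  -- Pairs with a + b ≥ r do not occur on the side of the sum x + y, but their terms contain f^(a+b)
  -- = 0.
  · rintro ⟨a, b⟩ h1 h2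
    have : r ≤ a + b := by
      by_contra hlt
      refine h2 ⟨⟨a + b, (a, b)⟩, ?_, rfl⟩
      simp; omega
    rw [smul_mul_smul_comm, hterm, pow_eq_zero_of_le this hf, mul_zero, smul_zero]
  · rintro ⟨N, p⟩ -
    rw [smul_mul_smul_comm, hterm]

/-- The usual rank-one commutation formula, by induction on the exponent. It is stated for abstract
K and K' because the two coproducts use different tensor positions. -/
lemma qcomm_mul_pow {r : ℕ} (hr : 2 ≤ r) {e f K K' : A} (hK : K * f = q r ^ (-2 : ℤ) • (f * K))
    (hK' : K' * f = q r ^ (2 : ℤ) • (f * K'))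
    (hef : e * f = f * e + (1 / qCurly r 1) • (K - K')) (a : ℕ) :
    e * f ^ (a + 1) = f ^ (a + 1) * e + (qCurly r (a + 1) / qCurly r 1 ^ 2) •
      (f ^ a * (q r ^ (-(a : ℤ)) • K - q r ^ (a : ℤ) • K')) := by
  have h1 := qCurly_one_ne_zero hr
  have hq := q_ne_zero r
  induction a with
  | zero =>
    simp only [zero_add, pow_one, hef, Nat.cast_zero, pow_zero, neg_zero, zpow_zero, one_smul,
      one_mul]
    congr 2
    field_simp
  | succ a ih =>
    rw [pow_succ f (a + 1), ← mul_assoc, ih, add_mul, mul_assoc, hef, mul_add, ← mul_assoc,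
      add_assoc]
    congr 1
    rw [smul_mul_assoc, mul_assoc, sub_mul, smul_mul_assoc, smul_mul_assoc, hK, hK', mul_sub,
      mul_smul_comm, mul_sub, mul_sub]
    simp only [mul_smul_comm, smul_smul, ← mul_assoc, ← pow_succ, smul_sub]
    rw [sub_add_sub_comm, ← add_smul, ← add_smul]
    congr 2
    · have : qCurly r 1 + qCurly r (a + 1) * q r ^ (-(a : ℤ)) * q r ^ (-2 : ℤ) =
          qCurly r ((a + 1 : ℕ) + 1) * q r ^ (-((a + 1 : ℕ) : ℤ)) := by
        simp only [qCurly, sub_mul, ← zpow_add₀ hq]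
        push_cast
        ring_nf
      rw [div_mul_eq_mul_div, div_mul_eq_mul_div, div_mul_eq_mul_div, ← this]
      field_simp
    · have : qCurly r 1 + qCurly r (a + 1) * q r ^ (a : ℤ) * q r ^ (2 : ℤ) =
          qCurly r ((a + 1 : ℕ) + 1) * q r ^ ((a + 1 : ℕ) : ℤ) := by
        simp only [qCurly, sub_mul, ← zpow_add₀ hq]
        push_cast
        ring_nf
      rw [div_mul_eq_mul_div, div_mul_eq_mul_div, div_mul_eq_mul_div, ← this]
      field_simp

/-- The nilpotent part of the `R`-matrix intertwines the two coproducts of `e`. -/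
lemma theta_intertwine {r : ℕ} (hr : 1 ≤ r) {e e' f K K' : A}
    (hK : K * f = q r ^ (-2 : ℤ) • (f * K)) (hK' : K' * f = q r ^ (2 : ℤ) • (f * K'))
    (hef : e * f = f * e + (1 / qCurly r 1) • (K - K')) (hr' : e' ^ r = 0)
    (h1 : Commute e' e) (h2 : Commute e' f) (h3 : Commute e' K') :
    (e' * K' + e) * theta r e' f = theta r e' f * (e + e' * K) := by
  obtain rfl | ⟨N, rfl⟩ : r = 1 ∨ ∃ N, r = N + 2 := by
    rcases r with _ | _ | N
    · omega
    · simp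
    · exact Or.inr ⟨N, rfl⟩
  -- For r = 1 the scalar {1} vanishes, but then e' = 0 and `theta` is 1.
  · rw [pow_one] at hr'
    simp [hr', theta, thetaCoeff_zero]
  set r := N + 2 with hrN
  have hr2 : 2 ≤ r := by omega
  have hq := q_ne_zero r
  have h1' := qCurly_one_ne_zero hr2
  -- Moving e past f^(a+1) and using the coefficient recursion brings the coefficient down to index
  -- a. The K' part cancels against `hL`, the K part is `hR`; in both of these the top term dies
  -- because e'^r = 0.
  have hE : e * theta r e' f = theta r e' f * e + ∑ a ∈ Finset.range (N + 1),
      thetaCoeff r a • (e' ^ (a + 1) * (f ^ a * (K - q r ^ (2 * a : ℤ) • K'))) := by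
    rw [theta, Finset.mul_sum, Finset.sum_mul, hrN, Finset.sum_range_succ' _ (N + 1),
      Finset.sum_range_succ' _ (N + 1)]
    simp only [pow_zero, mul_one, one_mul, smul_mul_assoc, mul_smul_comm]
    rw [add_right_comm, ← Finset.sum_add_distrib]
    congr 1
    refine Finset.sum_congr rfl fun a ha => ?_
    rw [Finset.mem_range] at ha
    have hc := thetaCoeff_succ (r := r) (a := a) (by omega)
    rw [← mul_assoc, ← (h1.pow_left (a + 1)).eq, mul_assoc,
      qcomm_mul_pow (r := N + 2) hr2 hK hK' hef a, mul_add, smul_add]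
    congr 1
    · rw [mul_assoc]
    · simp only [mul_smul_comm, smul_smul, mul_sub, smul_sub]
      have hc' : thetaCoeff r (a + 1) * (qCurly r (a + 1) / qCurly r 1 ^ 2) =
          thetaCoeff r a * q r ^ (a : ℤ) := by
        rw [mul_div_assoc', hc]; field_simp
      have e1 : q r ^ (a : ℤ) * q r ^ (-(a : ℤ)) = 1 := by rw [← zpow_add₀ hq]; simp
      have e2 : q r ^ (a : ℤ) * q r ^ (a : ℤ) = q r ^ (2 * a : ℤ) := by
        rw [← zpow_add₀ hq]; ring_nf
      congr 2
      · linear_combination q r ^ (-(a : ℤ)) * hc' + thetaCoeff r a * e1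
      · linear_combination q r ^ (a : ℤ) * hc' + thetaCoeff r a * e2
  have hL : e' * K' * theta r e' f = ∑ a ∈ Finset.range (N + 1),
      thetaCoeff r a • (e' ^ (a + 1) * (f ^ a * (q r ^ (2 * a : ℤ) • K'))) := by
    rw [theta, Finset.mul_sum, hrN, Finset.sum_range_succ]
    have : ∀ a : ℕ, e' * K' * (e' ^ a * f ^ a) =
        e' ^ (a + 1) * (f ^ a * (q r ^ (2 * a : ℤ) • K')) := by
      intro a
      rw [mul_assoc, ← mul_assoc K', ← (h3.pow_left a).eq, mul_assoc,
        mul_pow_of_mul_eq_smul hK', ← zpow_natCast (q r ^ (2 : ℤ)), ← zpow_mul, ← mul_assoc,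
        ← pow_succ', mul_smul_comm (q r ^ _) (f ^ a) K']
    rw [Finset.sum_congr rfl fun a _ => by rw [mul_smul_comm, this a]]
    rw [mul_smul_comm, this]
    rw [show N + 1 + 1 = r from rfl, hr', zero_mul, smul_zero, add_zero]
  have hR : theta r e' f * (e' * K) = ∑ a ∈ Finset.range (N + 1),
      thetaCoeff r a • (e' ^ (a + 1) * (f ^ a * K)) := by
    rw [theta, Finset.sum_mul, hrN, Finset.sum_range_succ]
    have : ∀ a : ℕ, e' ^ a * f ^ a * (e' * K) = e' ^ (a + 1) * (f ^ a * K) := by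
      intro a
      rw [mul_assoc, ← mul_assoc (f ^ a), ← (h2.pow_right a).eq, ← mul_assoc, ← mul_assoc,
        ← pow_succ, mul_assoc]
    simp only [smul_mul_assoc, this]
    rw [show N + 1 + 1 = r from rfl, hr', zero_mul, smul_zero, add_zero]
  rw [add_mul, mul_add, hE, hL, hR, add_left_comm, ← Finset.sum_add_distrib]
  congr 1
  refine Finset.sum_congr rfl fun a _ => ?_
  rw [← smul_add, ← mul_add, ← mul_add, add_sub_cancel]

/-- As e and f' commute, `theta` is symmetric in them, so the statement for F is the one for E with
the roles of the two generators, and of K and K', exchanged. -/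
lemma theta_intertwine' {r : ℕ} (hr : 1 ≤ r) {e f f' K K' : A}
    (hK : K * e = q r ^ (2 : ℤ) • (e * K)) (hK' : K' * e = q r ^ (-2 : ℤ) • (e * K'))
    (hef : e * f = f * e + (1 / qCurly r 1) • (K - K')) (hr' : f' ^ r = 0)
    (h1 : Commute f' f) (h2 : Commute f' e) (h3 : Commute f' K) :
    (f + f' * K) * theta r e f' = theta r e f' * (f + f' * K') := by
  have h : theta r e f' = theta r f' e := by
    refine Finset.sum_congr rfl fun a _ => ?_
    rw [(h2.pow_pow a a).eq]
  rw [h, add_comm f, theta_intertwine hr hK' hK ?_ hr' h1 h2 h3]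
  rw [hef, ← neg_sub K K', smul_neg, add_neg_cancel_right]

/-- The summand a = 0 is 1, and the others form a multiple of the nilpotent element ef by a
polynomial in ef. -/
lemma isUnit_theta {r : ℕ} (hr : 1 ≤ r) {e f : A} (h : Commute e f) (he : e ^ r = 0) :
    IsUnit (theta r e f) := by
  obtain ⟨N, rfl⟩ : ∃ N, r = N + 1 := ⟨r - 1, by omega⟩
  have : theta (N + 1) e f = 1 + (e * f) * ∑ a ∈ Finset.range N,
      thetaCoeff (N + 1) (a + 1) • (e * f) ^ a := by
    rw [theta, Finset.sum_range_succ', Finset.mul_sum, add_comm]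
    simp [thetaCoeff_zero, h.mul_pow, pow_succ', mul_assoc, ← (h.pow_left _).left_comm]
  rw [this]
  refine IsNilpotent.isUnit_one_add ?_
  refine (Commute.isNilpotent_mul_right ?_ ⟨N + 1, by rw [h.mul_pow, he, zero_mul]⟩)
  refine Commute.sum_right _ _ _ fun a _ => ?_
  exact ((Commute.refl _).pow_right a).smul_right _

end QExp

end

section

/-! ### The operators on a single Steinberg module -/

lemma u_of_lt {r m : ℕ} (h : m < r) : u r m = Pi.single ⟨m, h⟩ 1 := dif_pos h

lemma u_of_le {r m : ℕ} (h : r ≤ m) : u r m = 0 := dif_neg (by omega)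

lemma u_coe {r : ℕ} (m : Fin r) : u r m = Pi.single m 1 := u_of_lt m.2

lemma V_hom_ext {r : ℕ} {N : Type*} [AddCommMonoid N] [Module ℂ N] {f g : V r →ₗ[ℂ] N}
    (h : ∀ m < r, f (u r m) = g (u r m)) : f = g := by
  refine (Pi.basisFun ℂ (Fin r)).ext fun m => ?_
  rw [Pi.basisFun_apply, ← u_coe]
  exact h m m.2

lemma constr_u {r : ℕ} {N : Type*} [AddCommMonoid N] [Module ℂ N] (g : ℕ → N) {m : ℕ}
    (h : m < r) : (Pi.basisFun ℂ (Fin r)).constr ℂ (fun m : Fin r => g m) (u r m) = g m := by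
  rw [u_of_lt h, ← Pi.basisFun_apply, Module.Basis.constr_basis]

lemma steinberg_E_u (r : ℕ) (α : ℂ) {m : ℕ} (h : m < r) :
    (steinberg r α).E (u r m) = if m = 0 then 0 else u r (m - 1) :=
  constr_u (fun m => if m = 0 then 0 else u r (m - 1)) h

lemma steinberg_F_u (r : ℕ) (α : ℂ) (m : ℕ) :
    (steinberg r α).F (u r m) = (α ^ 2 * qInt r (m + 1) * qInt r (r - 1 - m)) • u r (m + 1) := by
  by_cases h : m < r
  · exact constr_u (fun m => (α ^ 2 * qInt r (m + 1) * qInt r (r - 1 - m)) • u r (m + 1)) h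
  · rw [u_of_le (by omega), u_of_le (by omega), map_zero, smul_zero]

lemma steinberg_k_u (r : ℕ) (α : ℂ) (m : ℕ) :
    (steinberg r α).k (u r m) = (α * qHalf r ^ ((r : ℤ) - 1 - 2 * m)) • u r m := by
  by_cases h : m < r
  · exact constr_u (fun m => (α * qHalf r ^ ((r : ℤ) - 1 - 2 * m)) • u r m) h
  · rw [u_of_le (by omega), map_zero, smul_zero]

lemma H₁_u (r : ℕ) (m : ℕ) : H₁ r (u r m) = ((r : ℂ) - 1 - 2 * m) • u r m := by
  by_cases h : m < r
  · exact constr_u (fun m => ((r : ℂ) - 1 - 2 * m) • u r m) h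
  · rw [u_of_le (by omega), map_zero, smul_zero]

/-- The operator `E` on `V_{r-1}`. -/
abbrev opE (r : ℕ) : Module.End ℂ (V r) := (steinberg r 1).E

/-- The operator `F` on `V_{r-1}`. -/
abbrev opF (r : ℕ) : Module.End ℂ (V r) := (steinberg r 1).F

/-- The operator `k^z` on `V_{r-1}`. -/
def kz (r : ℕ) (z : ℤ) : Module.End ℂ (V r) :=
  (Pi.basisFun ℂ (Fin r)).constr ℂ fun m : Fin r => qHalf r ^ (z * ((r : ℤ) - 1 - 2 * m)) • u r m

lemma kz_u (r : ℕ) (z : ℤ) (m : ℕ) :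
    kz r z (u r m) = qHalf r ^ (z * ((r : ℤ) - 1 - 2 * m)) • u r m := by
  by_cases h : m < r
  · exact constr_u (fun m => qHalf r ^ (z * ((r : ℤ) - 1 - 2 * m)) • u r m) h
  · rw [u_of_le (by omega), map_zero, smul_zero]

lemma kz_zero (r : ℕ) : kz r 0 = 1 :=
  V_hom_ext fun m _ => by rw [kz_u]; simp

lemma kz_add (r : ℕ) (x y : ℤ) : kz r (x + y) = kz r x * kz r y :=
  V_hom_ext fun m _ => by
    rw [Module.End.mul_apply, kz_u, kz_u, map_smul, kz_u, smul_smul,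
      ← zpow_add₀ (qHalf_ne_zero r)]
    ring_nf

lemma kz_comm (r : ℕ) (x y : ℤ) : Commute (kz r x) (kz r y) := by
  rw [Commute, SemiconjBy, ← kz_add, ← kz_add, add_comm]

lemma steinberg_k (r : ℕ) : (steinberg r 1).k = kz r 1 :=
  V_hom_ext fun m _ => by rw [kz_u, steinberg_k_u, one_mul, one_mul]

lemma kz_pow (r : ℕ) (z : ℤ) (m : ℕ) : kz r z ^ m = kz r (m * z) := by
  induction m with
  | zero => simp [kz_zero]
  | succ m ih => rw [pow_succ, ih, ← kz_add]; congr 1; push_cast; ring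

lemma steinberg_k_pow (r m : ℕ) : (steinberg r 1).k ^ m = kz r m := by
  rw [steinberg_k, kz_pow, mul_one]

lemma kz_four_mul {r : ℕ} (hr : 1 ≤ r) (z : ℤ) : kz r (4 * r * z) = 1 :=
  V_hom_ext fun m _ => by
    rw [kz_u, (qHalf_zpow_eq_one_iff hr _).2 ⟨z * ((r : ℤ) - 1 - 2 * m), by ring⟩]
    simp

lemma steinberg_k_inv_sq {r : ℕ} (hr : 1 ≤ r) :
    ((steinberg r 1).k ^ (4 * r - 1)) ^ 2 = kz r (-2) := by
  rw [steinberg_k_pow, kz_pow, show (((2 : ℕ) : ℤ) * ((4 * r - 1 : ℕ) : ℤ)) = 4 * r * 2 + (-2) by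
    push_cast [Nat.cast_sub (by omega : 1 ≤ 4 * r)]; ring, kz_add, kz_four_mul hr, one_mul]

lemma kz_mul_E (r : ℕ) (z : ℤ) : kz r z * opE r = qHalf r ^ (2 * z) • (opE r * kz r z) :=
  V_hom_ext fun m hm => by
    rw [Module.End.mul_apply, LinearMap.smul_apply, Module.End.mul_apply, kz_u, map_smul,
      steinberg_E_u r 1 hm, smul_smul, ← zpow_add₀ (qHalf_ne_zero r)]
    split_ifs with h
    · simp
    · rw [kz_u]
      congr 2
      push_cast [Nat.cast_sub (by omega : 1 ≤ m)]
      ring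

lemma kz_mul_F (r : ℕ) (z : ℤ) : kz r z * opF r = qHalf r ^ (-2 * z) • (opF r * kz r z) :=
  V_hom_ext fun m hm => by
    rw [Module.End.mul_apply, LinearMap.smul_apply, Module.End.mul_apply, kz_u, map_smul,
      steinberg_F_u r 1, map_smul, kz_u, smul_comm (qHalf r ^ (-2 * z)), smul_smul, smul_smul,
      smul_smul, mul_comm, mul_right_comm, ← zpow_add₀ (qHalf_ne_zero r)]
    congr 3
    push_cast
    ring

lemma H₁_mul_E (r : ℕ) : H₁ r * opE r = opE r * H₁ r + (2 : ℂ) • opE r :=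
  V_hom_ext fun m hm => by
    simp only [Module.End.mul_apply, LinearMap.add_apply, LinearMap.smul_apply]
    rw [H₁_u, map_smul, steinberg_E_u r 1 hm]
    split_ifs with h
    · simp
    · rw [H₁_u, ← add_smul]
      congr 1
      push_cast [Nat.cast_sub (by omega : 1 ≤ m)]
      ring

lemma H₁_mul_F (r : ℕ) : H₁ r * opF r = opF r * H₁ r + (-2 : ℂ) • opF r :=
  V_hom_ext fun m hm => by
    simp only [Module.End.mul_apply, LinearMap.add_apply, LinearMap.smul_apply]
    rw [H₁_u, map_smul, steinberg_F_u r 1, map_smul, H₁_u, smul_smul, smul_smul, smul_smul,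
      ← add_smul]
    congr 1
    push_cast
    ring

lemma H₁_comm_kz (r : ℕ) (z : ℤ) : Commute (H₁ r) (kz r z) :=
  V_hom_ext fun m hm => by
    rw [Module.End.mul_apply, Module.End.mul_apply, kz_u, H₁_u, map_smul, map_smul, kz_u, H₁_u,
      smul_comm]

/-- On u_m this is the identity {m+1}{r-1-m} - {m}{r-m} = {1}{r-1-2m}. The ends of the basis cause
no defect since the coefficient of F vanishes at m = r - 1 and [0] = 0. For r = 1 both quotients by
{1} read as 0. -/
lemma E_mul_F {r : ℕ} (hr : 1 ≤ r) :
    opE r * opF r = opF r * opE r + (1 / qCurly r 1) • (kz r 2 - kz r (-2)) :=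
  V_hom_ext fun m hm => by
    have hq := q_ne_zero r
    have key : qCurly r (m + 1) * qCurly r (r - 1 - m) - qCurly r m * qCurly r (r - m) =
        qCurly r 1 * qCurly r (r - 1 - 2 * m) := by
      simp only [qCurly, sub_mul, mul_sub, ← zpow_add₀ hq]
      ring_nf
    have key2 : qInt r (m + 1) * qInt r (r - 1 - m) - qInt r m * qInt r (r - m) =
        1 / qCurly r 1 * qCurly r (r - 1 - 2 * m) := by
      simp only [qInt]
      by_cases h : qCurly r 1 = 0
      · simp [h]
      · field_simp
        linear_combination key
    simp only [Module.End.mul_apply, LinearMap.add_apply, LinearMap.smul_apply,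
      LinearMap.sub_apply, kz_u]
    rw [steinberg_F_u, map_smul, steinberg_E_u r 1 hm, ← sub_smul, smul_smul]
    have h3 : qHalf r ^ (2 * ((r : ℤ) - 1 - 2 * m)) - qHalf r ^ (-2 * ((r : ℤ) - 1 - 2 * m)) =
        qCurly r (r - 1 - 2 * m) := by
      rw [qCurly, q_zpow_eq, q_zpow_eq]; ring_nf
    rw [h3, ← key2, sub_smul]
    have h4 : (opF r) (if m = 0 then 0 else u r (m - 1)) =
        (qInt r m * qInt r (r - m)) • u r m := by
      split_ifs with h
      · subst h
        simp [qInt, qCurly]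
      · rw [steinberg_F_u, show m - 1 + 1 = m by omega]
        congr 1
        push_cast [Nat.cast_sub (by omega : 1 ≤ m)]
        ring_nf
    rw [h4, add_sub_cancel]
    by_cases hm' : m + 1 < r
    · rw [steinberg_E_u r 1 hm']
      simp
    · obtain rfl : r = m + 1 := by omega
      rw [u_of_le le_rfl]
      simp [qInt, qCurly]

lemma opE_pow_u (r a : ℕ) {m : ℕ} (h : m < r) :
    (opE r ^ a) (u r m) = if a ≤ m then u r (m - a) else 0 := by
  induction a with
  | zero => simp
  | succ a ih =>
    rw [pow_succ', Module.End.mul_apply, ih]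
    split_ifs with h1 h2 h3
    · rw [steinberg_E_u r 1 (by omega), if_neg (by omega), Nat.sub_sub]
    · rw [steinberg_E_u r 1 (by omega), if_pos (by omega)]
    · omega
    · simp

lemma opE_pow (r : ℕ) : opE r ^ r = 0 :=
  V_hom_ext fun m hm => by rw [opE_pow_u r r hm, if_neg (by omega), LinearMap.zero_apply]

lemma opF_pow_u (r a m : ℕ) : (opF r ^ a) (u r m) =
    (∏ s ∈ Finset.range a, qInt r (m + s + 1) * qInt r (r - 1 - (m + s))) • u r (m + a) := by
  induction a with
  | zero => simp
  | succ a ih =>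
    rw [pow_succ', Module.End.mul_apply, ih, map_smul, steinberg_F_u, smul_smul,
      Finset.prod_range_succ]
    push_cast
    simp [add_assoc]

lemma opF_pow (r : ℕ) : opF r ^ r = 0 :=
  V_hom_ext fun m hm => by
    rw [opF_pow_u, u_of_le (by omega), smul_zero, LinearMap.zero_apply]

/-! ### Operators on a single position of a tensor power -/

variable {r n : ℕ}

lemma tmap_mul (f g : Fin n → Module.End ℂ (V r)) :
    (PiTensorProduct.map (f * g) : Module.End ℂ (TP r n)) =
      PiTensorProduct.map f * PiTensorProduct.map g := PiTensorProduct.map_mul f g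

/-- The operator `A` in position `p`, as an algebra homomorphism. -/
def slot (p : Fin n) : Module.End ℂ (V r) →ₐ[ℂ] Module.End ℂ (TP r n) :=
  AlgHom.ofLinearMap
    { toFun := fun A => PiTensorProduct.map (Pi.mulSingle p A)
      map_add' := fun A B => PiTensorProduct.map_update_add _ _ _ _
      map_smul' := fun c A => PiTensorProduct.map_update_smul _ _ _ _ }
    (by
      change PiTensorProduct.map (Pi.mulSingle p 1 : Fin n → Module.End ℂ (V r)) = _
      rw [Pi.mulSingle_one]
      exact PiTensorProduct.map_one)
    (fun A B => by
      change PiTensorProduct.map (Pi.mulSingle p (A * B) : Fin n → Module.End ℂ (V r)) = _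
      rw [Pi.mulSingle_mul]
      exact tmap_mul _ _)

lemma slot_eq (p : Fin n) (A : Module.End ℂ (V r)) :
    slot p A = PiTensorProduct.map (Pi.mulSingle p A : Fin n → Module.End ℂ (V r)) := rfl

lemma tmap_commute {f g : Fin n → Module.End ℂ (V r)} (h : ∀ p, Commute (f p) (g p)) :
    Commute (PiTensorProduct.map f : Module.End ℂ (TP r n)) (PiTensorProduct.map g) := by
  rw [Commute, SemiconjBy, ← tmap_mul, ← tmap_mul]
  congr 1
  exact funext h

lemma slot_commute {p p' : Fin n} (h : p ≠ p') (A B : Module.End ℂ (V r)) :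
    Commute (slot p A) (slot p' B) :=
  tmap_commute fun i => by
    by_cases hi : i = p
    · subst hi
      rw [Pi.mulSingle_eq_of_ne h]
      exact Commute.one_right _
    · rw [Pi.mulSingle_eq_of_ne hi]
      exact Commute.one_left _

lemma slot_commute_tmap {p : Fin n} {h : Fin n → Module.End ℂ (V r)} (hp : h p = 1)
    (A : Module.End ℂ (V r)) : Commute (PiTensorProduct.map h) (slot p A) :=
  tmap_commute fun i => by
    by_cases hi : i = p
    · subst hi; rw [hp]; exact Commute.one_left _
    · rw [Pi.mulSingle_eq_of_ne hi]; exact Commute.one_right _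

lemma slot_commute_tmap' {p : Fin n} {h : Fin n → Module.End ℂ (V r)}
    {A : Module.End ℂ (V r)} (hp : Commute (h p) A) : Commute (PiTensorProduct.map h) (slot p A) :=
  tmap_commute fun i => by
    by_cases hi : i = p
    · subst hi; rw [Pi.mulSingle_eq_same]; exact hp
    · rw [Pi.mulSingle_eq_of_ne hi]; exact Commute.one_right _

/-- Splitting off one position of a pure tensor of operators. -/
lemma tmap_eq_mul_slot (g : Fin n → Module.End ℂ (V r)) (a : Fin n) :
    (PiTensorProduct.map g : Module.End ℂ (TP r n)) =
      PiTensorProduct.map (Function.update g a 1) * slot a (g a) := by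
  rw [slot_eq, ← tmap_mul]
  congr 1
  ext1 i
  by_cases hi : i = a
  · subst hi; simp
  · simp [hi]

/-- The standard basis of a tensor power. -/
def tbasis (r n : ℕ) : Module.Basis (Fin n → Fin r) ℂ (TP r n) :=
  Basis.piTensorProduct fun _ => Pi.basisFun ℂ (Fin r)

lemma tbasis_apply (f : Fin n → Fin r) :
    tbasis r n f = PiTensorProduct.tprod ℂ fun p => u r (f p) := by
  rw [tbasis, Basis.piTensorProduct_apply]
  simp only [Pi.basisFun_apply, u_coe]

lemma tmap_tbasis_of_eigen {g : Fin n → Module.End ℂ (V r)} {f : Fin n → Fin r} {c : Fin n → ℂ}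
    (h : ∀ p, g p (u r (f p)) = c p • u r (f p)) :
    (PiTensorProduct.map g : Module.End ℂ (TP r n)) (tbasis r n f) =
      (∏ p, c p) • tbasis r n f := by
  rw [tbasis_apply, PiTensorProduct.map_tprod]
  simp only [h]
  exact MultilinearMap.map_smul_univ _ _ _

lemma slot_tbasis_of_eigen (p : Fin n) {A : Module.End ℂ (V r)} {f : Fin n → Fin r} {c : ℂ}
    (h : A (u r (f p)) = c • u r (f p)) : slot p A (tbasis r n f) = c • tbasis r n f := by
  rw [slot_eq, tmap_tbasis_of_eigen (c := fun i => if i = p then c else 1)]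
  · simp
  · intro i
    by_cases hi : i = p
    · subst hi; simp [h]
    · simp [hi]

lemma slot_kz_tbasis (p : Fin n) (z : ℤ) (f : Fin n → Fin r) :
    slot p (kz r z) (tbasis r n f) = qHalf r ^ (z * ((r : ℤ) - 1 - 2 * (f p : ℕ))) • tbasis r n f :=
  slot_tbasis_of_eigen p (kz_u r z _)

/-! ### The Cartan part of the `R`-matrix -/

/-- The Cartan part of the `R`-matrix in positions `a` and `b`. -/
def cartan (r : ℕ) {n : ℕ} (a b : Fin n) : Module.End ℂ (TP r n) :=
  (1 / (4 * r : ℂ)) • ∑ m ∈ Finset.range (4 * r), ∑ m' ∈ Finset.range (4 * r),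
    qHalf r ^ (-((m : ℤ) * m')) • (slot a (kz r m) * slot b (kz r m'))

lemma sum_qHalf_zpow (hr : 1 ≤ r) (x : ℤ) :
    ∑ m ∈ Finset.range (4 * r), qHalf r ^ ((m : ℤ) * x) =
      if (4 * r : ℤ) ∣ x then (4 * r : ℂ) else 0 := by
  have h : ∀ m : ℕ, qHalf r ^ ((m : ℤ) * x) = (qHalf r ^ x) ^ m := fun m => by
    rw [mul_comm, zpow_mul, zpow_natCast]
  simp only [h]
  split_ifs with hd
  · rw [(qHalf_zpow_eq_one_iff hr x).2 hd]
    simp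
  · have hne : qHalf r ^ x ≠ 1 := fun h => hd ((qHalf_zpow_eq_one_iff hr x).1 h)
    rw [geom_sum_eq hne, ← zpow_natCast, ← zpow_mul, mul_comm,
      (qHalf_zpow_eq_one_iff hr _).2 ⟨x, by push_cast; ring⟩]
    simp

/-- Orthogonality of characters modulo 4r: the sum over m selects the single m' congruent to x, and
for it the remaining factor equals the one with exponent xy. -/
lemma gauss_sum_qHalf (hr : 1 ≤ r) (x y : ℤ) :
    (1 / (4 * r : ℂ)) * ∑ m ∈ Finset.range (4 * r), ∑ m' ∈ Finset.range (4 * r),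
      qHalf r ^ (-((m : ℤ) * m')) * (qHalf r ^ (m * x) * qHalf r ^ (m' * y)) =
      qHalf r ^ (x * y) := by
  have hr0 : (4 * r : ℂ) ≠ 0 := by
    have : (r : ℂ) ≠ 0 := by exact_mod_cast (by omega : r ≠ 0)
    exact mul_ne_zero (by norm_num) this
  have hq := qHalf_ne_zero r
  rw [Finset.sum_comm]
  have : ∀ m' ∈ Finset.range (4 * r), ∑ m ∈ Finset.range (4 * r),
      qHalf r ^ (-((m : ℤ) * m')) * (qHalf r ^ (m * x) * qHalf r ^ (m' * y)) =
      if m' = (x % (4 * r)).toNat then (4 * r : ℂ) * qHalf r ^ (x * y) else 0 := by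
    intro m' hm'
    rw [Finset.mem_range] at hm'
    have h1 : ∀ m : ℕ, qHalf r ^ (-((m : ℤ) * m')) * (qHalf r ^ (m * x) * qHalf r ^ (m' * y)) =
        qHalf r ^ ((m : ℤ) * (x - m')) * qHalf r ^ (m' * y) := fun m => by
      rw [← mul_assoc, ← zpow_add₀ hq]; ring_nf
    simp only [h1]
    rw [← Finset.sum_mul, sum_qHalf_zpow hr]
    have hx0 := Int.emod_nonneg x (by omega : (4 * r : ℤ) ≠ 0)
    have hx1 := Int.emod_lt_of_pos x (by omega : (0 : ℤ) < 4 * r)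
    have hdm := Int.mul_ediv_add_emod x (4 * r)
    have hiff : (4 * r : ℤ) ∣ x - m' ↔ m' = (x % (4 * r)).toNat := by
      rw [← Int.emod_emod_of_dvd x dvd_rfl, ← Int.emod_eq_emod_iff_emod_sub_eq_zero.trans
        (Int.dvd_iff_emod_eq_zero).symm]
      rw [Int.emod_emod_of_dvd x dvd_rfl,
        Int.emod_eq_of_lt (a := (m' : ℤ)) (by omega) (by omega)]
      omega
    by_cases hd : (4 * r : ℤ) ∣ x - m'
    · rw [if_pos hd, if_pos (hiff.1 hd)]
      congr 1
      rw [qHalf_zpow_eq_iff hr]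
      obtain ⟨c, hc⟩ := hd
      exact ⟨-c * y, by linear_combination (-y) * hc⟩
    · rw [if_neg hd, if_neg (fun h => hd (hiff.2 h)), zero_mul]
  rw [Finset.sum_congr rfl this, Finset.sum_ite_eq' (Finset.range (4 * r)), if_pos]
  · rw [← mul_assoc, one_div_mul_cancel hr0, one_mul]
  · have hx0 := Int.emod_nonneg x (by omega : (4 * r : ℤ) ≠ 0)
    have hx1 := Int.emod_lt_of_pos x (by omega : (0 : ℤ) < 4 * r)
    rw [Finset.mem_range]
    omega

lemma slot_kz_apply_of_eigen (a : Fin n) {v : TP r n} {x : ℤ}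
    (h : slot a (kz r 1) v = qHalf r ^ x • v) (m : ℕ) :
    slot a (kz r m) v = qHalf r ^ (m * x) • v := by
  induction m with
  | zero => simp [kz_zero]
  | succ m ih =>
    rw [Nat.cast_succ, kz_add, map_mul, Module.End.mul_apply, h, map_smul, ih, smul_smul,
      ← zpow_add₀ (qHalf_ne_zero r)]
    congr 2
    ring

/-- Stated for arbitrary joint eigenvectors because `cartan_mul` applies it to images of basis
vectors under an operator X, which need not be basis vectors. -/
lemma cartan_apply_of_eigen (hr : 1 ≤ r) {a b : Fin n} {v : TP r n} {x y : ℤ}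
    (ha : slot a (kz r 1) v = qHalf r ^ x • v) (hb : slot b (kz r 1) v = qHalf r ^ y • v) :
    cartan r a b v = qHalf r ^ (x * y) • v := by
  rw [← gauss_sum_qHalf hr x y, cartan, LinearMap.smul_apply, mul_smul]
  congr 1
  simp only [LinearMap.sum_apply, Finset.sum_smul, LinearMap.smul_apply, Module.End.mul_apply,
    slot_kz_apply_of_eigen b hb, map_smul, slot_kz_apply_of_eigen a ha, smul_smul]
  refine Finset.sum_congr rfl fun m _ => Finset.sum_congr rfl fun m' _ => ?_
  congr 1
  ring

lemma cartan_tbasis (hr : 1 ≤ r) (a b : Fin n) (f : Fin n → Fin r) :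
    cartan r a b (tbasis r n f) = qHalf r ^
      (((r : ℤ) - 1 - 2 * (f a : ℕ)) * ((r : ℤ) - 1 - 2 * (f b : ℕ))) • tbasis r n f :=
  cartan_apply_of_eigen hr ((slot_kz_tbasis a 1 f).trans (by rw [one_mul]))
    ((slot_kz_tbasis b 1 f).trans (by rw [one_mul]))

/-- Moving the Cartan part of the `R`-matrix past a weight operator. -/
lemma cartan_mul (hr : 1 ≤ r) {a b : Fin n} {X : Module.End ℂ (TP r n)} {x y : ℤ}
    (ha : slot a (kz r 1) * X = qHalf r ^ x • (X * slot a (kz r 1)))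
    (hb : slot b (kz r 1) * X = qHalf r ^ y • (X * slot b (kz r 1))) :
    cartan r a b * X =
      qHalf r ^ (x * y) • (X * slot a (kz r y) * slot b (kz r x) * cartan r a b) := by
  have hq := qHalf_ne_zero r
  refine (tbasis r n).ext fun f => ?_
  simp only [Module.End.mul_apply, LinearMap.smul_apply, cartan_tbasis hr, map_smul,
    slot_kz_tbasis, smul_smul]
  set xa := (r : ℤ) - 1 - 2 * (f a : ℕ)
  set xb := (r : ℤ) - 1 - 2 * (f b : ℕ)
  have ha' : slot a (kz r 1) (X (tbasis r n f)) = qHalf r ^ (x + xa) • X (tbasis r n f) := by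
    rw [← Module.End.mul_apply, ha, LinearMap.smul_apply, Module.End.mul_apply, slot_kz_tbasis,
      map_smul, smul_smul, ← zpow_add₀ hq, one_mul]
  have hb' : slot b (kz r 1) (X (tbasis r n f)) = qHalf r ^ (y + xb) • X (tbasis r n f) := by
    rw [← Module.End.mul_apply, hb, LinearMap.smul_apply, Module.End.mul_apply, slot_kz_tbasis,
      map_smul, smul_smul, ← zpow_add₀ hq, one_mul]
  rw [cartan_apply_of_eigen hr ha' hb']
  simp only [← zpow_add₀ hq]
  congr 2
  ring

lemma cartan_commute_of_diag (hr : 1 ≤ r) (a b : Fin n) {X : Module.End ℂ (TP r n)}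
    {c : (Fin n → Fin r) → ℂ} (hX : ∀ f, X (tbasis r n f) = c f • tbasis r n f) :
    Commute (cartan r a b) X :=
  (tbasis r n).ext fun f => by
    rw [Module.End.mul_apply, Module.End.mul_apply, hX, map_smul, cartan_tbasis hr, map_smul, hX,
      smul_comm]

lemma isUnit_cartan (hr : 1 ≤ r) (a b : Fin n) : IsUnit (cartan r a b) := by
  let D : Module.End ℂ (TP r n) := (tbasis r n).constr ℂ fun f => qHalf r ^
      (-(((r : ℤ) - 1 - 2 * (f a : ℕ)) * ((r : ℤ) - 1 - 2 * (f b : ℕ)))) • tbasis r n f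
  have hD : ∀ f, D (tbasis r n f) = _ := fun f => (tbasis r n).constr_basis ℂ _ f
  refine ⟨⟨cartan r a b, D, ?_, ?_⟩, rfl⟩ <;>
  · refine (tbasis r n).ext fun f => ?_
    rw [Module.End.mul_apply]
    simp only [hD, map_smul, cartan_tbasis hr, smul_smul]
    rw [← zpow_add₀ (qHalf_ne_zero r)]
    simp

lemma slot_kz_mul_slot_E (a b : Fin n) (z : ℤ) : slot a (kz r z) * slot b (opE r) =
    qHalf r ^ (if a = b then 2 * z else 0) • (slot b (opE r) * slot a (kz r z)) := by
  split_ifs with h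
  · subst h
    rw [← map_mul, kz_mul_E, map_smul, map_mul]
  · rw [zpow_zero, one_smul, (slot_commute h _ _).eq]

lemma slot_kz_mul_slot_F (a b : Fin n) (z : ℤ) : slot a (kz r z) * slot b (opF r) =
    qHalf r ^ (if a = b then -2 * z else 0) • (slot b (opF r) * slot a (kz r z)) := by
  split_ifs with h
  · subst h
    rw [← map_mul, kz_mul_F, map_smul, map_mul]
  · rw [zpow_zero, one_smul, (slot_commute h _ _).eq]

/-- Raising the weight at `a` by 2 multiplies the Cartan eigenvalue by q to the weight at `b`, and
this is the action of k² at `b`. The three companions below are the same computation. -/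
lemma cartan_mul_E_left (hr : 1 ≤ r) {a b : Fin n} (h : a ≠ b) :
    cartan r a b * slot a (opE r) = slot a (opE r) * slot b (kz r 2) * cartan r a b := by
  have := cartan_mul hr (a := a) (b := b) (slot_kz_mul_slot_E a a 1) (slot_kz_mul_slot_E b a 1)
  simpa [h.symm, kz_zero] using this

lemma cartan_mul_E_right (hr : 1 ≤ r) {a b : Fin n} (h : a ≠ b) :
    cartan r a b * slot b (opE r) = slot b (opE r) * slot a (kz r 2) * cartan r a b := by
  have := cartan_mul hr (a := a) (b := b) (slot_kz_mul_slot_E a b 1) (slot_kz_mul_slot_E b b 1)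
  simpa [h, kz_zero] using this

lemma cartan_mul_F_left (hr : 1 ≤ r) {a b : Fin n} (h : a ≠ b) :
    cartan r a b * slot a (opF r) = slot a (opF r) * slot b (kz r (-2)) * cartan r a b := by
  have := cartan_mul hr (a := a) (b := b) (slot_kz_mul_slot_F a a 1) (slot_kz_mul_slot_F b a 1)
  simpa [h.symm, kz_zero] using this

lemma cartan_mul_F_right (hr : 1 ≤ r) {a b : Fin n} (h : a ≠ b) :
    cartan r a b * slot b (opF r) = slot b (opF r) * slot a (kz r (-2)) * cartan r a b := by
  have := cartan_mul hr (a := a) (b := b) (slot_kz_mul_slot_F a b 1) (slot_kz_mul_slot_F b b 1)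
  simpa [h, kz_zero] using this

end

section

variable {r n : ℕ}

/-! ### The `R`-matrix in two positions -/

section Theta

variable {A : Type*} [Ring A] [Algebra ℂ A]

/-- For commuting e and f, `theta` is a polynomial in the product ef, so only that product has to be
moved past D. -/
lemma theta_semiconj {D e f e' f' : A} (h : Commute e f) (h' : Commute e' f')
    (hD : D * (e * f) = e' * f' * D) : D * theta r e f = theta r e' f' * D := by
  rw [theta, theta, Finset.mul_sum, Finset.sum_mul]
  refine Finset.sum_congr rfl fun a _ => ?_
  rw [mul_smul_comm, smul_mul_assoc, ← h.mul_pow, ← h'.mul_pow]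
  congr 1
  exact SemiconjBy.pow_right hD a

end Theta

/-- The `R`-matrix acting in positions `a` and `b`. -/
def rmat (r : ℕ) {n : ℕ} (a b : Fin n) : Module.End ℂ (TP r n) :=
  cartan r a b * theta r (slot a (opE r)) (slot b (opF r))

lemma theta_slot_eq {a b : Fin n} : theta r (slot a (opE r)) (slot b (opF r)) =
    ∑ s ∈ Finset.range r, thetaCoeff r s • (slot a (opE r ^ s) * slot b (opF r ^ s)) := by
  simp only [theta, map_pow]

lemma kz_mul_E_pow (s m : ℕ) :
    kz r m * opE r ^ s = qHalf r ^ (2 * (s : ℤ) * m) • (opE r ^ s * kz r m) := by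
  rw [mul_pow_of_mul_eq_smul (kz_mul_E r m), ← zpow_natCast, ← zpow_mul]
  ring_nf

lemma kz_mul_F_pow (s m : ℕ) :
    kz r m * opF r ^ s = qHalf r ^ (-2 * (s : ℤ) * m) • (opF r ^ s * kz r m) := by
  rw [mul_pow_of_mul_eq_smul (kz_mul_F r m), ← zpow_natCast, ← zpow_mul]
  ring_nf

lemma leftPos_ne_rightPos (t : Fin (n - 1)) : leftPos t ≠ rightPos t := by
  simp [leftPos, rightPos]

lemma slot_mul_slot_eq {a b : Fin n} (h : a ≠ b) (X Y : Module.End ℂ (V r)) :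
    slot a X * slot b Y = PiTensorProduct.map fun p =>
      if p = a then X else if p = b then Y else 1 := by
  rw [slot_eq, slot_eq, ← tmap_mul]
  congr 1
  ext1 i
  by_cases hi : i = a
  · subst hi; simp [h]
  · by_cases hb : i = b
    · subst hb; simp [h.symm]
    · simp [hi, hb]

/-- The factor q^(a(m-m')) in the R-matrix is exactly what arises when the powers of k are moved to
the left of E^a and F^a. Hence the triple sum factors into a Cartan part followed by a nilpotent
part. -/
lemma RMatrixAt_eq (t : Fin (n - 1)) : RMatrixAt r n t = rmat r (leftPos t) (rightPos t) := by
  rw [RMatrixAt, rmat, theta_slot_eq, cartan, smul_mul_assoc, Finset.mul_sum]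
  refine congrArg (HSMul.hSMul _) (Finset.sum_congr rfl fun s _ => ?_)
  rw [Finset.sum_mul]
  refine Finset.sum_congr rfl fun m _ => ?_
  rw [Finset.sum_mul]
  refine Finset.sum_congr rfl fun m' _ => ?_
  have hne := leftPos_ne_rightPos t
  rw [← slot_mul_slot_eq hne, steinberg_k_pow, steinberg_k_pow, smul_mul_smul_comm]
  have h1 : slot (leftPos t) (kz r m) * slot (rightPos t) (kz r m') *
      (slot (leftPos t) (opE r ^ s) * slot (rightPos t) (opF r ^ s)) =
      (qHalf r ^ (2 * (s : ℤ) * m) * qHalf r ^ (-2 * (s : ℤ) * m')) •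
      (slot (leftPos t) (opE r ^ s * kz r m) * slot (rightPos t) (opF r ^ s * kz r m')) := by
    rw [mul_assoc, ← mul_assoc (slot (rightPos t) _), (slot_commute hne.symm _ _).eq, mul_assoc,
      ← map_mul, ← mul_assoc, ← map_mul, kz_mul_E_pow, kz_mul_F_pow, map_smul, map_smul,
      smul_mul_smul_comm]
  rw [h1, smul_smul]
  refine congrArg (fun c : ℂ => c • _) ?_
  have hq := qHalf_ne_zero r
  have h2 : qHalf r ^ ((s : ℤ) * (s - 1) + 2 * s * (m - m') - m * m') =
      qHalf r ^ ((s : ℤ) * (s - 1)) * (qHalf r ^ (-((m : ℤ) * m')) *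
        (qHalf r ^ (2 * (s : ℤ) * m) * qHalf r ^ (-2 * (s : ℤ) * m'))) := by
    simp only [← zpow_add₀ hq]
    ring_nf
  rw [h2, thetaCoeff]
  ring

lemma slot_EF_commute {a b : Fin n} (h : a ≠ b) : Commute (slot a (opE r)) (slot b (opF r)) :=
  slot_commute h _ _

lemma slot_kz_mul_neg (a : Fin n) (z : ℤ) : slot (r := r) a (kz r z) * slot a (kz r (-z)) = 1 := by
  rw [← map_mul, ← kz_add, add_neg_cancel, kz_zero, map_one]

lemma slot_kz_neg_mul (a : Fin n) (z : ℤ) : slot (r := r) a (kz r (-z)) * slot a (kz r z) = 1 := by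
  rw [← map_mul, ← kz_add, neg_add_cancel, kz_zero, map_one]

lemma slot_K_mul_F (a : Fin n) : slot a (kz r 2) * slot a (opF r) =
    q r ^ (-2 : ℤ) • (slot a (opF r) * slot a (kz r 2)) := by
  rw [slot_kz_mul_slot_F, if_pos rfl, q_zpow_eq]; norm_num

lemma slot_K_inv_mul_F (a : Fin n) : slot a (kz r (-2)) * slot a (opF r) =
    q r ^ (2 : ℤ) • (slot a (opF r) * slot a (kz r (-2))) := by
  rw [slot_kz_mul_slot_F, if_pos rfl, q_zpow_eq]; norm_num

lemma slot_K_mul_E (a : Fin n) : slot a (kz r 2) * slot a (opE r) =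
    q r ^ (2 : ℤ) • (slot a (opE r) * slot a (kz r 2)) := by
  rw [slot_kz_mul_slot_E, if_pos rfl, q_zpow_eq]

lemma slot_K_inv_mul_E (a : Fin n) : slot a (kz r (-2)) * slot a (opE r) =
    q r ^ (-2 : ℤ) • (slot a (opE r) * slot a (kz r (-2))) := by
  rw [slot_kz_mul_slot_E, if_pos rfl, q_zpow_eq]

lemma cartan_commute_slot {a b c : Fin n} (hac : a ≠ c) (hbc : b ≠ c)
    (X : Module.End ℂ (V r)) : Commute (cartan r a b) (slot c X) := by
  refine Commute.smul_left (Commute.sum_left _ _ _ fun m _ => Commute.sum_left _ _ _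
    fun m' _ => Commute.smul_left ?_ _) _
  exact (slot_commute hac _ _).mul_left (slot_commute hbc _ _)

lemma cartan_commute_kz (hr : 1 ≤ r) (a b c : Fin n) (z : ℤ) :
    Commute (cartan r a b) (slot c (kz r z)) :=
  cartan_commute_of_diag hr a b (slot_kz_tbasis c z)

lemma cartan_commute_H₁ (hr : 1 ≤ r) (a b c : Fin n) :
    Commute (cartan r a b) (slot c (H₁ r)) :=
  cartan_commute_of_diag hr a b fun f => slot_tbasis_of_eigen c (H₁_u r (f c))

lemma cartan_commute_cartan (hr : 1 ≤ r) (a b c d : Fin n) :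
    Commute (cartan r a b) (cartan r c d) :=
  cartan_commute_of_diag hr a b (cartan_tbasis hr c d)

/-- The `R`-matrix intertwines the two coproducts of `E`. -/
lemma rmat_mul_E (hr : 1 ≤ r) {a b : Fin n} (h : a ≠ b) :
    rmat r a b * (slot b (opE r) + slot a (opE r) * slot b (kz r 2)) =
      (slot a (opE r) + slot b (opE r) * slot a (kz r 2)) * rmat r a b := by
  have hi := theta_intertwine hr (e := slot b (opE r)) (e' := slot a (opE r))
    (f := slot b (opF r)) (K := slot b (kz r 2)) (K' := slot b (kz r (-2)))
    (slot_K_mul_F b)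
    (slot_K_inv_mul_F b)
    (by rw [← map_mul, E_mul_F hr]; simp)
    (by rw [← map_pow, opE_pow, map_zero])
    (slot_commute h _ _) (slot_commute h _ _) (slot_commute h _ _)
  rw [rmat, mul_assoc, ← hi, ← mul_assoc, ← mul_assoc]
  congr 1
  -- `theta` produces E_a k_b^(-2) + E_b. The Cartan part then multiplies E_a by k_b², cancelling
  -- k_b^(-2), and multiplies E_b by k_a²: the opposite coproduct.
  rw [mul_add, add_mul, cartan_mul_E_right hr h, ← mul_assoc, cartan_mul_E_left hr h, mul_assoc,
    (cartan_commute_kz hr a b b (-2)).eq, ← mul_assoc, mul_assoc _ _ (slot b (kz r (-2))),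
    slot_kz_mul_neg, mul_one]

/-- The `R`-matrix intertwines the two coproducts of `F`. -/
lemma rmat_mul_F (hr : 1 ≤ r) {a b : Fin n} (h : a ≠ b) :
    rmat r a b * (slot a (opF r) + slot b (opF r) * slot a (kz r (-2))) =
      (slot b (opF r) + slot a (opF r) * slot b (kz r (-2))) * rmat r a b := by
  have hi := theta_intertwine' hr (e := slot a (opE r)) (f := slot a (opF r))
    (f' := slot b (opF r)) (K := slot a (kz r 2)) (K' := slot a (kz r (-2)))
    (slot_K_mul_E a)
    (slot_K_inv_mul_E a)
    (by rw [← map_mul, E_mul_F hr]; simp)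
    (by rw [← map_pow, opF_pow, map_zero])
    (slot_commute h.symm _ _) (slot_commute h.symm _ _) (slot_commute h.symm _ _)
  rw [rmat, mul_assoc, ← hi, ← mul_assoc, ← mul_assoc]
  congr 1
  rw [mul_add, add_mul, cartan_mul_F_left hr h, ← mul_assoc, cartan_mul_F_right hr h, mul_assoc,
    mul_assoc (slot b (opF r) * _), (cartan_commute_kz hr a b a 2).eq,
    ← mul_assoc (slot b (opF r) * _), mul_assoc _ _ (slot a (kz r 2)),
    slot_kz_neg_mul, mul_one, add_comm]

lemma rmat_commute {a b : Fin n} (h : a ≠ b) {X : Module.End ℂ (TP r n)}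
    (h1 : Commute X (cartan r a b)) (h2 : Commute X (slot a (opE r) * slot b (opF r))) :
    Commute X (rmat r a b) :=
  h1.mul_right (theta_semiconj (slot_EF_commute h) (slot_EF_commute h) h2.eq)

lemma rmat_commute_slot {a b c : Fin n} (h : a ≠ b) (hac : a ≠ c) (hbc : b ≠ c)
    (X : Module.End ℂ (V r)) : Commute (slot c X) (rmat r a b) :=
  rmat_commute h (cartan_commute_slot hac hbc X).symm
    ((slot_commute hac.symm _ _).mul_right (slot_commute hbc.symm _ _))

lemma rmat_commute_tmap {a b : Fin n} (h : a ≠ b) {g : Fin n → Module.End ℂ (V r)}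
    (ha : g a = 1) (hb : g b = 1) : Commute (PiTensorProduct.map g) (rmat r a b) := by
  refine rmat_commute h ?_ ((slot_commute_tmap ha _).mul_right (slot_commute_tmap hb _))
  refine Commute.smul_right (Commute.sum_right _ _ _ fun m _ => Commute.sum_right _ _ _
    fun m' _ => Commute.smul_right ?_ _) _
  exact (slot_commute_tmap ha _).mul_right (slot_commute_tmap hb _)

lemma rmat_commute_kz (hr : 1 ≤ r) {a b : Fin n} (h : a ≠ b) (z : ℤ) :
    Commute (slot a (kz r z) * slot b (kz r z)) (rmat r a b) := by
  refine rmat_commute h ((cartan_commute_kz hr a b a z).symm.mul_left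
    (cartan_commute_kz hr a b b z).symm) ?_
  have h1 := slot_kz_mul_slot_E (r := r) a a z
  have h2 := slot_kz_mul_slot_F (r := r) b b z
  rw [if_pos rfl] at h1 h2
  rw [Commute, SemiconjBy, mul_assoc, ← mul_assoc (slot b _), (slot_commute h.symm _ _).eq,
    mul_assoc, h2, mul_smul_comm, mul_smul_comm, ← mul_assoc, h1, smul_mul_assoc, smul_smul,
    ← zpow_add₀ (qHalf_ne_zero r), mul_assoc, ← mul_assoc (slot a (kz r z)),
    (slot_commute h _ _).eq]
  simp [mul_assoc]

lemma rmat_commute_H₁ (hr : 1 ≤ r) {a b : Fin n} (h : a ≠ b) :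
    Commute (slot a (H₁ r) + slot b (H₁ r)) (rmat r a b) := by
  refine rmat_commute h ((cartan_commute_H₁ hr a b a).symm.add_left
    (cartan_commute_H₁ hr a b b).symm) ?_
  have h1 : slot a (H₁ r) * slot a (opE r) =
      slot a (opE r) * slot a (H₁ r) + (2 : ℂ) • slot a (opE r) := by
    rw [← map_mul, H₁_mul_E, map_add, map_mul, map_smul]
  have h2 : slot b (H₁ r) * slot b (opF r) =
      slot b (opF r) * slot b (H₁ r) + (-2 : ℂ) • slot b (opF r) := by
    rw [← map_mul, H₁_mul_F, map_add, map_mul, map_smul]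
  rw [Commute, SemiconjBy, add_mul, ← mul_assoc, h1, ← mul_assoc,
    (slot_commute h.symm (H₁ r) (opE r)).eq, mul_assoc (slot a (opE r)) (slot b (H₁ r)), h2,
    mul_add, add_mul, mul_assoc, (slot_commute h (H₁ r) (opF r)).eq, mul_add]
  simp only [smul_mul_assoc, mul_smul_comm, mul_assoc]
  rw [add_assoc, add_left_comm ((2 : ℂ) • _), ← add_smul]
  simp

lemma isUnit_rmat (hr : 1 ≤ r) {a b : Fin n} (h : a ≠ b) : IsUnit (rmat r a b) :=
  (isUnit_cartan hr a b).mul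
    (isUnit_theta hr (slot_EF_commute h) (by rw [← map_pow, opE_pow, map_zero]))

/-- The hexagon identity (Δ ⊗ 1)R = R₁₃ R₂₃ in operator form. After the two Cartan factors are
collected on the left, the two q-exponentials have q-commuting first arguments whose sum is the
coproduct of E. -/
lemma rmat_mul_rmat (hr : 1 ≤ r) {a b c : Fin n} (hab : a ≠ b) (hac : a ≠ c) (hbc : b ≠ c) :
    rmat r a c * rmat r b c = cartan r a c * cartan r b c *
      theta r (slot b (opE r) + slot a (opE r) * slot b (kz r 2)) (slot c (opF r)) := by
  have h1 : Commute (slot a (opE r) * slot b (kz r 2)) (slot c (opF r)) :=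
    (slot_commute hac _ _).mul_left (slot_commute hbc _ _)
  -- The factor k_b^(-2) that the Cartan part in `b`, `c` attaches to F_c cancels the k_b² standing
  -- next to E_a.
  have h2 : cartan r b c * theta r (slot a (opE r) * slot b (kz r 2)) (slot c (opF r)) =
      theta r (slot a (opE r)) (slot c (opF r)) * cartan r b c := by
    refine theta_semiconj h1 (slot_EF_commute hac) ?_
    have hc : Commute (cartan r b c) (slot a (opE r) * slot b (kz r 2)) :=
      (cartan_commute_slot hab.symm hac.symm _).mul_right (cartan_commute_kz hr b c b 2)
    rw [← mul_assoc, hc.eq, mul_assoc, cartan_mul_F_right hr hbc]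
    rw [(slot_commute hbc.symm (opF r) (kz r (-2))).eq, mul_assoc, mul_assoc, ← mul_assoc (slot b _),
      slot_kz_mul_neg, one_mul, mul_assoc]
  rw [rmat, rmat, mul_assoc, ← mul_assoc (theta r _ _), ← h2, mul_assoc, theta_mul_theta,
    ← mul_assoc, add_comm]
  · rw [mul_assoc, slot_kz_mul_slot_E, if_pos rfl, mul_smul_comm, smul_smul, q_zpow_eq,
      ← zpow_add₀ (qHalf_ne_zero r), ← mul_assoc, ← mul_assoc, (slot_commute hab _ _).eq]
    simp
  · exact h1
  · exact slot_commute hbc _ _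
  · rw [← map_pow, opF_pow, map_zero]

/-- The Yang–Baxter equation. -/
lemma rmat_yangBaxter (hr : 1 ≤ r) {a b c : Fin n} (hab : a ≠ b) (hac : a ≠ c) (hbc : b ≠ c) :
    rmat r a b * rmat r a c * rmat r b c = rmat r b c * rmat r a c * rmat r a b := by
  -- E_a F_b leaves the total weight of `a` and `b` unchanged, so the factors k_c² and k_c^(-2)
  -- produced by the two Cartan parts cancel.
  have h1 : Commute (cartan r a c * cartan r b c) (rmat r a b) := by
    refine rmat_commute hab ((cartan_commute_cartan hr _ _ _ _).mul_left
      (cartan_commute_cartan hr _ _ _ _)) ?_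
    have e1 : cartan r a c * (slot a (opE r) * slot b (opF r)) =
        slot a (opE r) * slot b (opF r) * slot c (kz r 2) * cartan r a c := by
      rw [← mul_assoc, cartan_mul_E_left hr hac, mul_assoc,
        (cartan_commute_slot hab hbc.symm _).eq, ← mul_assoc, mul_assoc (slot a _),
        (slot_commute hbc.symm _ _).eq, mul_assoc (slot a _) (slot b _)]
    have e2 : cartan r b c * (slot a (opE r) * slot b (opF r)) =
        slot a (opE r) * slot b (opF r) * slot c (kz r (-2)) * cartan r b c := by
      rw [← mul_assoc, (cartan_commute_slot hab.symm hac.symm _).eq, mul_assoc,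
        cartan_mul_F_left hr hbc, ← mul_assoc, ← mul_assoc]
    rw [Commute, SemiconjBy, mul_assoc, e2, ← mul_assoc, ← mul_assoc, e1,
      mul_assoc _ (cartan r a c), (cartan_commute_kz hr a c c _).eq, ← mul_assoc,
      mul_assoc _ (slot c _) (slot c _), slot_kz_mul_neg, mul_one, mul_assoc]
  have h2 : rmat r a b *
      theta r (slot b (opE r) + slot a (opE r) * slot b (kz r 2)) (slot c (opF r)) =
      theta r (slot a (opE r) + slot b (opE r) * slot a (kz r 2)) (slot c (opF r)) *
        rmat r a b := by
    refine theta_semiconj ((slot_commute hbc _ _).add_left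
      ((slot_commute hac _ _).mul_left (slot_commute hbc _ _)))
      ((slot_commute hac _ _).add_left ((slot_commute hbc _ _).mul_left (slot_commute hac _ _))) ?_
    rw [← mul_assoc, rmat_mul_E hr hab, mul_assoc, ← (rmat_commute_slot hab hac hbc _).eq,
      mul_assoc]
  -- The hexagon identity is used on both sides, on the right with `a` and `b` exchanged. Then R_ab
  -- turns the coproduct of E inside `theta` into the opposite one.
  rw [mul_assoc, rmat_mul_rmat hr hab hac hbc, rmat_mul_rmat hr hab.symm hbc hac, ← mul_assoc,
    ← h1.eq, mul_assoc, h2, ← mul_assoc, (cartan_commute_cartan hr _ _ _ _).eq]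

/-! ### Permutations of the tensor factors -/

/-- The permutation of the tensor factors by `π`. -/
def permOp (r : ℕ) {n : ℕ} (π : Equiv.Perm (Fin n)) : TP r n ≃ₗ[ℂ] TP r n :=
  PiTensorProduct.reindex ℂ (fun _ : Fin n => V r) π

lemma permOp_tprod (π : Equiv.Perm (Fin n)) (x : Fin n → V r) :
    permOp r π (PiTensorProduct.tprod ℂ x) = PiTensorProduct.tprod ℂ fun p => x (π.symm p) :=
  PiTensorProduct.reindex_tprod _ _

/-- `permOp` as an endomorphism. -/
def permEnd (r : ℕ) {n : ℕ} (π : Equiv.Perm (Fin n)) : Module.End ℂ (TP r n) :=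
  (permOp r π).toLinearMap

lemma permEnd_mul (π ρ : Equiv.Perm (Fin n)) :
    permEnd r (π * ρ) = permEnd r π * permEnd r ρ :=
  PiTensorProduct.ext <| MultilinearMap.ext fun x => by
    simp only [LinearMap.compMultilinearMap_apply, permEnd, Module.End.mul_apply,
      LinearEquiv.coe_coe, permOp_tprod]
    rfl

lemma isUnit_permEnd (π : Equiv.Perm (Fin n)) : IsUnit (permEnd r π) :=
  (Module.End.isUnit_iff _).2 (permOp r π).bijective

lemma permEnd_mul_tmap (π : Equiv.Perm (Fin n)) (g : Fin n → Module.End ℂ (V r)) :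
    permEnd r π * PiTensorProduct.map g =
      PiTensorProduct.map (fun p => g (π.symm p)) * permEnd r π :=
  PiTensorProduct.ext <| MultilinearMap.ext fun x => by
    simp only [LinearMap.compMultilinearMap_apply, permEnd, Module.End.mul_apply,
      LinearEquiv.coe_coe, permOp_tprod, PiTensorProduct.map_tprod]

lemma permEnd_mul_slot (π : Equiv.Perm (Fin n)) (p : Fin n) (A : Module.End ℂ (V r)) :
    permEnd r π * slot p A = slot (π p) A * permEnd r π := by
  rw [slot_eq, permEnd_mul_tmap, slot_eq]
  congr 2
  ext1 i
  by_cases h : i = π p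
  · subst h; simp
  · rw [Pi.mulSingle_eq_of_ne h, Pi.mulSingle_eq_of_ne]
    rintro rfl
    simp at h

lemma permEnd_mul_rmat (π : Equiv.Perm (Fin n)) (a b : Fin n) (h : a ≠ b) :
    permEnd r π * rmat r a b = rmat r (π a) (π b) * permEnd r π := by
  have hm : ∀ {A B A' B' : Module.End ℂ (TP r n)}, permEnd r π * A = A' * permEnd r π →
      permEnd r π * B = B' * permEnd r π → permEnd r π * (A * B) = A' * B' * permEnd r π :=
    fun h1 h2 => SemiconjBy.mul_right h1 h2
  refine hm ?_ (theta_semiconj (slot_EF_commute h)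
    (slot_EF_commute (π.injective.ne h)) (hm (permEnd_mul_slot _ _ _) (permEnd_mul_slot _ _ _)))
  rw [cartan, cartan]
  simp only [mul_smul_comm, smul_mul_assoc, Finset.mul_sum, Finset.sum_mul,
    hm (permEnd_mul_slot π _ _) (permEnd_mul_slot π _ _)]

/-! ### The braid group representation -/

lemma braidOp_eq (t : Fin (n - 1)) : braidOp r n t = qHalf r ^ (-((r : ℤ) - 1) ^ 2) •
    (permEnd r (Equiv.swap (leftPos t) (rightPos t)) * rmat r (leftPos t) (rightPos t)) := by
  rw [braidOp, RMatrixAt_eq]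
  rfl

lemma isUnit_braidOp (hr : 1 ≤ r) (t : Fin (n - 1)) : IsUnit (braidOp r n t) := by
  rw [braidOp_eq]
  have h : qHalf r ^ (-((r : ℤ) - 1) ^ 2) ≠ 0 := zpow_ne_zero _ (qHalf_ne_zero r)
  exact IsUnit.smul (Units.mk0 _ h) ((isUnit_permEnd _).mul (isUnit_rmat hr (leftPos_ne_rightPos t)))

lemma swap_braid {a b c : Fin n} (hab : a ≠ b) (hac : a ≠ c) (hbc : b ≠ c) :
    Equiv.swap a b * Equiv.swap b c * Equiv.swap a b =
      Equiv.swap b c * Equiv.swap a b * Equiv.swap b c := by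
  rw [Equiv.swap_mul_swap_mul_swap hab hac, Equiv.swap_comm a b, Equiv.swap_comm b c,
    Equiv.swap_mul_swap_mul_swap hbc.symm hac.symm, Equiv.swap_comm]

/-- The scalar factors agree on both sides. Pulling all flips to the left renames the positions of
the R-matrices, which leaves the braid relation for transpositions times the Yang–Baxter equation.
-/
lemma braidOp_braid (hr : 1 ≤ r) {s t : Fin (n - 1)} (h : (s : ℕ) + 1 = t) :
    braidOp r n s * braidOp r n t * braidOp r n s =
      braidOp r n t * braidOp r n s * braidOp r n t := by
  simp only [braidOp_eq, smul_mul_assoc, mul_smul_comm]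
  congr 3
  have hst : leftPos t = rightPos s := by ext; simp [leftPos, rightPos, h]
  rw [hst]
  set a := leftPos s
  set b := rightPos s with hb
  set c := rightPos t with hc
  have hab : a ≠ b := leftPos_ne_rightPos s
  have hbc : b ≠ c := hst ▸ leftPos_ne_rightPos t
  have hac : a ≠ c := by
    intro h'
    have := congr_arg Fin.val h'
    simp [a, hc, leftPos, rightPos] at this
    omega
  have e1 := permEnd_mul_rmat (r := r) (Equiv.swap b c) a c hac
  have e2 := permEnd_mul_rmat (r := r) (Equiv.swap a b) a c hac
  have e3 := permEnd_mul_rmat (r := r) (Equiv.swap a b) b c hbc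
  have e4 := permEnd_mul_rmat (r := r) (Equiv.swap b c) a b hab
  rw [Equiv.swap_apply_right, Equiv.swap_apply_of_ne_of_ne hab hac] at e1
  rw [Equiv.swap_apply_left, Equiv.swap_apply_of_ne_of_ne hac.symm hbc.symm] at e2
  rw [Equiv.swap_apply_right, Equiv.swap_apply_of_ne_of_ne hac.symm hbc.symm] at e3
  rw [Equiv.swap_apply_left, Equiv.swap_apply_of_ne_of_ne hab hac] at e4
  set S := permEnd r (Equiv.swap a b)
  set T := permEnd r (Equiv.swap b c)
  have hST : S * T * S = T * S * T := by
    simp only [S, T, ← permEnd_mul, swap_braid hab hac hbc]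
  calc S * rmat r a b * (T * rmat r b c) * (S * rmat r a b)
      = S * (rmat r a b * T) * (rmat r b c * S) * rmat r a b := by simp only [mul_assoc]
    _ = S * T * (rmat r a c * S) * rmat r a c * rmat r a b := by
        rw [← e1, ← e2]; simp only [mul_assoc]
    _ = S * T * S * (rmat r b c * rmat r a c * rmat r a b) := by
        rw [← e3]; simp only [mul_assoc]
    _ = T * S * T * (rmat r a b * rmat r a c * rmat r b c) := by
        rw [hST, rmat_yangBaxter hr hab hac hbc]
    _ = T * S * (rmat r a c * T) * rmat r a c * rmat r b c := by
        rw [← e4]; simp only [mul_assoc]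
    _ = T * (rmat r b c * S) * (rmat r a b * T) * rmat r b c := by
        rw [← e2, ← e1]; simp only [mul_assoc]
    _ = _ := by simp only [mul_assoc]

lemma permEnd_swap_commute_tmap {a b : Fin n} {g : Fin n → Module.End ℂ (V r)} (h : g a = g b) :
    Commute (PiTensorProduct.map g) (permEnd r (Equiv.swap a b)) := by
  refine ((permEnd_mul_tmap (r := r) (Equiv.swap a b) g).trans ?_).symm
  congr 2
  ext1 i
  rw [Equiv.symm_swap]
  by_cases h1 : i = a
  · subst h1; rw [Equiv.swap_apply_left, h]
  · by_cases h2 : i = b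
    · subst h2; rw [Equiv.swap_apply_right, h]
    · rw [Equiv.swap_apply_of_ne_of_ne h1 h2]

lemma braidOp_commute_tmap (t : Fin (n - 1)) {g : Fin n → Module.End ℂ (V r)}
    (ha : g (leftPos t) = 1) (hb : g (rightPos t) = 1) :
    Commute (PiTensorProduct.map g) (braidOp r n t) := by
  rw [braidOp_eq]
  exact ((permEnd_swap_commute_tmap (ha.trans hb.symm)).mul_right
    (rmat_commute_tmap (leftPos_ne_rightPos t) ha hb)).smul_right _

lemma braidOp_far {s t : Fin (n - 1)} (h : (s : ℕ) + 1 < t) :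
    Commute (braidOp r n s) (braidOp r n t) := by
  have h1 : leftPos s ≠ leftPos t := by simp [leftPos]; omega
  have h2 : leftPos s ≠ rightPos t := by simp [leftPos, rightPos]; omega
  have h3 : rightPos s ≠ leftPos t := by simp [leftPos, rightPos]; omega
  have h4 : rightPos s ≠ rightPos t := by simp [rightPos]; omega
  have hs := leftPos_ne_rightPos s
  have ht := leftPos_ne_rightPos t
  have hslot : ∀ p, p ≠ leftPos t → p ≠ rightPos t → ∀ A : Module.End ℂ (V r),
      Commute (slot p A) (braidOp r n t) := fun p hp hp' A =>
    braidOp_commute_tmap t (by rw [Pi.mulSingle_eq_of_ne hp.symm])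
      (by rw [Pi.mulSingle_eq_of_ne hp'.symm])
  have hR : Commute (rmat r (leftPos s) (rightPos s)) (braidOp r n t) := by
    refine Commute.mul_left ?_ ?_
    · exact Commute.smul_left (Commute.sum_left _ _ _ fun m _ => Commute.sum_left _ _ _
        fun m' _ => Commute.smul_left ((hslot _ h1 h2 _).mul_left (hslot _ h3 h4 _)) _) _
    · exact Commute.sum_left _ _ _ fun m _ => Commute.smul_left
        (((hslot _ h1 h2 _).pow_left _).mul_left ((hslot _ h3 h4 _).pow_left _)) _
  have hS : Commute (permEnd r (Equiv.swap (leftPos s) (rightPos s))) (braidOp r n t) := by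
    rw [braidOp_eq]
    refine (Commute.mul_right ?_ ?_).smul_right _
    · rw [Commute, SemiconjBy, ← permEnd_mul, ← permEnd_mul]
      congr 1
      exact (Equiv.Perm.disjoint_swap_swap (by simp [hs, ht, h1, h2, h3, h4])).commute.eq
    · have := permEnd_mul_rmat (r := r) (Equiv.swap (leftPos s) (rightPos s)) _ _ ht
      rwa [Equiv.swap_apply_of_ne_of_ne h1.symm h3.symm,
        Equiv.swap_apply_of_ne_of_ne h2.symm h4.symm] at this
  rw [braidOp_eq (r := r) s]
  exact (hS.mul_left hR).smul_left _

/-- The braid operators, as units. -/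
def braidUnit (hr : 1 ≤ r) (t : Fin (n - 1)) : (Module.End ℂ (TP r n))ˣ :=
  (isUnit_braidOp hr t).unit

/-- The representation of the braid group on a tensor power. -/
def braidRep (hr : 1 ≤ r) (n : ℕ) : Representation ℂ (BraidGroup n) (TP r n) :=
  (Units.coeHom _).comp (PresentedGroup.toGroup (f := braidUnit (r := r) (n := n) hr) (by
    rintro x (⟨a, b, hab, rfl⟩ | ⟨a, b, hab, rfl⟩)
    · simp only [map_mul, map_inv, FreeGroup.lift_apply_of, mul_inv_eq_one]
      exact Units.ext (braidOp_braid hr hab)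
    · simp only [map_mul, map_inv, FreeGroup.lift_apply_of, mul_inv_eq_one]
      exact Units.ext (braidOp_far hab).eq))

lemma braidRep_braidGen (hr : 1 ≤ r) (t : Fin (n - 1)) :
    braidRep hr n (braidGen n t) = braidOp r n t := by
  simp only [braidRep, MonoidHom.comp_apply, braidGen, PresentedGroup.toGroup.of]
  rfl

lemma braidRep_commute (hr : 1 ≤ r) {X : Module.End ℂ (TP r n)}
    (h : ∀ t, Commute X (braidOp r n t)) (g : BraidGroup n) : Commute X (braidRep hr n g) := by
  have hg : g ∈ Subgroup.closure (Set.range (PresentedGroup.of : Fin (n - 1) → BraidGroup n)) := by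
    rw [PresentedGroup.closure_range_of]; trivial
  induction hg using Subgroup.closure_induction with
  | mem x hx =>
    obtain ⟨t, rfl⟩ := hx
    exact (braidRep_braidGen hr t) ▸ h t
  | one => rw [map_one]; exact Commute.one_right X
  | mul x y _ _ hx hy => rw [map_mul]; exact hx.mul_right hy
  | inv x _ hx =>
    have h1 : braidRep hr n x * braidRep hr n x⁻¹ = 1 := by rw [← map_mul]; simp
    have h2 : braidRep hr n x⁻¹ * braidRep hr n x = 1 := by rw [← map_mul]; simp
    exact Commute.units_inv_right (u := ⟨_, _, h1, h2⟩) hx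

end

section

variable {r n : ℕ}

/-! ### The generators of `D` on a tensor power -/

/-- The summand of the action of `E` with `E` in position `t`. -/
def summandE (r : ℕ) {n : ℕ} (t : Fin n) : Module.End ℂ (TP r n) :=
  PiTensorProduct.map fun p : Fin n => if p < t then 1 else if p = t then opE r else kz r 2

/-- The summand of the action of `F` with `F` in position `t`. -/
def summandF (r : ℕ) {n : ℕ} (t : Fin n) : Module.End ℂ (TP r n) :=
  PiTensorProduct.map fun p : Fin n => if p < t then kz r (-2) else if p = t then opF r else 1

lemma tensorPower_E : (tensorPower r n).E = ∑ t : Fin n, summandE r t := by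
  simp only [tensorPower, steinberg_k_pow]
  rfl

lemma tensorPower_F (hr : 1 ≤ r) : (tensorPower r n).F = ∑ t : Fin n, summandF r t := by
  simp only [tensorPower, steinberg_k_inv_sq hr]
  rfl

lemma Hn_eq : Hn r n = ∑ t : Fin n, slot t (H₁ r) := by
  refine Finset.sum_congr rfl fun t _ => ?_
  rw [slot_eq]
  congr 1
  ext1 p
  by_cases h : p = t
  · subst h; simp
  · simp [h]

/-! ### Invariance under the braid group -/

/-- Meant for sums over tensor positions: the two summands supported at the braided positions are
only required to commute with the braid operator jointly. -/
lemma commute_sum_of_pair {A : Type*} [Semiring A] {ι : Type*} [Fintype ι] [DecidableEq ι]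
    {T : ι → A} {S : A} {a b : ι} (hab : a ≠ b) (h : ∀ t, t ≠ a → t ≠ b → Commute (T t) S)
    (h2 : Commute (T a + T b) S) : Commute (∑ t, T t) S := by
  rw [← Finset.add_sum_erase _ _ (Finset.mem_univ a),
    ← Finset.add_sum_erase _ _ (Finset.mem_erase.2 ⟨hab.symm, Finset.mem_univ b⟩), ← add_assoc]
  refine h2.add_left (Commute.sum_left _ _ _ fun t ht => ?_)
  rw [Finset.mem_erase, Finset.mem_erase] at ht
  exact h t ht.2.1 ht.1

lemma braidOp_commute_kz (hr : 1 ≤ r) (t : Fin (n - 1)) (z : ℤ) :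
    Commute (slot (leftPos t) (kz r z) * slot (rightPos t) (kz r z)) (braidOp r n t) := by
  have hne := leftPos_ne_rightPos t
  rw [braidOp_eq]
  refine (Commute.mul_right ?_ (rmat_commute_kz hr hne z)).smul_right _
  rw [slot_mul_slot_eq hne]
  exact permEnd_swap_commute_tmap (by simp)

/-- Splitting off two positions of a pure tensor of operators. -/
lemma tmap_eq_mul_slot_slot (g : Fin n → Module.End ℂ (V r)) {a b : Fin n} (h : a ≠ b) :
    (PiTensorProduct.map g : Module.End ℂ (TP r n)) =
      PiTensorProduct.map (fun p => if p = a ∨ p = b then 1 else g p) *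
        (slot a (g a) * slot b (g b)) := by
  rw [slot_mul_slot_eq h, ← tmap_mul]
  congr 1
  ext1 i
  by_cases hi : i = a
  · subst hi; simp
  · by_cases hb : i = b
    · subst hb; simp [hi]
    · simp [hi, hb]

lemma braidOp_commute_tmap_kz (hr : 1 ≤ r) (t : Fin (n - 1)) {g : Fin n → Module.End ℂ (V r)}
    (z : ℤ) (ha : g (leftPos t) = kz r z) (hb : g (rightPos t) = kz r z) :
    Commute (PiTensorProduct.map g) (braidOp r n t) := by
  rw [tmap_eq_mul_slot_slot g (leftPos_ne_rightPos t), ha, hb]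
  exact (braidOp_commute_tmap t (by simp) (by simp)).mul_left (braidOp_commute_kz hr t z)

lemma val_lt_or_of_ne {t : Fin (n - 1)} {s : Fin n} (h1 : s ≠ leftPos t) (h2 : s ≠ rightPos t) :
    (s : ℕ) < t ∨ (t : ℕ) + 1 < s := by
  simp only [leftPos, rightPos, ne_eq, Fin.ext_iff] at h1 h2
  omega

/-- Summands with E elsewhere act on the two braided positions by 1 ⊗ 1 or by k² ⊗ k². The remaining
two share a factor Z and add up to Z times the coproduct of E, which R carries to the opposite
coproduct and the flip carries back. -/
lemma braidOp_commute_E (hr : 1 ≤ r) (t : Fin (n - 1)) :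
    Commute (tensorPower r n).E (braidOp r n t) := by
  have hne := leftPos_ne_rightPos t
  rw [tensorPower_E]
  refine commute_sum_of_pair hne (fun s h1 h2 => ?_) ?_
  · rcases val_lt_or_of_ne h1 h2 with h | h
    · refine braidOp_commute_tmap_kz hr t 2 ?_ ?_ <;>
      · simp only [leftPos, rightPos, Fin.lt_def, Fin.ext_iff]
        rw [if_neg (by omega), if_neg (by omega)]
    · exact braidOp_commute_tmap t
        (if_pos (by simp only [leftPos, Fin.lt_def]; omega))
        (if_pos (by simp only [rightPos, Fin.lt_def]; omega))
  · set a := leftPos t with ha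
    set b := rightPos t with hb
    set Z : Module.End ℂ (TP r n) := PiTensorProduct.map fun p : Fin n =>
      if p = a ∨ p = b then 1 else if p < a then 1 else kz r 2 with hZ
    have hlt : a < b := by simp [ha, hb, leftPos, rightPos, Fin.lt_def]
    have e1 : summandE r a = Z * (slot a (opE r) * slot b (kz r 2)) := by
      rw [summandE, tmap_eq_mul_slot_slot _ hne]
      simp only [lt_irrefl, if_false, if_true, hlt.not_gt, hne.symm]
      congr 2
      ext1 p
      by_cases h : p = a ∨ p = b
      · simp [h]
      · have : p ≠ a := fun h' => h (Or.inl h')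
        simp [this]
    have e2 : summandE r b = Z * slot b (opE r) := by
      rw [summandE, tmap_eq_mul_slot_slot _ hne]
      simp only [lt_irrefl, if_false, if_true, hlt, map_one, one_mul]
      congr 2
      ext1 p
      by_cases h : p = a ∨ p = b
      · simp [h]
      · have h1 : p ≠ a := fun h' => h (Or.inl h')
        have h2 : p ≠ b := fun h' => h (Or.inr h')
        have h3 : p < b ↔ p < a := by
          simp only [ha, hb, leftPos, rightPos, Fin.lt_def, ne_eq, Fin.ext_iff] at *
          omega
        simp only [h2, h3, if_false]
    have hZc : Commute Z (braidOp r n t) := braidOp_commute_tmap t (if_pos (Or.inl rfl))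
      (if_pos (Or.inr rfl))
    rw [e1, e2, ← mul_add]
    refine hZc.mul_left ?_
    rw [braidOp_eq]
    refine Commute.smul_right ?_ _
    have hR := rmat_mul_E hr hne
    have hP : permEnd r (Equiv.swap a b) * (slot a (opE r) + slot b (opE r) * slot a (kz r 2)) =
        (slot b (opE r) + slot a (opE r) * slot b (kz r 2)) * permEnd r (Equiv.swap a b) := by
      rw [mul_add, ← mul_assoc, permEnd_mul_slot, permEnd_mul_slot, mul_assoc, permEnd_mul_slot,
        Equiv.swap_apply_left, Equiv.swap_apply_right, ← mul_assoc, ← add_mul]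
    rw [Commute, SemiconjBy, add_comm, ← mul_assoc, ← ha, ← hb, ← hP, mul_assoc, ← hR, mul_assoc]

lemma braidOp_commute_F (hr : 1 ≤ r) (t : Fin (n - 1)) :
    Commute (tensorPower r n).F (braidOp r n t) := by
  have hne := leftPos_ne_rightPos t
  rw [tensorPower_F hr]
  refine commute_sum_of_pair hne (fun s h1 h2 => ?_) ?_
  · rcases val_lt_or_of_ne h1 h2 with h | h
    · refine braidOp_commute_tmap t ?_ ?_ <;>
      · simp only [leftPos, rightPos, Fin.lt_def, Fin.ext_iff]
        rw [if_neg (by omega), if_neg (by omega)]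
    · refine braidOp_commute_tmap_kz hr t (-2) ?_ ?_ <;>
      · simp only [leftPos, rightPos, Fin.lt_def]
        rw [if_pos (by omega)]
  · set a := leftPos t with ha
    set b := rightPos t with hb
    set Z : Module.End ℂ (TP r n) := PiTensorProduct.map fun p : Fin n =>
      if p = a ∨ p = b then 1 else if p < a then kz r (-2) else 1 with hZ
    have hlt : a < b := by simp [ha, hb, leftPos, rightPos, Fin.lt_def]
    have e1 : summandF r a = Z * slot a (opF r) := by
      rw [summandF, tmap_eq_mul_slot_slot _ hne]
      simp only [lt_irrefl, if_false, if_true, hlt.not_gt, hne.symm, map_one, mul_one]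
      congr 2
      ext1 p
      by_cases h : p = a ∨ p = b
      · simp [h]
      · have : p ≠ a := fun h' => h (Or.inl h')
        simp [this]
    have e2 : summandF r b = Z * (slot b (opF r) * slot a (kz r (-2))) := by
      rw [summandF, tmap_eq_mul_slot_slot _ hne]
      simp only [lt_irrefl, if_false, if_true, hlt]
      rw [(slot_commute hne _ _).eq]
      congr 2
      ext1 p
      by_cases h : p = a ∨ p = b
      · simp [h]
      · have h1 : p ≠ a := fun h' => h (Or.inl h')
        have h2 : p ≠ b := fun h' => h (Or.inr h')
        have h3 : p < b ↔ p < a := by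
          simp only [ha, hb, leftPos, rightPos, Fin.lt_def, ne_eq, Fin.ext_iff] at *
          omega
        simp only [h2, h3, if_false]
    have hZc : Commute Z (braidOp r n t) := braidOp_commute_tmap t (if_pos (Or.inl rfl))
      (if_pos (Or.inr rfl))
    rw [e1, e2, ← mul_add]
    refine hZc.mul_left ?_
    rw [braidOp_eq]
    refine Commute.smul_right ?_ _
    have hR := rmat_mul_F hr hne
    have hP : permEnd r (Equiv.swap a b) *
        (slot b (opF r) + slot a (opF r) * slot b (kz r (-2))) =
        (slot a (opF r) + slot b (opF r) * slot a (kz r (-2))) * permEnd r (Equiv.swap a b) := by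
      rw [mul_add, ← mul_assoc, permEnd_mul_slot, permEnd_mul_slot, mul_assoc, permEnd_mul_slot,
        Equiv.swap_apply_left, Equiv.swap_apply_right, ← mul_assoc, ← add_mul]
    rw [Commute, SemiconjBy, ← mul_assoc, ← ha, ← hb, ← hP, mul_assoc, ← hR, mul_assoc]

lemma braidOp_commute_Hn (hr : 1 ≤ r) (t : Fin (n - 1)) :
    Commute (Hn r n) (braidOp r n t) := by
  have hne := leftPos_ne_rightPos t
  rw [Hn_eq]
  refine commute_sum_of_pair hne (fun s h1 h2 => ?_) ?_
  · exact braidOp_commute_tmap t (by rw [Pi.mulSingle_eq_of_ne h1.symm])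
      (by rw [Pi.mulSingle_eq_of_ne h2.symm])
  · rw [braidOp_eq]
    refine (Commute.mul_right ?_ (rmat_commute_H₁ hr hne)).smul_right _
    have h1 := permEnd_mul_slot (r := r) (Equiv.swap (leftPos t) (rightPos t)) (leftPos t) (H₁ r)
    have h2 := permEnd_mul_slot (r := r) (Equiv.swap (leftPos t) (rightPos t)) (rightPos t) (H₁ r)
    rw [Equiv.swap_apply_left] at h1
    rw [Equiv.swap_apply_right] at h2
    rw [Commute, SemiconjBy, mul_add, h1, h2, ← add_mul, add_comm]

lemma mem_strongWeightSpace {l : ℕ} {v : TP r n} : v ∈ strongWeightSpace r n l ↔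
    Hn r n v = ((n : ℂ) * ((r : ℂ) - 1) - 2 * l) • v := by
  rw [strongWeightSpace, LinearMap.mem_ker]
  exact sub_eq_zero

lemma mem_Wspace {l : ℕ} {v : TP r n} : v ∈ Wspace r n l ↔
    (tensorPower r n).E v = 0 ∧ v ∈ strongWeightSpace r n l := Iff.rfl

lemma mem_Nspace {l : ℕ} {v : TP r n} : v ∈ Nspace r n l ↔
    (tensorPower r n).F ((tensorPower r n).E ((tensorPower r n).F ((tensorPower r n).E v))) = 0 ∧
      v ∈ strongWeightSpace r n l := by
  rw [Nspace, Submodule.mem_inf, LinearMap.mem_ker, pow_two]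
  rfl

lemma strongWeightSpace_invariant (hr : 1 ≤ r) (l : ℕ) (g : BraidGroup n) {v : TP r n}
    (hv : v ∈ strongWeightSpace r n l) : braidRep hr n g v ∈ strongWeightSpace r n l := by
  rw [mem_strongWeightSpace] at hv ⊢
  rw [← Module.End.mul_apply, (braidRep_commute hr (braidOp_commute_Hn hr) g).eq,
    Module.End.mul_apply, hv, map_smul]

lemma Wspace_invariant (hr : 1 ≤ r) (l : ℕ) (g : BraidGroup n) {v : TP r n}
    (hv : v ∈ Wspace r n l) : braidRep hr n g v ∈ Wspace r n l := by
  have hE := braidRep_commute hr (braidOp_commute_E hr) g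
  rw [mem_Wspace] at hv ⊢
  refine ⟨?_, strongWeightSpace_invariant hr l g hv.2⟩
  rw [← Module.End.mul_apply, hE.eq, Module.End.mul_apply, hv.1, map_zero]

lemma Nspace_invariant (hr : 1 ≤ r) (l : ℕ) (g : BraidGroup n) {v : TP r n}
    (hv : v ∈ Nspace r n l) : braidRep hr n g v ∈ Nspace r n l := by
  have hE := braidRep_commute hr (braidOp_commute_E hr) g
  have hF := braidRep_commute hr (braidOp_commute_F hr) g
  rw [Nspace, Submodule.mem_inf, LinearMap.mem_ker] at hv ⊢
  refine ⟨?_, strongWeightSpace_invariant hr l g hv.2⟩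
  rw [← Module.End.mul_apply, ((hF.mul_left hE).pow_left 2).eq, Module.End.mul_apply, hv.1,
    map_zero]

end

section

variable {r n : ℕ}

/-! ### Relations between the generators on a tensor power -/

lemma tmap_smul (c : Fin n → ℂ) (g : Fin n → Module.End ℂ (V r)) :
    (PiTensorProduct.map (fun p => c p • g p) : Module.End ℂ (TP r n)) =
      (∏ p, c p) • PiTensorProduct.map g :=
  PiTensorProduct.ext <| MultilinearMap.ext fun x => by
    simp only [LinearMap.compMultilinearMap_apply, PiTensorProduct.map_tprod,
      LinearMap.smul_apply]
    exact MultilinearMap.map_smul_univ _ _ _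

lemma tmap_mul_of_qcomm {g h : Fin n → Module.End ℂ (V r)} {c : Fin n → ℂ}
    (H : ∀ p, g p * h p = c p • (h p * g p)) :
    (PiTensorProduct.map g * PiTensorProduct.map h : Module.End ℂ (TP r n)) =
      (∏ p, c p) • (PiTensorProduct.map h * PiTensorProduct.map g) := by
  rw [← tmap_mul, ← tmap_mul, ← tmap_smul]
  congr 1
  exact funext H

/-- Only position t contributes: there E stands on one side and k² on the other. The power q^(-2) is
the one required by the Frobenius property `add_pow_of_qcomm`. -/
lemma summandE_qcomm {s t : Fin n} (h : s < t) :
    summandE r t * summandE r s = q r ^ (-2 : ℤ) • (summandE r s * summandE r t) := by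
  rw [summandE, summandE,
    tmap_mul_of_qcomm (c := fun p => if p = t then q r ^ (-2 : ℤ) else 1)]
  · simp
  · intro p
    rcases lt_trichotomy p t with hp | rfl | hp
    · simp [hp, hp.ne]
    · have e := kz_mul_E r 2
      simp only [lt_irrefl, if_false, if_true, h.not_gt, h.ne']
      rw [e, smul_smul, q_zpow_eq, ← zpow_add₀ (qHalf_ne_zero r)]
      norm_num
    · have h2 := h.trans hp
      simp [hp.not_gt, hp.ne', h2.not_gt, h2.ne']

lemma summandF_qcomm {s t : Fin n} (h : s < t) :
    summandF r s * summandF r t = q r ^ (-2 : ℤ) • (summandF r t * summandF r s) := by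
  rw [summandF, summandF,
    tmap_mul_of_qcomm (c := fun p => if p = s then q r ^ (-2 : ℤ) else 1)]
  · simp
  · intro p
    rcases lt_trichotomy p s with hp | rfl | hp
    · have h2 := hp.trans h
      simp [hp, hp.ne, h2]
    · have e := kz_mul_F r (-2)
      simp only [lt_irrefl, if_false, if_true, h]
      rw [e, smul_smul, q_zpow_eq, ← zpow_add₀ (qHalf_ne_zero r)]
      norm_num
    · simp [hp.not_gt, hp.ne']

lemma summandE_pow (t : Fin n) : summandE r t ^ r = 0 := by
  rw [summandE, tmap_eq_mul_slot _ t]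
  simp only [lt_irrefl, if_false, if_true]
  rw [(slot_commute_tmap (by simp) _).mul_pow, ← map_pow, opE_pow, map_zero, mul_zero]

lemma summandF_pow (t : Fin n) : summandF r t ^ r = 0 := by
  rw [summandF, tmap_eq_mul_slot _ t]
  simp only [lt_irrefl, if_false, if_true]
  rw [(slot_commute_tmap (by simp) _).mul_pow, ← map_pow, opF_pow, map_zero, mul_zero]

/-- The q-commuting summands are each nilpotent of order r, so the Frobenius property applies
repeatedly. Inserting the smallest position puts the q-commutation in the required order; for F the
largest position plays this role. -/
lemma tensorPower_E_pow (hr : 1 ≤ r) : (tensorPower r n).E ^ r = 0 := by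
  rw [tensorPower_E]
  suffices h : ∀ S : Finset (Fin n), (∑ t ∈ S, summandE r t) ^ r = 0 from h _
  intro S
  induction S using Finset.induction_on_min with
  | empty => simp [zero_pow (by omega : r ≠ 0)]
  | insert a S ha ih =>
    rw [Finset.sum_insert (fun h => lt_irrefl _ (ha a h))]
    refine (add_pow_of_qcomm (X := summandE r a) (Y := ∑ x ∈ S, summandE r x) hr ?_).trans
      ((congrArg₂ (· + ·) (summandE_pow a) ih).trans (add_zero _))
    rw [Finset.sum_mul, Finset.mul_sum, Finset.smul_sum]
    exact Finset.sum_congr rfl fun t ht => summandE_qcomm (ha t ht)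

lemma tensorPower_F_pow (hr : 1 ≤ r) : (tensorPower r n).F ^ r = 0 := by
  rw [tensorPower_F hr]
  suffices h : ∀ S : Finset (Fin n), (∑ t ∈ S, summandF r t) ^ r = 0 from h _
  intro S
  induction S using Finset.induction_on_max with
  | empty => simp [zero_pow (by omega : r ≠ 0)]
  | insert a S ha ih =>
    rw [Finset.sum_insert (fun h => lt_irrefl _ (ha a h))]
    refine (add_pow_of_qcomm (X := summandF r a) (Y := ∑ x ∈ S, summandF r x) hr ?_).trans
      ((congrArg₂ (· + ·) (summandF_pow a) ih).trans (add_zero _))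
    rw [Finset.sum_mul, Finset.mul_sum, Finset.smul_sum]
    exact Finset.sum_congr rfl fun t ht => summandF_qcomm (ha t ht)

/-- If s < t, moving k^(-2) past E at s and k² past F at t gives the factors q² and q^(-2), which
cancel. If t < s, in each position one of the two operators is the identity. -/
lemma summandE_comm_summandF {s t : Fin n} (h : s ≠ t) :
    Commute (summandE r s) (summandF r t) := by
  rcases lt_or_gt_of_ne h with h | h
  · rw [Commute, SemiconjBy, summandE, summandF, tmap_mul_of_qcomm
      (c := fun p => if p = s then qHalf r ^ (4 : ℤ) else if p = t then qHalf r ^ (-4 : ℤ) else 1)]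
    · rw [← Finset.mul_prod_erase _ _ (Finset.mem_univ s),
        ← Finset.mul_prod_erase _ _ (Finset.mem_erase.2 ⟨h.ne', Finset.mem_univ t⟩),
        Finset.prod_eq_one, if_pos rfl, if_neg h.ne', if_pos rfl, mul_one,
        ← zpow_add₀ (qHalf_ne_zero r)]
      · norm_num
      · intro x hx
        simp only [Finset.mem_erase] at hx
        rw [if_neg hx.2.1, if_neg hx.1]
    · intro p
      rcases lt_trichotomy p s with hp | rfl | hp
      · have h2 := hp.trans h
        simp [hp, hp.ne, h2, h2.ne]
      · have e := kz_mul_E r (-2)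
        simp only [lt_irrefl, if_false, if_true, h]
        rw [e, smul_smul, ← zpow_add₀ (qHalf_ne_zero r)]
        norm_num
      · rcases lt_trichotomy p t with hq | rfl | hq
        · simp only [hp.not_gt, hp.ne', hq, hq.ne, if_false, if_true, one_smul]
          exact kz_comm r 2 (-2)
        · have e := kz_mul_F r 2
          simp only [hp.not_gt, hp.ne', lt_irrefl, if_false, if_true]
          rw [e]
          norm_num
        · simp [hp.not_gt, hp.ne', hq.not_gt, hq.ne']
  · refine tmap_commute fun p => ?_
    rcases lt_or_ge p s with hp | hp
    · simp only [hp, if_true]; exact Commute.one_left _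
    · have h2 : t < p := lt_of_lt_of_le h hp
      simp only [h2.not_gt, h2.ne', if_false]
      exact Commute.one_right _

/-- `k^{-2} ⊗ ⋯ ⊗ k^{-2} ⊗ k^2 ⊗ ⋯ ⊗ k^2`, with `s` factors `k^{-2}`. -/
def mixedK (r n s : ℕ) : Module.End ℂ (TP r n) :=
  PiTensorProduct.map fun p : Fin n => if (p : ℕ) < s then kz r (-2) else kz r 2

/-- The commutators of equal-position summands telescope: `mixedK` interpolates between k² and
k^(-2) on the whole tensor power, one position at a time. The additive form keeps the telescoping
induction in `tensorPower_EF` free of subtractions. -/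
lemma summandE_mul_summandF (hr : 1 ≤ r) (t : Fin n) :
    summandE r t * summandF r t + (1 / qCurly r 1) • mixedK r n (t + 1) =
      summandF r t * summandE r t + (1 / qCurly r 1) • mixedK r n t := by
  set Z : Module.End ℂ (TP r n) := PiTensorProduct.map fun p : Fin n =>
    if p = t then 1 else if p < t then kz r (-2) else kz r 2 with hZ
  have key : ∀ {g : Fin n → Module.End ℂ (V r)} {X : Module.End ℂ (V r)},
      (∀ p, p < t → g p = kz r (-2)) → (∀ p, t < p → g p = kz r 2) → g t = X →
      (PiTensorProduct.map g : Module.End ℂ (TP r n)) = Z * slot t X := by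
    intro g X h1 h2 h3
    rw [tmap_eq_mul_slot g t, h3, hZ]
    congr 2
    ext1 p
    rcases lt_trichotomy p t with hp | rfl | hp
    · simp [hp, hp.ne, h1 p hp]
    · simp
    · simp [hp.not_gt, hp.ne', h2 p hp]
  have e1 : summandE r t * summandF r t = Z * slot t (opE r * opF r) := by
    rw [summandE, summandF, ← tmap_mul]
    refine key ?_ ?_ ?_
    · intro p hp; simp [hp]
    · intro p hp; simp [hp.not_gt, hp.ne']
    · simp
  have e2 : summandF r t * summandE r t = Z * slot t (opF r * opE r) := by
    rw [summandE, summandF, ← tmap_mul]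
    refine key ?_ ?_ ?_
    · intro p hp; simp [hp]
    · intro p hp; simp [hp.not_gt, hp.ne']
    · simp
  have e3 : mixedK r n (t + 1) = Z * slot t (kz r (-2)) := by
    rw [mixedK]
    refine key ?_ ?_ ?_
    · intro p hp; rw [if_pos]; rw [Fin.lt_def] at hp; omega
    · intro p hp; rw [if_neg]; rw [Fin.lt_def] at hp; omega
    · simp
  have e4 : mixedK r n t = Z * slot t (kz r 2) := by
    rw [mixedK]
    refine key ?_ ?_ ?_
    · intro p hp; rw [if_pos]; rwa [Fin.lt_def] at hp
    · intro p hp; rw [if_neg]; rw [Fin.lt_def] at hp; omega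
    · simp
  rw [e1, e2, e3, e4, ← mul_smul_comm, ← mul_smul_comm, ← map_smul, ← map_smul, ← mul_add,
    ← mul_add, ← map_add, ← map_add, E_mul_F hr]
  congr 2
  rw [smul_sub, add_assoc, sub_add_cancel]

lemma tensorPower_EF (hr : 1 ≤ r) :
    (tensorPower r n).E * (tensorPower r n).F + (1 / qCurly r 1) • mixedK r n n =
      (tensorPower r n).F * (tensorPower r n).E + (1 / qCurly r 1) • mixedK r n 0 := by
  have hEF : ∀ s : ℕ, s ≤ n →
      (∑ t : Fin n, if (t : ℕ) < s then summandE r t * summandF r t else 0) +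
        (1 / qCurly r 1) • mixedK r n s =
      (∑ t : Fin n, if (t : ℕ) < s then summandF r t * summandE r t else 0) +
        (1 / qCurly r 1) • mixedK r n 0 := by
    intro s hs
    induction s with
    | zero => simp
    | succ s ih =>
      have ih := ih (by omega)
      have hsplit : ∀ G : Fin n → Module.End ℂ (TP r n),
          (∑ t : Fin n, if (t : ℕ) < s + 1 then G t else 0) =
          (∑ t : Fin n, if (t : ℕ) < s then G t else 0) + G ⟨s, by omega⟩ := by
        intro G
        have : G ⟨s, by omega⟩ = ∑ t : Fin n, if t = ⟨s, by omega⟩ then G t else 0 := by simp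
        rw [this, ← Finset.sum_add_distrib]
        refine Finset.sum_congr rfl fun t _ => ?_
        rcases lt_trichotomy (t : ℕ) s with h | h | h
        · have : t ≠ ⟨s, by omega⟩ := fun h' => by simp [h'] at h
          simp [h, this, Nat.lt_succ_of_lt h]
        · have : t = ⟨s, by omega⟩ := Fin.ext h
          rw [if_pos (by omega), if_neg (by omega), if_pos this, zero_add]
        · have : t ≠ ⟨s, by omega⟩ := fun h' => by simp [h'] at h
          rw [if_neg (by omega), if_neg (by omega), if_neg this, add_zero]
      have hst := summandE_mul_summandF (n := n) hr ⟨s, by omega⟩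
      rw [hsplit, hsplit, add_assoc, hst, add_left_comm, ih, ← add_assoc]
      congr 1
      rw [add_comm]
  have h1 := hEF n le_rfl
  simp only [Fin.is_lt, if_true] at h1
  rw [tensorPower_E, tensorPower_F hr, Finset.sum_mul_sum, Finset.sum_mul_sum]
  have hE : ∑ s, ∑ t, summandE r s * summandF r t =
      (∑ s : Fin n, summandE r s * summandF r s) +
      ∑ s : Fin n, ∑ t ∈ Finset.univ.erase s, summandE r s * summandF r t := by
    rw [← Finset.sum_add_distrib]
    exact Finset.sum_congr rfl fun s _ =>
      (Finset.add_sum_erase _ (fun t => summandE r s * summandF r t) (Finset.mem_univ s)).symm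
  have hF : ∑ s, ∑ t, summandF r s * summandE r t =
      (∑ s : Fin n, summandF r s * summandE r s) +
      ∑ s : Fin n, ∑ t ∈ Finset.univ.erase s, summandE r s * summandF r t := by
    rw [Finset.sum_comm, ← Finset.sum_add_distrib]
    refine Finset.sum_congr rfl fun s _ => ?_
    rw [← Finset.add_sum_erase _ _ (Finset.mem_univ s)]
    congr 1
    refine Finset.sum_congr rfl fun t ht => ?_
    rw [(summandE_comm_summandF (Finset.ne_of_mem_erase ht).symm).eq]
  rw [hE, hF, add_right_comm, h1, add_right_comm]

lemma Hn_mul_of_slot {X : Module.End ℂ (TP r n)} {s : Fin n} {c : ℂ}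
    (h : ∀ p, p ≠ s → Commute (slot p (H₁ r)) X)
    (hs : slot s (H₁ r) * X = X * slot s (H₁ r) + c • X) : Hn r n * X = X * Hn r n + c • X := by
  rw [Hn_eq, Finset.sum_mul, Finset.mul_sum, ← Finset.add_sum_erase _ _ (Finset.mem_univ s),
    ← Finset.add_sum_erase _ (fun p => X * slot p (H₁ r)) (Finset.mem_univ s), hs,
    add_right_comm]
  congr 2
  exact Finset.sum_congr rfl fun p hp => (h p (Finset.ne_of_mem_erase hp)).eq

lemma Hn_mul_E : Hn r n * (tensorPower r n).E =
    (tensorPower r n).E * Hn r n + (2 : ℂ) • (tensorPower r n).E := by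
  rw [tensorPower_E, Finset.mul_sum, Finset.sum_mul, Finset.smul_sum, ← Finset.sum_add_distrib]
  refine Finset.sum_congr rfl fun s _ => Hn_mul_of_slot (s := s) (fun p hp => ?_) ?_
  · refine (slot_commute_tmap' ?_).symm
    split_ifs with h1
    · exact Commute.one_left _
    · exact (H₁_comm_kz r 2).symm
  · rw [summandE, tmap_eq_mul_slot _ s]
    simp only [lt_irrefl, if_false, if_true]
    rw [← mul_assoc, ← (slot_commute_tmap (by simp) _).eq, mul_assoc, ← map_mul, H₁_mul_E, map_add,
      map_smul, map_mul, mul_add, mul_smul_comm, mul_assoc]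

lemma Hn_mul_F (hr : 1 ≤ r) : Hn r n * (tensorPower r n).F =
    (tensorPower r n).F * Hn r n + (-2 : ℂ) • (tensorPower r n).F := by
  rw [tensorPower_F hr, Finset.mul_sum, Finset.sum_mul, Finset.smul_sum,
    ← Finset.sum_add_distrib]
  refine Finset.sum_congr rfl fun s _ => Hn_mul_of_slot (s := s) (fun p hp => ?_) ?_
  · refine (slot_commute_tmap' ?_).symm
    split_ifs with h1
    · exact (H₁_comm_kz r (-2)).symm
    · exact Commute.one_left _
  · rw [summandF, tmap_eq_mul_slot _ s]
    simp only [lt_irrefl, if_false, if_true]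
    rw [← mul_assoc, ← (slot_commute_tmap (by simp) _).eq, mul_assoc, ← map_mul, H₁_mul_F, map_add,
      map_smul, map_mul, mul_add, mul_smul_comm, mul_assoc]

/-! ### Strong weight spaces -/

/-- The level of a basis vector of a tensor power. -/
def level (f : Fin n → Fin r) : ℤ := ∑ p, ((f p : ℕ) : ℤ)

lemma level_nonneg (f : Fin n → Fin r) : 0 ≤ level f :=
  Finset.sum_nonneg fun _ _ => Int.natCast_nonneg _

lemma level_le (f : Fin n → Fin r) : level f ≤ n * ((r : ℤ) - 1) := by
  have : level f ≤ ∑ p : Fin n, ((r : ℤ) - 1) :=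
    Finset.sum_le_sum fun p _ => by have := (f p).2; omega
  rwa [Finset.sum_const, Finset.card_univ, Fintype.card_fin, nsmul_eq_mul] at this

lemma sum_weight (f : Fin n → Fin r) :
    ∑ p, ((r : ℤ) - 1 - 2 * (f p : ℕ)) = n * ((r : ℤ) - 1) - 2 * level f := by
  rw [Finset.sum_sub_distrib, level, Finset.mul_sum, Finset.sum_const, Finset.card_univ,
    Fintype.card_fin, nsmul_eq_mul]

lemma prod_zpow_eq_zpow_sum {ι : Type*} (S : Finset ι) {x : ℂ} (hx : x ≠ 0) (a : ι → ℤ) :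
    ∏ i ∈ S, x ^ a i = x ^ ∑ i ∈ S, a i := by
  classical
  induction S using Finset.induction_on with
  | empty => simp
  | insert i S hi ih => rw [Finset.prod_insert hi, Finset.sum_insert hi, ih, zpow_add₀ hx]

lemma Hn_tbasis (f : Fin n → Fin r) : Hn r n (tbasis r n f) =
    ((n : ℂ) * ((r : ℂ) - 1) - 2 * (level f : ℂ)) • tbasis r n f := by
  rw [Hn_eq, LinearMap.sum_apply,
    Finset.sum_congr rfl fun p _ => slot_tbasis_of_eigen p (H₁_u r (f p)), ← Finset.sum_smul]
  congr 1
  have := congr_arg (Int.cast : ℤ → ℂ) (sum_weight f)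
  push_cast at this
  rw [← this]

lemma tensorPower_k_tbasis (f : Fin n → Fin r) : (tensorPower r n).k (tbasis r n f) =
    qHalf r ^ ((n : ℤ) * ((r : ℤ) - 1) - 2 * level f) • tbasis r n f := by
  rw [tensorPower, tmap_tbasis_of_eigen (c := fun p => qHalf r ^ ((r : ℤ) - 1 - 2 * (f p : ℕ)))]
  · rw [← sum_weight, ← prod_zpow_eq_zpow_sum _ (qHalf_ne_zero r)]
  · intro p
    rw [steinberg_k_u, one_mul]

lemma mixedK_zero_tbasis (f : Fin n → Fin r) : mixedK r n 0 (tbasis r n f) =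
    q r ^ ((n : ℤ) * ((r : ℤ) - 1) - 2 * level f) • tbasis r n f := by
  rw [mixedK, tmap_tbasis_of_eigen (c := fun p => q r ^ ((r : ℤ) - 1 - 2 * (f p : ℕ)))]
  · rw [← sum_weight, ← prod_zpow_eq_zpow_sum _ (q_ne_zero r)]
  · intro p
    simp only [Nat.not_lt_zero, if_false, kz_u, q_zpow_eq]

lemma mixedK_full_tbasis (f : Fin n → Fin r) : mixedK r n n (tbasis r n f) =
    q r ^ (-((n : ℤ) * ((r : ℤ) - 1) - 2 * level f)) • tbasis r n f := by
  rw [mixedK, tmap_tbasis_of_eigen (c := fun p => q r ^ (-((r : ℤ) - 1 - 2 * (f p : ℕ))))]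
  · rw [← sum_weight, ← Finset.sum_neg_distrib, ← prod_zpow_eq_zpow_sum _ (q_ne_zero r)]
  · intro p
    simp only [Fin.is_lt, if_true, kz_u, q_zpow_eq]
    ring_nf

/-- The strong weight space of level `m`, for `m : ℤ`. -/
def Lev (r n : ℕ) (m : ℤ) : Submodule ℂ (TP r n) :=
  LinearMap.eqLocus (Hn r n) (((n : ℂ) * ((r : ℂ) - 1) - 2 * (m : ℂ)) • LinearMap.id)

lemma mem_Lev {m : ℤ} {v : TP r n} :
    v ∈ Lev r n m ↔ Hn r n v = ((n : ℂ) * ((r : ℂ) - 1) - 2 * (m : ℂ)) • v := Iff.rfl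

lemma Lev_natCast (m : ℕ) : Lev r n m = strongWeightSpace r n m := by
  ext v
  rw [mem_Lev, mem_strongWeightSpace]
  simp

/-- The operator H_n is diagonal in the standard basis and its eigenvalues separate levels. This is
what the reduced weight from k, known only modulo 4r, would not provide. -/
lemma mem_Lev_iff_repr {m : ℤ} {v : TP r n} :
    v ∈ Lev r n m ↔ ∀ f, level f ≠ m → (tbasis r n).repr v f = 0 := by
  have h : ∀ f v, (tbasis r n).repr (Hn r n v) f =
      ((n : ℂ) * ((r : ℂ) - 1) - 2 * (level f : ℂ)) * (tbasis r n).repr v f := by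
    intro f v
    have : (tbasis r n).coord f ∘ₗ Hn r n =
        ((n : ℂ) * ((r : ℂ) - 1) - 2 * (level f : ℂ)) • (tbasis r n).coord f := by
      refine (tbasis r n).ext fun g => ?_
      simp only [LinearMap.comp_apply, Hn_tbasis, map_smul, LinearMap.smul_apply,
        Module.Basis.coord_apply, Module.Basis.repr_self, smul_eq_mul]
      by_cases hfg : g = f
      · subst hfg; rfl
      · rw [Finsupp.single_eq_of_ne (Ne.symm hfg), mul_zero, mul_zero]
    exact LinearMap.congr_fun this v
  rw [mem_Lev]
  constructor
  · intro hv f hf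
    have h1 := h f v
    rw [hv, map_smul, Finsupp.smul_apply, smul_eq_mul] at h1
    have h2 : (m : ℂ) - level f ≠ 0 := by
      rw [sub_ne_zero]; exact_mod_cast hf.symm
    have h3 : (m - level f : ℂ) * (tbasis r n).repr v f = 0 := by linear_combination (-1 / 2) * h1
    exact (mul_eq_zero.1 h3).resolve_left h2
  · intro hv
    refine (tbasis r n).repr.injective (Finsupp.ext fun f => ?_)
    rw [h, map_smul, Finsupp.smul_apply, smul_eq_mul]
    by_cases hf : level f = m
    · rw [hf]
    · rw [hv f hf, mul_zero, mul_zero]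

lemma tbasis_mem_Lev (f : Fin n → Fin r) : tbasis r n f ∈ Lev r n (level f) :=
  mem_Lev.2 (Hn_tbasis f)

lemma Lev_eq_bot {m : ℤ} (h : m < 0 ∨ n * ((r : ℤ) - 1) < m) : Lev r n m = ⊥ := by
  refine (Submodule.eq_bot_iff _).2 fun v hv => ?_
  rw [mem_Lev_iff_repr] at hv
  refine (tbasis r n).repr.injective (Finsupp.ext fun f => ?_)
  rw [map_zero, Finsupp.zero_apply]
  refine hv f fun hf => ?_
  have := level_nonneg f
  have := level_le f
  omega

lemma eq_on_Lev {X Y : Module.End ℂ (TP r n)} {m : ℤ}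
    (h : ∀ f, level f = m → X (tbasis r n f) = Y (tbasis r n f)) {v : TP r n}
    (hv : v ∈ Lev r n m) : X v = Y v := by
  rw [mem_Lev_iff_repr] at hv
  rw [← (tbasis r n).sum_repr v, map_sum, map_sum]
  refine Finset.sum_congr rfl fun f _ => ?_
  rw [map_smul, map_smul]
  by_cases hf : level f = m
  · rw [h f hf]
  · rw [hv f hf, zero_smul, zero_smul]

/-- The projection onto the strong weight space of level `m`. -/
def levProj (r n : ℕ) (m : ℤ) : Module.End ℂ (TP r n) :=
  (tbasis r n).constr ℂ fun f => if level f = m then tbasis r n f else 0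

lemma levProj_tbasis (m : ℤ) (f : Fin n → Fin r) :
    levProj r n m (tbasis r n f) = if level f = m then tbasis r n f else 0 :=
  (tbasis r n).constr_basis ℂ _ f

lemma levProj_mem (m : ℤ) (v : TP r n) : levProj r n m v ∈ Lev r n m := by
  rw [← (tbasis r n).sum_repr v, map_sum]
  refine Submodule.sum_mem _ fun f _ => ?_
  rw [map_smul, levProj_tbasis]
  refine Submodule.smul_mem _ _ ?_
  split_ifs with h
  · exact h ▸ tbasis_mem_Lev f
  · exact Submodule.zero_mem _

lemma levProj_apply {m : ℤ} {v : TP r n} (hv : v ∈ Lev r n m) : levProj r n m v = v := by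
  have := eq_on_Lev (X := levProj r n m) (Y := 1) (fun f hf => ?_) hv
  · rw [this, Module.End.one_apply]
  · rw [levProj_tbasis, if_pos hf, Module.End.one_apply]

lemma levProj_apply_of_ne {m m' : ℤ} (h : m' ≠ m) {v : TP r n} (hv : v ∈ Lev r n m') :
    levProj r n m v = 0 := by
  have := eq_on_Lev (X := levProj r n m) (Y := 0) (fun f hf => ?_) hv
  · rw [this, LinearMap.zero_apply]
  · rw [levProj_tbasis, if_neg (by omega), LinearMap.zero_apply]

lemma sum_levProj (v : TP r n) : ∑ m ∈ Finset.Icc (0 : ℤ) (n * ((r : ℤ) - 1)), levProj r n m v = v := by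
  rw [← LinearMap.sum_apply]
  refine LinearMap.congr_fun (g := LinearMap.id) ((tbasis r n).ext fun f => ?_) v
  rw [LinearMap.sum_apply]
  simp only [levProj_tbasis, LinearMap.id_apply]
  rw [Finset.sum_ite_eq, if_pos (Finset.mem_Icc.2 ⟨level_nonneg f, level_le f⟩)]

lemma E_mem_Lev {m : ℤ} {v : TP r n} (hv : v ∈ Lev r n m) :
    (tensorPower r n).E v ∈ Lev r n (m - 1) := by
  rw [mem_Lev] at hv ⊢
  rw [← Module.End.mul_apply, Hn_mul_E, LinearMap.add_apply, Module.End.mul_apply, hv,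
    LinearMap.smul_apply, map_smul, ← add_smul]
  congr 1
  push_cast
  ring

lemma F_mem_Lev (hr : 1 ≤ r) {m : ℤ} {v : TP r n} (hv : v ∈ Lev r n m) :
    (tensorPower r n).F v ∈ Lev r n (m + 1) := by
  rw [mem_Lev] at hv ⊢
  rw [← Module.End.mul_apply, Hn_mul_F hr, LinearMap.add_apply, Module.End.mul_apply, hv,
    LinearMap.smul_apply, map_smul, ← add_smul]
  congr 1
  push_cast
  ring

lemma k_apply_of_mem_Lev {m : ℤ} {v : TP r n} (hv : v ∈ Lev r n m) :
    (tensorPower r n).k v = qHalf r ^ ((n : ℤ) * ((r : ℤ) - 1) - 2 * m) • v := by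
  refine eq_on_Lev (Y := qHalf r ^ ((n : ℤ) * ((r : ℤ) - 1) - 2 * m) • 1) (fun f hf => ?_) hv
  rw [tensorPower_k_tbasis, hf]
  rfl

/-! ### The Casimir operator -/

/-- The scalar by which `C - F E` acts on vectors of level `m`, `C` being the Casimir operator. -/
def casScalar (r n : ℕ) (m : ℤ) : ℂ :=
  (q r ^ ((n : ℤ) * ((r : ℤ) - 1) - 2 * m + 1) + q r ^ (-((n : ℤ) * ((r : ℤ) - 1) - 2 * m + 1))) /
    qCurly r 1 ^ 2

/-- The Casimir operator on a tensor power. -/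
def casimir (r n : ℕ) : Module.End ℂ (TP r n) :=
  (tensorPower r n).F * (tensorPower r n).E +
    (tbasis r n).constr ℂ fun f => casScalar r n (level f) • tbasis r n f

lemma casimir_eq_FE {m : ℤ} {v : TP r n} (hv : v ∈ Lev r n m) : casimir r n v =
    (tensorPower r n).F ((tensorPower r n).E v) + casScalar r n m • v := by
  rw [casimir, LinearMap.add_apply, Module.End.mul_apply]
  congr 1
  refine eq_on_Lev (Y := casScalar r n m • 1) (fun f hf => ?_) hv
  rw [Module.Basis.constr_basis, hf]
  rfl

/-- The difference of consecutive Casimir scalars is the value of [E, F] on that level, so FE and EF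
give the same Casimir operator. -/
lemma casScalar_succ (hr : 2 ≤ r) (m : ℤ) : casScalar r n m +
    1 / qCurly r 1 * q r ^ (-((n : ℤ) * ((r : ℤ) - 1) - 2 * m)) =
    casScalar r n (m + 1) + 1 / qCurly r 1 * q r ^ ((n : ℤ) * ((r : ℤ) - 1) - 2 * m) := by
  have h := qCurly_one_ne_zero hr
  have hq := q_ne_zero r
  rw [casScalar, casScalar, show ∀ x : ℂ, 1 / qCurly r 1 * x = qCurly r 1 * x / qCurly r 1 ^ 2 by
    intro x; field_simp, show ∀ x : ℂ, 1 / qCurly r 1 * x = qCurly r 1 * x / qCurly r 1 ^ 2 by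
    intro x; field_simp, ← add_div, ← add_div]
  congr 1
  simp only [qCurly, sub_mul, ← zpow_add₀ hq]
  ring_nf

lemma casimir_eq_EF (hr : 2 ≤ r) {m : ℤ} {v : TP r n} (hv : v ∈ Lev r n m) : casimir r n v =
    (tensorPower r n).E ((tensorPower r n).F v) + casScalar r n (m + 1) • v := by
  have h := LinearMap.congr_fun (tensorPower_EF (r := r) (n := n) (by omega)) v
  have h0 : mixedK r n 0 v = q r ^ ((n : ℤ) * ((r : ℤ) - 1) - 2 * m) • v :=
    eq_on_Lev (Y := q r ^ ((n : ℤ) * ((r : ℤ) - 1) - 2 * m) • 1)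
      (fun f hf => by rw [mixedK_zero_tbasis, hf]; rfl) hv
  have h1 : mixedK r n n v = q r ^ (-((n : ℤ) * ((r : ℤ) - 1) - 2 * m)) • v :=
    eq_on_Lev (Y := q r ^ (-((n : ℤ) * ((r : ℤ) - 1) - 2 * m)) • 1)
      (fun f hf => by rw [mixedK_full_tbasis, hf]; rfl) hv
  simp only [LinearMap.add_apply, LinearMap.smul_apply, Module.End.mul_apply, h0, h1,
    smul_smul] at h
  have hc := casScalar_succ (n := n) hr m
  rw [casimir_eq_FE hv]
  set a := 1 / qCurly r 1 * q r ^ ((n : ℤ) * ((r : ℤ) - 1) - 2 * m)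
  set b := 1 / qCurly r 1 * q r ^ (-((n : ℤ) * ((r : ℤ) - 1) - 2 * m))
  refine add_right_cancel (b := a • v) ?_
  rw [add_right_comm, ← h, add_assoc, add_assoc, ← add_smul, ← add_smul]
  congr 2
  rw [add_comm, hc]

end

section

/-! ### Freeness over `ℂ[E]` and `ℂ[F]` -/

/-- If `A + B` is nilpotent of order `r`, and `A` lowers a grading with `r` degrees in which it is
free, whereas `B` preserves the grading, then `A + B` is free. -/
lemma exists_pow_eq_of_graded {M : Type*} [AddCommGroup M] [Module ℂ M] {r : ℕ} (hr : 1 ≤ r)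
    {T A B : Module.End ℂ M} {P : ℕ → Module.End ℂ M} (hT : ∀ v, T v = A v + B v)
    (hnil : T ^ r = 0)
    (hB : ∀ a v, P a (B v) = B (P a v)) (hA : ∀ a, a + 1 < r → ∀ v, P a (A v) = A (P (a + 1) v))
    (hinj : ∀ a, a + 1 < r → ∀ v, A (P (a + 1) v) = 0 → P (a + 1) v = 0)
    (hsep : ∀ v, (∀ a < r, P a v = 0) → v = 0)
    (hsurj : ∀ v, ∃ w, (A ^ (r - 1)) w = P 0 v ∧ P (r - 1) w = w ∧ ∀ b < r - 1, P b w = 0)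
    {v : M} (hv : T v = 0) : ∃ w, v = (T ^ (r - 1)) w := by
  obtain ⟨w, hw, hw1, hw0⟩ := hsurj v
  -- The vector w sits in the top degree. Each application of T lowers the bottom degree by at most
  -- one, and the bottom component only sees A.
  have h1 : ∀ s b, (b + s < r - 1 → P b ((T ^ s) w) = 0) ∧
      (b + s = r - 1 → P b ((T ^ s) w) = (A ^ s) w) := by
    intro s
    induction s with
    | zero =>
      intro b
      refine ⟨fun h => hw0 b h, ?_⟩
      rintro rfl
      simpa using hw1
    | succ s ih =>
      intro b
      rw [pow_succ' T, pow_succ' A, Module.End.mul_apply, Module.End.mul_apply, hT, map_add, hB]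
      refine ⟨fun h => ?_, fun h => ?_⟩
      · rw [hA b (by omega), (ih (b + 1)).1 (by omega), (ih b).1 (by omega)]
        simp
      · rw [hA b (by omega), (ih (b + 1)).2 (by omega), (ih b).1 (by omega)]
        simp
  refine ⟨w, sub_eq_zero.1 (hsep _ ?_)⟩
  set d := v - (T ^ (r - 1)) w with hd
  have hTd : T d = 0 := by
    rw [hd, map_sub, hv, ← Module.End.mul_apply, ← pow_succ', Nat.sub_add_cancel hr, hnil]
    simp
  -- The difference d has no component in degree 0 and Td = 0. Inductively, if its component in
  -- degree a vanishes, A kills the component in degree a + 1, which is then zero by `hinj`.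
  intro a
  induction a with
  | zero => intro _; rw [hd, map_sub, (h1 (r - 1) 0).2 (by omega), hw, sub_self]
  | succ a ih =>
    intro ha
    refine hinj a ha d ?_
    rw [← hA a ha]
    have : P a (A d) + P a (B d) = 0 := by rw [← map_add, ← hT, hTd, map_zero]
    rwa [hB, ih (by omega), map_zero, add_zero] at this

variable {r n : ℕ}

/-- The projection of `V_{r-1}` onto the line through `u_a`. -/
def lineProj (r a : ℕ) : Module.End ℂ (V r) :=
  (Pi.basisFun ℂ (Fin r)).constr ℂ fun m : Fin r => if (m : ℕ) = a then u r m else 0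

lemma lineProj_u (a m : ℕ) : lineProj r a (u r m) = if m = a then u r m else 0 := by
  by_cases h : m < r
  · exact constr_u (fun m => if m = a then u r m else 0) h
  · rw [u_of_le (by omega)]
    simp

lemma sum_lineProj : ∑ a ∈ Finset.range r, lineProj r a = 1 :=
  V_hom_ext fun m hm => by
    rw [LinearMap.sum_apply]
    simp only [lineProj_u]
    rw [Finset.sum_ite_eq, if_pos (Finset.mem_range.2 hm), Module.End.one_apply]

lemma lineProj_mul_E {a : ℕ} (ha : a + 1 < r) :
    lineProj r a * opE r = opE r * lineProj r (a + 1) :=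
  V_hom_ext fun m hm => by
    rw [Module.End.mul_apply, Module.End.mul_apply, steinberg_E_u r 1 hm, lineProj_u]
    by_cases h1 : m = 0
    · rw [if_pos h1, if_neg (by omega), map_zero, map_zero]
    by_cases h2 : m = a + 1
    · subst h2
      rw [if_neg h1, if_pos rfl, lineProj_u, if_pos (by omega), steinberg_E_u r 1 ha, if_neg h1]
    · rw [if_neg h1, if_neg h2, lineProj_u, if_neg (by omega), map_zero]

lemma lineProj_mul_F {a : ℕ} (ha : a + 1 < r) :
    lineProj r (a + 1) * opF r = opF r * lineProj r a :=
  V_hom_ext fun m hm => by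
    rw [Module.End.mul_apply, Module.End.mul_apply, steinberg_F_u r 1, map_smul, lineProj_u,
      lineProj_u]
    by_cases h : m = a
    · subst h
      rw [if_pos rfl, if_pos rfl, steinberg_F_u]
    · rw [if_neg (by omega), if_neg h, map_zero, smul_zero]

lemma lineProj_comm_kz (a : ℕ) (z : ℤ) : Commute (lineProj r a) (kz r z) :=
  V_hom_ext fun m hm => by
    rw [Module.End.mul_apply, Module.End.mul_apply, kz_u, map_smul, lineProj_u]
    split_ifs
    · rw [kz_u]
    · rw [map_zero, smul_zero]

/-- A left inverse of `E` away from `u_0`. -/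
def raiseE (r : ℕ) : Module.End ℂ (V r) :=
  (Pi.basisFun ℂ (Fin r)).constr ℂ fun m : Fin r => u r (m + 1)

lemma raiseE_mul_E (a : ℕ) :
    raiseE r * opE r * lineProj r (a + 1) = lineProj r (a + 1) :=
  V_hom_ext fun m hm => by
    rw [Module.End.mul_apply, lineProj_u]
    split_ifs with h
    · rw [Module.End.mul_apply, steinberg_E_u r 1 hm, if_neg (by omega), raiseE,
        constr_u (fun m => u r (m + 1)) (by omega : m - 1 < r), Nat.sub_add_cancel (by omega)]
    · rw [map_zero]

/-- A left inverse of `F` away from `u_{r-1}`. -/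
def raiseF (r : ℕ) : Module.End ℂ (V r) :=
  (Pi.basisFun ℂ (Fin r)).constr ℂ fun m : Fin r =>
    (qInt r m * qInt r (r - m))⁻¹ • u r (m - 1)

lemma F_coeff_ne_zero (hr : 2 ≤ r) {m : ℕ} (h : m + 1 < r) :
    qInt r (m + 1) * qInt r (r - 1 - m) ≠ 0 := by
  refine mul_ne_zero ?_ ?_ <;> rw [Ne, qInt_eq_zero_iff hr] <;> intro hd <;>
    have := Int.le_of_dvd (by omega) hd <;> omega

lemma raiseF_mul_F (hr : 2 ≤ r) {a : ℕ} (ha : a + 1 < r) :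
    raiseF r * opF r * lineProj r a = lineProj r a :=
  V_hom_ext fun m hm => by
    rw [Module.End.mul_apply, lineProj_u]
    split_ifs with h
    · subst h
      rw [Module.End.mul_apply, steinberg_F_u, map_smul, raiseF,
        constr_u (fun m => (qInt r m * qInt r (r - m))⁻¹ • u r (m - 1)) ha, smul_smul]
      have h1 := F_coeff_ne_zero hr ha
      have h2 : ((r : ℤ) - 1 - m) = r - (m + 1 : ℕ) := by push_cast; ring
      rw [h2] at h1 ⊢
      push_cast at h1 ⊢
      rw [one_pow, one_mul, mul_inv_cancel₀ h1, one_smul]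
    · rw [map_zero]

/-- The operator sending `u_a` to `u_b` and all other basis vectors to `0`. -/
def unitOp (r a b : ℕ) : Module.End ℂ (V r) :=
  (Pi.basisFun ℂ (Fin r)).constr ℂ fun m : Fin r => if (m : ℕ) = a then u r b else 0

lemma unitOp_u {a b m : ℕ} (hm : m < r) : unitOp r a b (u r m) = if m = a then u r b else 0 :=
  constr_u (fun m => if m = a then u r b else 0) hm

lemma lineProj_mul_unitOp (a b c : ℕ) :
    lineProj r c * unitOp r a b = if b = c then unitOp r a b else 0 :=
  V_hom_ext fun m hm => by
    rw [Module.End.mul_apply, unitOp_u hm]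
    split_ifs with h1 h2 h2
    · rw [lineProj_u, if_pos h2, unitOp_u hm, if_pos h1]
    · rw [lineProj_u, if_neg h2, LinearMap.zero_apply]
    · rw [map_zero, unitOp_u hm, if_neg h1]
    · rw [map_zero, LinearMap.zero_apply]

lemma E_pow_mul_unitOp (hr : 1 ≤ r) : opE r ^ (r - 1) * unitOp r 0 (r - 1) = lineProj r 0 :=
  V_hom_ext fun m hm => by
    rw [Module.End.mul_apply, unitOp_u hm, lineProj_u]
    split_ifs with h
    · subst h
      rw [opE_pow_u r (r - 1) (by omega), if_pos le_rfl, Nat.sub_self]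
    · rw [map_zero]

lemma F_pow_mul_unitOp (hr : 2 ≤ r) : ∃ c : ℂ,
    opF r ^ (r - 1) * (c • unitOp r (r - 1) 0) = lineProj r (r - 1) := by
  refine ⟨(∏ s ∈ Finset.range (r - 1), qInt r ((0 : ℕ) + s + 1) *
    qInt r (r - 1 - ((0 : ℕ) + s)))⁻¹, V_hom_ext fun m hm => ?_⟩
  rw [Module.End.mul_apply, LinearMap.smul_apply, unitOp_u hm, lineProj_u]
  split_ifs with h
  · subst h
    rw [map_smul, opF_pow_u, smul_smul, inv_mul_cancel₀, one_smul, zero_add]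
    refine Finset.prod_ne_zero_iff.2 fun s hs => ?_
    have := F_coeff_ne_zero hr (m := s) (by rw [Finset.mem_range] at hs; omega)
    simpa using this
  · rw [smul_zero, map_zero]

lemma slot_commute_sum_erase {T : Fin n → Module.End ℂ (TP r n)} {a : Fin n}
    {A : Module.End ℂ (V r)} (h : ∀ t, t ≠ a → Commute (slot a A) (T t)) :
    Commute (slot a A) (∑ t ∈ Finset.univ.erase a, T t) :=
  Commute.sum_right _ _ _ fun t ht => h t (Finset.ne_of_mem_erase ht)

lemma eq_zero_of_slot_lineProj {a : Fin n} {v : TP r n}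
    (h : ∀ b < r, slot a (lineProj r b) v = 0) : v = 0 := by
  have : (∑ b ∈ Finset.range r, slot a (lineProj r b)) v = v := by
    rw [← map_sum, sum_lineProj, map_one, Module.End.one_apply]
  rw [← this, LinearMap.sum_apply]
  exact Finset.sum_eq_zero fun b hb => h b (Finset.mem_range.1 hb)

/-- Grade by the index of the basis vector in the first tensor factor. The summand with E in that
factor lowers the index and is free there up to the invertible operator Z; all other summands act by
the identity on the first factor. This is where n ≥ 1 enters. -/
lemma tensorPower_E_exact (hn : 1 ≤ n) (hr : 2 ≤ r) {v : TP r n} (hv : (tensorPower r n).E v = 0) :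
    ∃ w, v = ((tensorPower r n).E ^ (r - 1)) w := by
  set o : Fin n := ⟨0, hn⟩ with ho
  set Z : Module.End ℂ (TP r n) := PiTensorProduct.map fun p : Fin n =>
    if p = o then 1 else kz r 2 with hZ
  set Z' : Module.End ℂ (TP r n) := PiTensorProduct.map fun p : Fin n =>
    if p = o then 1 else kz r (-2) with hZ'
  have hZZ : Z' * Z = 1 := by
    rw [hZ, hZ', ← tmap_mul]
    refine Eq.trans ?_ PiTensorProduct.map_one
    congr 1
    ext1 p
    by_cases h : p = o
    · simp [h]
    · simp only [Pi.mul_apply, h, if_false]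
      rw [← kz_add, neg_add_cancel, kz_zero]
  have hZZ' : Z * Z' = 1 := by
    have : Commute Z Z' := tmap_commute fun p => by
      by_cases h : p = o
      · simp [h]
      · simp only [h, if_false]; exact kz_comm r _ _
    rw [this.eq, hZZ]
  have hZc : ∀ X : Module.End ℂ (V r), Commute Z (slot o X) := fun X =>
    slot_commute_tmap (by simp) X
  have hA : summandE r o = Z * slot o (opE r) := by
    rw [summandE, tmap_eq_mul_slot _ o]
    simp only [lt_irrefl, if_false, if_true]
    congr 2
    ext1 p
    by_cases h : p = o
    · simp [h]
    · have : ¬ p < o := by simp [ho, Fin.lt_def]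
      simp [h, this]
  have hsum : (tensorPower r n).E = summandE r o + ∑ t ∈ Finset.univ.erase o, summandE r t := by
    rw [tensorPower_E, Finset.add_sum_erase _ _ (Finset.mem_univ o)]
  refine exists_pow_eq_of_graded (by omega : 1 ≤ r) (A := summandE r o)
    (B := ∑ t ∈ Finset.univ.erase o, summandE r t) (P := fun a => slot o (lineProj r a))
    (fun v => by rw [hsum, LinearMap.add_apply]) (tensorPower_E_pow (by omega)) ?_ ?_ ?_
    (fun v => eq_zero_of_slot_lineProj) ?_ hv
  · intro a v
    refine LinearMap.congr_fun (slot_commute_sum_erase fun t ht => ?_).eq v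
    have : o < t := by
      rw [Fin.lt_def]
      have : (t : ℕ) ≠ 0 := fun h => ht (Fin.ext h)
      simp only [ho]
      omega
    exact (slot_commute_tmap (by simp [this]) _).symm
  · intro a ha v
    refine LinearMap.congr_fun (f := slot o (lineProj r a) * summandE r o)
      (g := summandE r o * slot o (lineProj r (a + 1))) ?_ v
    rw [hA, ← mul_assoc, ← (hZc _).eq, mul_assoc, ← map_mul, lineProj_mul_E ha, map_mul, mul_assoc]
  · intro a ha v h0
    have h1 : slot o (raiseE r) * Z' * summandE r o * slot o (lineProj r (a + 1)) =
        slot o (lineProj r (a + 1)) := by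
      rw [hA, mul_assoc (slot o _) Z', ← mul_assoc Z', hZZ, one_mul, ← map_mul, ← map_mul,
        raiseE_mul_E]
    rw [← h1]
    simp only [Module.End.mul_apply]
    rw [h0, map_zero, map_zero]
  · intro v
    refine ⟨slot o (unitOp r 0 (r - 1)) ((Z' ^ (r - 1)) v), ?_, ?_, ?_⟩
    · refine LinearMap.congr_fun (f := summandE r o ^ (r - 1) * (slot o (unitOp r 0 (r - 1)) *
        Z' ^ (r - 1))) ?_ v
      have hp : Z ^ (r - 1) * Z' ^ (r - 1) = 1 := by
        rw [← Commute.mul_pow (by rw [Commute, SemiconjBy, hZZ, hZZ']), hZZ', one_pow]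
      rw [hA, (hZc _).mul_pow, ← map_pow, mul_assoc, ← mul_assoc (slot o _), ← map_mul,
        E_pow_mul_unitOp (by omega), ← mul_assoc, ((hZc _).pow_left _).eq, mul_assoc, hp, mul_one]
    · rw [← Module.End.mul_apply, ← map_mul, lineProj_mul_unitOp, if_pos rfl]
    · intro b hb
      rw [← Module.End.mul_apply, ← map_mul, lineProj_mul_unitOp, if_neg (by omega), map_zero,
        LinearMap.zero_apply]

/-- As for E, but F raises the index, so the grading is reversed. No auxiliary invertible operator
is needed since F in the first factor is followed by identities; the other summands act on that
factor by k^(-2), which preserves each line. -/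
lemma tensorPower_F_exact (hn : 1 ≤ n) (hr : 2 ≤ r) {v : TP r n} (hv : (tensorPower r n).F v = 0) :
    ∃ w, v = ((tensorPower r n).F ^ (r - 1)) w := by
  set o : Fin n := ⟨0, hn⟩ with ho
  have hA : summandF r o = slot o (opF r) := by
    rw [summandF, tmap_eq_mul_slot _ o]
    simp only [lt_irrefl, if_false, if_true]
    refine Eq.trans ?_ (one_mul _)
    congr 1
    refine Eq.trans ?_ PiTensorProduct.map_one
    congr 1
    ext1 p
    by_cases h : p = o
    · simp [h]
    · have : ¬ p < o := by simp [ho, Fin.lt_def]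
      simp [h, this]
  have hsum : (tensorPower r n).F = summandF r o + ∑ t ∈ Finset.univ.erase o, summandF r t := by
    rw [tensorPower_F (by omega), Finset.add_sum_erase _ _ (Finset.mem_univ o)]
  refine exists_pow_eq_of_graded (by omega : 1 ≤ r) (A := summandF r o)
    (B := ∑ t ∈ Finset.univ.erase o, summandF r t) (P := fun a => slot o (lineProj r (r - 1 - a)))
    (fun v => by rw [hsum, LinearMap.add_apply]) (tensorPower_F_pow (by omega)) ?_ ?_ ?_
    (fun v h => eq_zero_of_slot_lineProj fun b hb => by
      have := h (r - 1 - b) (by omega)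
      rwa [show r - 1 - (r - 1 - b) = b by omega] at this) ?_ hv
  · intro a v
    refine LinearMap.congr_fun (slot_commute_sum_erase fun t ht => ?_).eq v
    have : o < t := by
      rw [Fin.lt_def]
      have : (t : ℕ) ≠ 0 := fun h => ht (Fin.ext h)
      simp only [ho]
      omega
    refine (slot_commute_tmap' ?_).symm
    rw [if_pos this]
    exact (lineProj_comm_kz _ _).symm
  · intro a ha v
    refine LinearMap.congr_fun (f := slot o (lineProj r (r - 1 - a)) * summandF r o)
      (g := summandF r o * slot o (lineProj r (r - 1 - (a + 1)))) ?_ v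
    rw [hA, ← map_mul, ← map_mul, ← lineProj_mul_F (by omega),
      show r - 1 - (a + 1) + 1 = r - 1 - a by omega]
  · intro a ha v h0
    have h1 : slot o (raiseF r) * summandF r o * slot o (lineProj r (r - 1 - (a + 1))) =
        slot o (lineProj r (r - 1 - (a + 1))) := by
      rw [hA, ← map_mul, ← map_mul, raiseF_mul_F hr (by omega)]
    rw [← h1]
    simp only [Module.End.mul_apply]
    rw [h0, map_zero]
  · intro v
    obtain ⟨c, hc⟩ := F_pow_mul_unitOp hr
    refine ⟨slot o (c • unitOp r (r - 1) 0) v, ?_, ?_, ?_⟩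
    · refine LinearMap.congr_fun (f := summandF r o ^ (r - 1) * slot o (c • unitOp r (r - 1) 0))
        ?_ v
      rw [hA, ← map_pow, ← map_mul, hc, Nat.sub_zero]
    · rw [← Module.End.mul_apply, ← map_mul, mul_smul_comm, lineProj_mul_unitOp,
        if_pos (by omega)]
    · intro b hb
      rw [← Module.End.mul_apply, ← map_mul, mul_smul_comm, lineProj_mul_unitOp,
        if_neg (by omega), smul_zero, map_zero, LinearMap.zero_apply]

end

section

variable {r n : ℕ}

/-! ### Coincidences between Casimir scalars -/

/-- The strong weight of the vectors of level `l`. -/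
def wt (r n : ℕ) (l : ℤ) : ℤ := n * ((r : ℤ) - 1) - 2 * l

/-- The distance from the level `l` to the next level with the same Casimir scalar, or `0` if this
distance is `r`. -/
def wall (r n : ℕ) (l : ℤ) : ℕ := ((wt r n l + 1) % r).toNat

lemma wall_lt (hr : 1 ≤ r) (l : ℤ) : wall r n l < r := by
  have h1 := Int.emod_nonneg (wt r n l + 1) (by omega : (r : ℤ) ≠ 0)
  have h2 := Int.emod_lt_of_pos (wt r n l + 1) (by omega : (0 : ℤ) < r)
  rw [wall]; omega

lemma dvd_wall (hr : 1 ≤ r) (l : ℤ) : (r : ℤ) ∣ wt r n l + 1 - wall r n l := by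
  have h1 := Int.emod_nonneg (wt r n l + 1) (by omega : (r : ℤ) ≠ 0)
  rw [wall, Int.toNat_of_nonneg h1]
  exact Int.dvd_self_sub_emod

lemma nat_eq_of_dvd_sub {a b : ℕ} (ha : a < r) (hb : b < r) (h : (r : ℤ) ∣ a - b) : a = b := by
  have := Int.eq_zero_of_abs_lt_dvd h (by rw [abs_lt]; omega)
  omega

lemma wall_eq_of_dvd {l : ℤ} {d : ℕ} (hd : d < r) (h : (r : ℤ) ∣ wt r n l + 1 - d) :
    wall r n l = d :=
  nat_eq_of_dvd_sub (wall_lt (by omega) l) hd (by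
    have := dvd_sub h (dvd_wall (n := n) (by omega : 1 ≤ r) l)
    rwa [sub_sub_sub_cancel_left] at this)

lemma wt_add (l s : ℤ) : wt r n (l + s) = wt r n l - 2 * s := by rw [wt, wt]; ring

/-- Levels with a common Casimir scalar are spaced alternately by d and r - d: the step upward from
l is d, and the next one is r - d. -/
lemma wall_add_wall {l : ℤ} (h : wall r n l ≠ 0) (hr : 1 ≤ r) :
    wall r n (l + wall r n l) = r - wall r n l := by
  have h1 := wall_lt (n := n) hr l
  refine wall_eq_of_dvd (by omega) ?_
  obtain ⟨e, he⟩ := dvd_wall (n := n) hr l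
  refine ⟨e - 1, ?_⟩
  rw [wt_add]
  push_cast [Nat.cast_sub h1.le]
  linear_combination he

lemma wall_sub_wall {l : ℤ} (h : wall r n l ≠ 0) (hr : 1 ≤ r) :
    wall r n (l - (r - wall r n l : ℕ)) = r - wall r n l := by
  have h1 := wall_lt (n := n) hr l
  refine wall_eq_of_dvd (by omega) ?_
  obtain ⟨e, he⟩ := dvd_wall (n := n) hr l
  refine ⟨e + 1, ?_⟩
  rw [sub_eq_add_neg l, wt_add]
  push_cast [Nat.cast_sub h1.le]
  linear_combination he

/-- The sign `α²` for the summands with head at level `l`. -/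
def wallSign (r n : ℕ) (l : ℤ) : ℂ := q r ^ (wt r n l + 1 - wall r n l)

/-- The scalar `α` for the summands with head at level `l`. -/
def wallRoot (r n : ℕ) (l : ℤ) : ℂ := qHalf r ^ (wt r n l + 1 - wall r n l)

lemma wallRoot_sq (l : ℤ) : wallRoot r n l ^ 2 = wallSign r n l := by
  rw [wallRoot, wallSign, q_zpow_eq, ← zpow_natCast, ← zpow_mul, mul_comm]
  rfl

lemma q_zpow_mul_self (hr : 1 ≤ r) {z : ℤ} (hz : (r : ℤ) ∣ z) : q r ^ z * q r ^ z = 1 := by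
  obtain ⟨e, rfl⟩ := hz
  rw [← zpow_add₀ (q_ne_zero r), q_zpow_eq, qHalf_zpow_eq_one_iff hr]
  exact ⟨e, by ring⟩

lemma wallSign_mul_self (hr : 1 ≤ r) (l : ℤ) : wallSign r n l * wallSign r n l = 1 :=
  q_zpow_mul_self hr (dvd_wall hr l)

lemma wallRoot_pow_four (hr : 1 ≤ r) (l : ℤ) : wallRoot r n l ^ 4 = 1 := by
  rw [show 4 = 2 * 2 from rfl, pow_mul, wallRoot_sq, sq, wallSign_mul_self hr]

lemma qInt_add_of_dvd (hr : 1 ≤ r) {z : ℤ} (hz : (r : ℤ) ∣ z) (y : ℤ) :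
    qInt r (z + y) = q r ^ z * qInt r y := by
  have h : q r ^ (-z) = q r ^ z := by
    rw [zpow_neg]
    exact inv_eq_of_mul_eq_one_right (q_zpow_mul_self hr hz)
  rw [qInt, qInt, qCurly.eq_1 r (z + y), qCurly.eq_1 r y, neg_add, zpow_add₀ (q_ne_zero r), zpow_add₀ (q_ne_zero r), h]
  ring

/-- The factorization of a difference of Casimir scalars into quantum integers serves twice: its
zeros locate the walls, and its values are the structure constants of the modules P_i^α and
V_{r-1}^α. -/
lemma casScalar_sub (hr : 2 ≤ r) (l s : ℤ) : casScalar r n l - casScalar r n (l + s) =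
    wallSign r n l * (qInt r s * qInt r (wall r n l - s)) := by
  have h1 : qInt r (wt r n l + 1 - s) = wallSign r n l * qInt r (wall r n l - s) := by
    rw [wallSign, ← qInt_add_of_dvd (by omega) (dvd_wall (by omega) l)]
    congr 1; ring
  rw [mul_left_comm, ← h1, qInt, qInt, casScalar, casScalar, ← sub_div, div_mul_div_comm, ← sq]
  congr 1
  simp only [qCurly, sub_mul, mul_sub, ← zpow_add₀ (q_ne_zero r), wt]
  ring_nf

lemma wallSign_ne_zero (l : ℤ) : wallSign r n l ≠ 0 := zpow_ne_zero _ (q_ne_zero r)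

lemma casScalar_add_eq_iff (hr : 2 ≤ r) (l s : ℤ) : casScalar r n (l + s) = casScalar r n l ↔
    (r : ℤ) ∣ s ∨ (r : ℤ) ∣ wall r n l - s := by
  rw [eq_comm, ← sub_eq_zero, casScalar_sub hr, mul_eq_zero, mul_eq_zero, qInt_eq_zero_iff hr,
    qInt_eq_zero_iff hr, or_iff_right (wallSign_ne_zero l)]

lemma casScalar_add_wall (hr : 2 ≤ r) (l : ℤ) :
    casScalar r n (l + wall r n l) = casScalar r n l :=
  (casScalar_add_eq_iff hr _ _).2 (Or.inr (by simp))

lemma casScalar_sub_wall (hr : 2 ≤ r) (l : ℤ) :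
    casScalar r n (l - (r - wall r n l : ℕ)) = casScalar r n l := by
  rw [sub_eq_add_neg]
  refine (casScalar_add_eq_iff hr _ _).2 (Or.inr ?_)
  push_cast [Nat.cast_sub (wall_lt (n := n) (by omega : 1 ≤ r) l).le]
  simp

lemma casScalar_add_ne (hr : 2 ≤ r) {l : ℤ} {s : ℕ} (h1 : 1 ≤ s)
    (h2 : s < wall r n l ∨ wall r n l < s ∧ s < r) :
    casScalar r n (l + s) ≠ casScalar r n l := by
  have hw := wall_lt (n := n) (by omega : 1 ≤ r) l
  rw [Ne, casScalar_add_eq_iff hr]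
  rintro (h | h)
  · have := Int.le_of_dvd (by omega) h
    omega
  · have := nat_eq_of_dvd_sub (by omega) (by omega) h
    omega

/-- The next coincidence below l is at distance r - d, so the levels strictly in between are
harmless. -/
lemma casScalar_sub_ne (hr : 2 ≤ r) {l : ℤ} {s : ℕ} (h1 : 1 ≤ s) (h2 : s < r - wall r n l) :
    casScalar r n (l - s) ≠ casScalar r n l := by
  rw [sub_eq_add_neg, Ne, casScalar_add_eq_iff hr, dvd_neg, sub_neg_eq_add]
  rintro (h | h)
  · have := Int.le_of_dvd (by omega) h
    omega
  · have := Int.le_of_dvd (by omega) h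
    omega

/-! ### Kernels of `E` and `(F E)^2` on the indecomposable projective modules -/

lemma gam_zero (r a : ℕ) : gam r a (0 : ℕ) = 0 := by
  simp [gam, qInt, qCurly_zero]

lemma gam_ne_zero {a m : ℕ} (hr : 2 ≤ r) (ha : a < r) (h1 : 1 ≤ m) (h2 : m ≤ a) :
    gam r a m ≠ 0 := by
  rw [gam]
  refine mul_ne_zero ?_ ?_ <;> rw [Ne, qInt_eq_zero_iff hr] <;> intro hd <;>
    have := Int.le_of_dvd (by omega) hd <;> omega

section Proj

variable {i : ℕ}

lemma wH_of_lt {m : ℕ} (h : m < i + 1) : wH r i m = Finsupp.single (.H ⟨m, h⟩) 1 := dif_pos h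
lemma wS_of_lt {m : ℕ} (h : m < i + 1) : wS r i m = Finsupp.single (.S ⟨m, h⟩) 1 := dif_pos h
lemma wL_of_lt {m : ℕ} (h : m < r - 2 - i + 1) : wL r i m = Finsupp.single (.L ⟨m, h⟩) 1 := dif_pos h
lemma wR_of_lt {m : ℕ} (h : m < r - 2 - i + 1) : wR r i m = Finsupp.single (.R ⟨m, h⟩) 1 := dif_pos h

lemma P_hom_ext {N : Type*} [AddCommMonoid N] [Module ℂ N] {f g : P r i →ₗ[ℂ] N}
    (hH : ∀ m ≤ i, f (wH r i m) = g (wH r i m)) (hS : ∀ m ≤ i, f (wS r i m) = g (wS r i m))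
    (hL : ∀ m ≤ r - 2 - i, f (wL r i m) = g (wL r i m))
    (hR : ∀ m ≤ r - 2 - i, f (wR r i m) = g (wR r i m)) : f = g := by
  refine Finsupp.lhom_ext' fun x => LinearMap.ext_ring ?_
  rcases x with m | m | m | m
  · simpa [wH_of_lt m.2] using hH m (by omega)
  · simpa [wS_of_lt m.2] using hS m (by omega)
  · simpa [wL_of_lt m.2] using hL m (by omega)
  · simpa [wR_of_lt m.2] using hR m (by omega)

variable (α : ℂ)

lemma proj_E_wH {m : ℕ} (h : m ≤ i) : (proj r i α).E (wH r i m) =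
    if m = 0 then wR r i (r - 2 - i) else gam r i m • wH r i (m - 1) + wS r i (m - 1) := by
  rw [wH_of_lt (by omega : m < i + 1)]
  exact (Finsupp.linearCombination_single ℂ _ _).trans (one_smul ℂ _)

lemma proj_E_wS {m : ℕ} (h : m ≤ i) : (proj r i α).E (wS r i m) =
    if m = 0 then 0 else gam r i m • wS r i (m - 1) := by
  rw [wS_of_lt (by omega : m < i + 1)]
  exact (Finsupp.linearCombination_single ℂ _ _).trans (one_smul ℂ _)

lemma proj_E_wL {m : ℕ} (h : m ≤ r - 2 - i) : (proj r i α).E (wL r i m) =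
    if m = 0 then wS r i i else -gam r (r - 2 - i) m • wL r i (m - 1) := by
  rw [wL_of_lt (by omega : m < r - 2 - i + 1)]
  exact (Finsupp.linearCombination_single ℂ _ _).trans (one_smul ℂ _)

lemma proj_E_wR {m : ℕ} (h : m ≤ r - 2 - i) : (proj r i α).E (wR r i m) =
    if m = 0 then 0 else wR r i (m - 1) := by
  rw [wR_of_lt (by omega : m < r - 2 - i + 1)]
  exact (Finsupp.linearCombination_single ℂ _ _).trans (one_smul ℂ _)

lemma proj_F_wH {m : ℕ} (h : m ≤ i) : (proj r i α).F (wH r i m) =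
    α ^ 2 • if m = i then wL r i 0 else wH r i (m + 1) := by
  rw [wH_of_lt (by omega : m < i + 1)]
  exact congr_arg (fun x : P r i => α ^ 2 • x) ((Finsupp.linearCombination_single ℂ _ _).trans (one_smul ℂ _))

lemma proj_F_wS {m : ℕ} (h : m ≤ i) : (proj r i α).F (wS r i m) = α ^ 2 • wS r i (m + 1) := by
  rw [wS_of_lt (by omega : m < i + 1)]
  exact congr_arg (fun x : P r i => α ^ 2 • x) ((Finsupp.linearCombination_single ℂ _ _).trans (one_smul ℂ _))

lemma proj_F_wL {m : ℕ} (h : m ≤ r - 2 - i) :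
    (proj r i α).F (wL r i m) = α ^ 2 • wL r i (m + 1) := by
  rw [wL_of_lt (by omega : m < r - 2 - i + 1)]
  exact congr_arg (fun x : P r i => α ^ 2 • x) ((Finsupp.linearCombination_single ℂ _ _).trans (one_smul ℂ _))

lemma proj_F_wR {m : ℕ} (h : m ≤ r - 2 - i) : (proj r i α).F (wR r i m) =
    α ^ 2 • if m = r - 2 - i then wS r i 0 else -gam r (r - 2 - i) (m + 1) • wR r i (m + 1) := by
  rw [wR_of_lt (by omega : m < r - 2 - i + 1)]
  exact congr_arg (fun x : P r i => α ^ 2 • x) ((Finsupp.linearCombination_single ℂ _ _).trans (one_smul ℂ _))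

lemma proj_k_wH {m : ℕ} (h : m ≤ i) :
    (proj r i α).k (wH r i m) = α • qHalf r ^ ((i : ℤ) - 2 * m) • wH r i m := by
  rw [wH_of_lt (by omega : m < i + 1)]
  refine congr_arg (fun x : P r i => α • x)
    ((Finsupp.linearCombination_single ℂ _ _).trans ((one_smul ℂ _).trans ?_))
  dsimp only
  rw [wH_of_lt (by omega : m < i + 1)]

lemma proj_k_wS {m : ℕ} (h : m ≤ i) :
    (proj r i α).k (wS r i m) = α • qHalf r ^ ((i : ℤ) - 2 * m) • wS r i m := by
  rw [wS_of_lt (by omega : m < i + 1)]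
  refine congr_arg (fun x : P r i => α • x)
    ((Finsupp.linearCombination_single ℂ _ _).trans ((one_smul ℂ _).trans ?_))
  dsimp only
  rw [wS_of_lt (by omega : m < i + 1)]

lemma proj_k_wL {m : ℕ} (h : m ≤ r - 2 - i) :
    (proj r i α).k (wL r i m) = α • qHalf r ^ (-((i : ℤ) + 2 + 2 * m)) • wL r i m := by
  rw [wL_of_lt (by omega : m < r - 2 - i + 1)]
  refine congr_arg (fun x : P r i => α • x)
    ((Finsupp.linearCombination_single ℂ _ _).trans ((one_smul ℂ _).trans ?_))
  dsimp only
  rw [wL_of_lt (by omega : m < r - 2 - i + 1)]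

lemma proj_k_wR {m : ℕ} (h : m ≤ r - 2 - i) : (proj r i α).k (wR r i m) =
    α • qHalf r ^ (((r - 2 - i : ℕ) : ℤ) + r - 2 * m) • wR r i m := by
  rw [wR_of_lt (by omega : m < r - 2 - i + 1)]
  refine congr_arg (fun x : P r i => α • x)
    ((Finsupp.linearCombination_single ℂ _ _).trans ((one_smul ℂ _).trans ?_))
  dsimp only
  rw [wR_of_lt (by omega : m < r - 2 - i + 1)]

/-- The term w_m^S is the only off-diagonal entry of FE on P_i^α. For m = 0 it comes by way of
w_{i'}^R, for m > 0 by way of w_{m-1}^S, and the formula is uniform because γ_{i,0} = 0. -/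
lemma proj_FE_wH {m : ℕ} (h : m ≤ i) : (proj r i α).F ((proj r i α).E (wH r i m)) =
    α ^ 2 • (gam r i m • wH r i m + wS r i m) := by
  rw [proj_E_wH α h]
  by_cases h0 : m = 0
  · subst h0
    rw [if_pos rfl, proj_F_wR α le_rfl, if_pos rfl]
    have := gam_zero r i
    rw [this, zero_smul, zero_add]
  · rw [if_neg h0, map_add, map_smul, proj_F_wH α (by omega), if_neg (by omega),
      proj_F_wS α (by omega), Nat.sub_add_cancel (by omega), smul_comm, smul_add]

lemma proj_FE_wS {m : ℕ} (h : m ≤ i) : (proj r i α).F ((proj r i α).E (wS r i m)) =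
    (α ^ 2 * gam r i m) • wS r i m := by
  rw [proj_E_wS α h]
  by_cases h0 : m = 0
  · subst h0
    rw [if_pos rfl, gam_zero, mul_zero, zero_smul, map_zero]
  · rw [if_neg h0, map_smul, proj_F_wS α (by omega), Nat.sub_add_cancel (by omega), smul_comm,
      smul_smul]

lemma proj_FE_wL {m : ℕ} (h : m ≤ r - 2 - i) : (proj r i α).F ((proj r i α).E (wL r i m)) =
    (α ^ 2 * -gam r (r - 2 - i) m) • wL r i m := by
  rw [proj_E_wL α h]
  by_cases h0 : m = 0
  · subst h0
    rw [if_pos rfl, gam_zero, neg_zero, mul_zero, zero_smul, proj_F_wS α le_rfl, wS,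
      dif_neg (by omega), smul_zero]
  · rw [if_neg h0, map_smul, proj_F_wL α (by omega), Nat.sub_add_cancel (by omega), smul_comm,
      smul_smul]

lemma proj_FE_wR {m : ℕ} (h : m ≤ r - 2 - i) : (proj r i α).F ((proj r i α).E (wR r i m)) =
    (α ^ 2 * -gam r (r - 2 - i) m) • wR r i m := by
  rw [proj_E_wR α h]
  by_cases h0 : m = 0
  · subst h0
    rw [if_pos rfl, gam_zero, neg_zero, mul_zero, zero_smul, map_zero]
  · rw [if_neg h0, proj_F_wR α (by omega), if_neg (by omega), Nat.sub_add_cancel (by omega),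
      smul_smul]

variable {α}

lemma proj_FE_apply_H (w : P r i) (m : Fin (i + 1)) :
    (proj r i α).F ((proj r i α).E w) (.H m) = α ^ 2 * gam r i m * w (.H m) := by
  have : Finsupp.lapply (.H m) ∘ₗ (proj r i α).F ∘ₗ (proj r i α).E =
      (α ^ 2 * gam r i m) • (Finsupp.lapply (.H m) : P r i →ₗ[ℂ] ℂ) := by
    refine P_hom_ext (fun a ha => ?_) (fun a ha => ?_) (fun a ha => ?_) (fun a ha => ?_) <;>
      rw [LinearMap.comp_apply, LinearMap.comp_apply]
    · rw [proj_FE_wH α ha, wH_of_lt (by omega), wS_of_lt (by omega)]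
      by_cases h : a = m
      · subst h; simp
      · simp [Fin.ext_iff, h]
    · rw [proj_FE_wS α ha, wS_of_lt (by omega)]
      simp
    · rw [proj_FE_wL α ha, wL_of_lt (by omega)]
      simp
    · rw [proj_FE_wR α ha, wR_of_lt (by omega)]
      simp
  exact LinearMap.congr_fun this w

lemma proj_FE_apply_S (w : P r i) (m : Fin (i + 1)) :
    (proj r i α).F ((proj r i α).E w) (.S m) =
      α ^ 2 * (w (.H m) + gam r i m * w (.S m)) := by
  have : Finsupp.lapply (.S m) ∘ₗ (proj r i α).F ∘ₗ (proj r i α).E =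
      α ^ 2 • ((Finsupp.lapply (.H m) : P r i →ₗ[ℂ] ℂ) + gam r i m • Finsupp.lapply (.S m)) := by
    refine P_hom_ext (fun a ha => ?_) (fun a ha => ?_) (fun a ha => ?_) (fun a ha => ?_) <;>
      rw [LinearMap.comp_apply, LinearMap.comp_apply]
    · rw [proj_FE_wH α ha, wH_of_lt (by omega), wS_of_lt (by omega)]
      by_cases h : a = m
      · subst h; simp
      · simp [Fin.ext_iff, h]
    · rw [proj_FE_wS α ha, wS_of_lt (by omega)]
      by_cases h : a = m
      · subst h; simp
      · simp [Fin.ext_iff, h]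
    · rw [proj_FE_wL α ha, wL_of_lt (by omega)]
      simp
    · rw [proj_FE_wR α ha, wR_of_lt (by omega)]
      simp
  exact LinearMap.congr_fun this w

lemma proj_FE_apply_L (w : P r i) (m : Fin (r - 2 - i + 1)) :
    (proj r i α).F ((proj r i α).E w) (.L m) = α ^ 2 * -gam r (r - 2 - i) m * w (.L m) := by
  have : Finsupp.lapply (.L m) ∘ₗ (proj r i α).F ∘ₗ (proj r i α).E =
      (α ^ 2 * -gam r (r - 2 - i) m) • (Finsupp.lapply (.L m) : P r i →ₗ[ℂ] ℂ) := by
    refine P_hom_ext (fun a ha => ?_) (fun a ha => ?_) (fun a ha => ?_) (fun a ha => ?_) <;>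
      rw [LinearMap.comp_apply, LinearMap.comp_apply]
    · rw [proj_FE_wH α ha, wH_of_lt (by omega), wS_of_lt (by omega)]
      simp
    · rw [proj_FE_wS α ha, wS_of_lt (by omega)]
      simp
    · rw [proj_FE_wL α ha, wL_of_lt (by omega)]
      by_cases h : a = m
      · subst h; simp
      · simp [Fin.ext_iff, h]
    · rw [proj_FE_wR α ha, wR_of_lt (by omega)]
      simp
  exact LinearMap.congr_fun this w

lemma proj_FE_apply_R (w : P r i) (m : Fin (r - 2 - i + 1)) :
    (proj r i α).F ((proj r i α).E w) (.R m) = α ^ 2 * -gam r (r - 2 - i) m * w (.R m) := by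
  have : Finsupp.lapply (.R m) ∘ₗ (proj r i α).F ∘ₗ (proj r i α).E =
      (α ^ 2 * -gam r (r - 2 - i) m) • (Finsupp.lapply (.R m) : P r i →ₗ[ℂ] ℂ) := by
    refine P_hom_ext (fun a ha => ?_) (fun a ha => ?_) (fun a ha => ?_) (fun a ha => ?_) <;>
      rw [LinearMap.comp_apply, LinearMap.comp_apply]
    · rw [proj_FE_wH α ha, wH_of_lt (by omega), wS_of_lt (by omega)]
      simp
    · rw [proj_FE_wS α ha, wS_of_lt (by omega)]
      simp
    · rw [proj_FE_wL α ha, wL_of_lt (by omega)]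
      simp
    · rw [proj_FE_wR α ha, wR_of_lt (by omega)]
      by_cases h : a = m
      · subst h; simp
      · simp [Fin.ext_iff, h]
  exact LinearMap.congr_fun this w

lemma P_ext_iff {w w' : P r i} : w = w' ↔ (∀ m, w (.H m) = w' (.H m)) ∧
    (∀ m, w (.S m) = w' (.S m)) ∧ (∀ m, w (.L m) = w' (.L m)) ∧ ∀ m, w (.R m) = w' (.R m) := by
  refine ⟨by rintro rfl; simp, fun ⟨h1, h2, h3, h4⟩ => Finsupp.ext fun x => ?_⟩
  rcases x with m | m | m | m
  exacts [h1 m, h2 m, h3 m, h4 m]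

/-- FE is triangular with diagonal entries ±α²γ, nonzero for every positive index, so the kernel of
its square only involves the four vectors of index 0. -/
lemma proj_ker_FE_sq (hi : i + 2 ≤ r) (hα : α ^ 4 = 1) {w : P r i}
    (hw : (proj r i α).F ((proj r i α).E ((proj r i α).F ((proj r i α).E w))) = 0) :
    w = w (.H 0) • wH r i 0 + w (.S 0) • wS r i 0 + w (.L 0) • wL r i 0 + w (.R 0) • wR r i 0 := by
  have hα2 : α ^ 2 ≠ 0 := fun h => by
    rw [show α ^ 4 = α ^ 2 * α ^ 2 by ring, h, zero_mul] at hα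
    exact zero_ne_one hα
  rw [wH_of_lt (by omega), wS_of_lt (by omega), wL_of_lt (by omega), wR_of_lt (by omega),
    P_ext_iff]
  have hz : ∀ x, (proj r i α).F ((proj r i α).E ((proj r i α).F ((proj r i α).E w))) x = 0 := by
    rw [hw]; exact fun _ => rfl
  refine ⟨fun m => ?_, fun m => ?_, fun m => ?_, fun m => ?_⟩
  · by_cases h : m = 0
    · subst h; simp
    · have h1 := hz (.H m)
      have hm : (m : ℕ) ≠ 0 := fun h' => h (Fin.ext h')
      have := gam_ne_zero (r := r) (a := i) (m := m) (by omega) (by omega) (by omega) (by omega)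
      rw [proj_FE_apply_H, proj_FE_apply_H] at h1
      simp only [mul_eq_zero, hα2, this, false_or] at h1
      simp [h1, Ne.symm h]
  · by_cases h : m = 0
    · subst h; simp
    · have h1 := hz (.S m)
      have h2 := hz (.H m)
      have hm : (m : ℕ) ≠ 0 := fun h' => h (Fin.ext h')
      have := gam_ne_zero (r := r) (a := i) (m := m) (by omega) (by omega) (by omega) (by omega)
      rw [proj_FE_apply_H, proj_FE_apply_H] at h2
      simp only [mul_eq_zero, hα2, this, false_or] at h2
      rw [proj_FE_apply_S, proj_FE_apply_S, proj_FE_apply_H, h2] at h1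
      simp only [mul_zero, zero_add, mul_eq_zero, hα2, this, false_or] at h1
      simp [h1, Ne.symm h]
  · by_cases h : m = 0
    · subst h; simp
    · have h1 := hz (.L m)
      have hm : (m : ℕ) ≠ 0 := fun h' => h (Fin.ext h')
      have := gam_ne_zero (r := r) (a := r - 2 - i) (m := m) (by omega) (by omega) (by omega)
        (by omega)
      rw [proj_FE_apply_L, proj_FE_apply_L] at h1
      simp only [mul_eq_zero, neg_eq_zero, hα2, this, false_or] at h1
      simp [h1, Ne.symm h]
  · by_cases h : m = 0
    · subst h; simp
    · have h1 := hz (.R m)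
      have hm : (m : ℕ) ≠ 0 := fun h' => h (Fin.ext h')
      have := gam_ne_zero (r := r) (a := r - 2 - i) (m := m) (by omega) (by omega) (by omega)
        (by omega)
      rw [proj_FE_apply_R, proj_FE_apply_R] at h1
      simp only [mul_eq_zero, neg_eq_zero, hα2, this, false_or] at h1
      simp [h1, Ne.symm h]

/-- Among the four vectors of index 0, w_0^H is excluded since FE sends it to a nonzero multiple of
w_0^S, and w_0^L since E sends it to w_i^S. -/
lemma proj_ker_E (hi : i + 2 ≤ r) (hα : α ^ 4 = 1) {w : P r i} (hw : (proj r i α).E w = 0) :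
    w = w (.S 0) • wS r i 0 + w (.R 0) • wR r i 0 := by
  have hα2 : α ^ 2 ≠ 0 := fun h => by
    rw [show α ^ 4 = α ^ 2 * α ^ 2 by ring, h, zero_mul] at hα
    exact zero_ne_one hα
  have h1 := proj_ker_FE_sq hi hα (w := w) (by rw [hw]; simp)
  have h2 : w (.H 0) = 0 := by
    have := proj_FE_apply_S (α := α) w 0
    rw [hw, map_zero, Finsupp.zero_apply, Fin.val_zero, gam_zero, zero_mul, add_zero] at this
    exact (mul_eq_zero.1 this.symm).resolve_left hα2
  rw [h2, zero_smul, zero_add] at h1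
  have h3 : w (.L 0) = 0 := by
    have h4 := hw
    rw [h1, map_add, map_add, map_smul, map_smul, map_smul, proj_E_wS α (by omega),
      proj_E_wL α (by omega), proj_E_wR α (by omega), if_pos rfl, if_pos rfl, if_pos rfl,
      smul_zero, smul_zero, zero_add, add_zero, wS_of_lt (by omega)] at h4
    have h5 := DFunLike.congr_fun h4 (.S ⟨i, by omega⟩)
    simpa using h5
  rwa [h3, zero_smul, add_zero] at h1

end Proj

lemma steinberg_FE_apply {α : ℂ} (w : V r) (m : Fin r) :
    (steinberg r α).F ((steinberg r α).E w) m = α ^ 2 * qInt r m * qInt r (r - m) * w m := by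
  have : LinearMap.proj m ∘ₗ (steinberg r α).F ∘ₗ (steinberg r α).E =
      (α ^ 2 * qInt r m * qInt r (r - m)) • (LinearMap.proj m : V r →ₗ[ℂ] ℂ) := by
    refine V_hom_ext fun a ha => ?_
    rw [LinearMap.comp_apply, LinearMap.comp_apply, steinberg_E_u r α ha, LinearMap.smul_apply,
      LinearMap.proj_apply, LinearMap.proj_apply, smul_eq_mul]
    by_cases h0 : a = 0
    · rw [if_pos h0, map_zero, Pi.zero_apply]
      by_cases h : a = m
      · rw [← h, h0]; simp [qInt, qCurly_zero]
      · rw [u_of_lt ha, Pi.single_eq_of_ne (fun h' => h (congr_arg Fin.val h').symm), mul_zero]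
    · rw [if_neg h0, steinberg_F_u, Nat.sub_add_cancel (by omega), Pi.smul_apply, smul_eq_mul]
      by_cases h : a = m
      · subst h
        congr 3
        · push_cast [Nat.cast_sub (by omega : 1 ≤ (m : ℕ))]; ring_nf
        · push_cast [Nat.cast_sub (by omega : 1 ≤ (m : ℕ))]; ring_nf
      · rw [u_of_lt ha, Pi.single_eq_of_ne (fun h' => h (congr_arg Fin.val h').symm), mul_zero,
          mul_zero]
  exact LinearMap.congr_fun this w

lemma steinberg_ker_FE_sq (hr : 2 ≤ r) {α : ℂ} (hα : α ^ 4 = 1) {w : V r}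
    (hw : (steinberg r α).F ((steinberg r α).E ((steinberg r α).F ((steinberg r α).E w))) = 0) :
    w = w ⟨0, by omega⟩ • u r 0 := by
  have hα2 : α ^ 2 ≠ 0 := fun h => by
    rw [show α ^ 4 = α ^ 2 * α ^ 2 by ring, h, zero_mul] at hα
    exact zero_ne_one hα
  ext m
  rw [u_of_lt (by omega), Pi.smul_apply, smul_eq_mul]
  by_cases h : (m : ℕ) = 0
  · rw [show m = ⟨0, by omega⟩ from Fin.ext h]; simp
  · have h1 := congr_fun hw m
    have hd : ∀ x : ℤ, 0 < x → x < r → qInt r x ≠ 0 := fun x h0 hx h' => by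
      rw [qInt_eq_zero_iff hr] at h'
      have := Int.le_of_dvd h0 h'
      omega
    rw [steinberg_FE_apply, steinberg_FE_apply] at h1
    simp only [Pi.zero_apply, mul_eq_zero, hα2, hd m (by omega) (by omega),
      hd (r - m) (by omega) (by omega), false_or] at h1
    rw [h1, Pi.single_eq_of_ne (fun h' => h (congr_arg Fin.val h')), mul_zero]

end

section

/-! ### Spaces with strong weights, a Casimir operator, and free nilpotent operators `E` and `F` -/

/-- A graded `D`-module whose degrees lift the weights in the same way as on `V_{r-1}^{⊗ n}`,
together with its Casimir operator, and on which `E` and `F` act freely. -/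
structure WeightSystem (r n : ℕ) (M : Type*) [AddCommGroup M] [Module ℂ M] where
  /-- the action of `E` -/
  E : Module.End ℂ M
  /-- the action of `F` -/
  F : Module.End ℂ M
  /-- the action of `k` -/
  k : Module.End ℂ M
  /-- the Casimir operator -/
  cas : Module.End ℂ M
  /-- the homogeneous components -/
  L : ℤ → Submodule ℂ M
  /-- the projections onto the homogeneous components -/
  π : ℤ → Module.End ℂ M
  E_mem : ∀ {m v}, v ∈ L m → E v ∈ L (m - 1)
  F_mem : ∀ {m v}, v ∈ L m → F v ∈ L (m + 1)
  k_apply : ∀ {m v}, v ∈ L m → k v = qHalf r ^ wt r n m • v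
  cas_FE : ∀ {m v}, v ∈ L m → cas v = F (E v) + casScalar r n m • v
  cas_EF : ∀ {m v}, v ∈ L m → cas v = E (F v) + casScalar r n (m + 1) • v
  E_pow : E ^ r = 0
  F_pow : F ^ r = 0
  exact_E : ∀ {v}, E v = 0 → ∃ w, v = (E ^ (r - 1)) w
  exact_F : ∀ {v}, F v = 0 → ∃ w, v = (F ^ (r - 1)) w
  π_mem : ∀ m v, π m v ∈ L m
  π_apply : ∀ {m v}, v ∈ L m → π m v = v
  π_apply_of_ne : ∀ {m m' v}, m' ≠ m → v ∈ L m' → π m v = 0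
  sum_π : ∀ v, ∑ m ∈ Finset.Icc (0 : ℤ) (n * ((r : ℤ) - 1)), π m v = v
  L_eq_bot : ∀ {m : ℤ}, m < 0 ∨ n * ((r : ℤ) - 1) < m → L m = ⊥

namespace WeightSystem

variable {r n : ℕ} {M : Type*} [AddCommGroup M] [Module ℂ M] (W : WeightSystem r n M)

/-- The underlying `D`-module. -/
def act : DAction M := ⟨W.E, W.F, W.k⟩

variable {W}

lemma ext_of_L {X Y : Module.End ℂ M} (h : ∀ m, ∀ v ∈ W.L m, X v = Y v) : X = Y :=
  LinearMap.ext fun v => by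
    rw [← W.sum_π v, map_sum, map_sum]
    exact Finset.sum_congr rfl fun m _ => h m _ (W.π_mem m v)

lemma cas_mem {m : ℤ} {v : M} (hv : v ∈ W.L m) : W.cas v ∈ W.L m := by
  rw [W.cas_FE hv]
  have := W.F_mem (W.E_mem hv)
  rw [sub_add_cancel] at this
  exact add_mem this (Submodule.smul_mem _ _ hv)

lemma cas_comm_E : Commute W.cas W.E :=
  W.ext_of_L fun m v hv => by
    have h := W.cas_EF (W.E_mem hv)
    rw [sub_add_cancel] at h
    rw [Module.End.mul_apply, Module.End.mul_apply, h, W.cas_FE hv, map_add, map_smul]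

lemma cas_comm_F : Commute W.cas W.F :=
  W.ext_of_L fun m v hv => by
    rw [Module.End.mul_apply, Module.End.mul_apply, W.cas_FE (W.F_mem hv), W.cas_EF hv, map_add,
      map_smul]

lemma π_E (m : ℤ) (v : M) : W.π m (W.E v) = W.E (W.π (m + 1) v) := by
  refine LinearMap.congr_fun (f := W.π m * W.E) (g := W.E * W.π (m + 1))
    (W.ext_of_L fun m' v hv => ?_) v
  rw [Module.End.mul_apply, Module.End.mul_apply]
  by_cases h : m' = m + 1
  · subst h
    have := W.E_mem hv
    rw [add_sub_cancel_right] at this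
    rw [W.π_apply hv, W.π_apply this]
  · rw [W.π_apply_of_ne h hv, W.π_apply_of_ne (by omega) (W.E_mem hv), map_zero]

lemma π_F (m : ℤ) (v : M) : W.π m (W.F v) = W.F (W.π (m - 1) v) := by
  refine LinearMap.congr_fun (f := W.π m * W.F) (g := W.F * W.π (m - 1))
    (W.ext_of_L fun m' v hv => ?_) v
  rw [Module.End.mul_apply, Module.End.mul_apply]
  by_cases h : m' = m - 1
  · subst h
    have := W.F_mem hv
    rw [sub_add_cancel] at this
    rw [W.π_apply hv, W.π_apply this]
  · rw [W.π_apply_of_ne h hv, W.π_apply_of_ne (by omega) (W.F_mem hv), map_zero]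

lemma π_E_pow (s : ℕ) (m : ℤ) (v : M) : W.π m ((W.E ^ s) v) = (W.E ^ s) (W.π (m + s) v) := by
  induction s generalizing m with
  | zero => simp
  | succ s ih =>
    rw [pow_succ', Module.End.mul_apply, Module.End.mul_apply, π_E, ih]
    congr 4; push_cast; ring

lemma π_F_pow (s : ℕ) (m : ℤ) (v : M) : W.π m ((W.F ^ s) v) = (W.F ^ s) (W.π (m - s) v) := by
  induction s generalizing m with
  | zero => simp
  | succ s ih =>
    rw [pow_succ', Module.End.mul_apply, Module.End.mul_apply, π_F, ih]
    congr 4; push_cast; ring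

lemma E_pow_mem (s : ℕ) {m : ℤ} {v : M} (hv : v ∈ W.L m) : (W.E ^ s) v ∈ W.L (m - s) := by
  induction s with
  | zero => simpa
  | succ s ih =>
    rw [pow_succ', Module.End.mul_apply]
    convert W.E_mem ih using 2
    push_cast; ring

lemma F_pow_mem (s : ℕ) {m : ℤ} {v : M} (hv : v ∈ W.L m) : (W.F ^ s) v ∈ W.L (m + s) := by
  induction s with
  | zero => simpa
  | succ s ih =>
    rw [pow_succ', Module.End.mul_apply]
    convert W.F_mem ih using 2
    push_cast; ring

lemma pow_apply_add {X : Module.End ℂ M} (a b : ℕ) (v : M) :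
    (X ^ a) ((X ^ b) v) = (X ^ (a + b)) v := by
  rw [pow_add, Module.End.mul_apply]

lemma E_pow_eq_zero {s : ℕ} (h : r ≤ s) (v : M) : (W.E ^ s) v = 0 := by
  rw [pow_eq_zero_of_le h W.E_pow, LinearMap.zero_apply]

lemma F_pow_eq_zero {s : ℕ} (h : r ≤ s) (v : M) : (W.F ^ s) v = 0 := by
  rw [pow_eq_zero_of_le h W.F_pow, LinearMap.zero_apply]

/-- Freeness over ℂ[X]/(X^r) passes from the first power to all powers: X^s v = X^(r-1) y, so
X^(r-s-1) y can be subtracted from v and the induction continues. -/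
lemma exact_pow {X : Module.End ℂ M} (hr : 1 ≤ r)
    (hex : ∀ {v}, X v = 0 → ∃ w, v = (X ^ (r - 1)) w) {s : ℕ} (hs : s ≤ r) {v : M}
    (hv : (X ^ s) v = 0) : ∃ w, v = (X ^ (r - s)) w := by
  induction s generalizing v with
  | zero => exact ⟨0, by simpa using hv⟩
  | succ s ih =>
    rw [pow_succ', Module.End.mul_apply] at hv
    obtain ⟨y, hy⟩ := hex hv
    obtain ⟨z, hz⟩ := ih (by omega) (v := v - (X ^ (r - (s + 1))) y) (by
      rw [map_sub, hy, pow_apply_add, show s + (r - (s + 1)) = r - 1 by omega, sub_self])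
    refine ⟨y + X z, ?_⟩
    rw [map_add, ← Module.End.mul_apply, ← pow_succ, show r - (s + 1) + 1 = r - s by omega, ← hz]
    abel

/-! #### Polynomials in the Casimir operator -/

open Polynomial in
lemma aeval_mem (p : ℂ[X]) {m : ℤ} {v : M} (hv : v ∈ W.L m) : aeval W.cas p v ∈ W.L m := by
  induction p using Polynomial.induction_on' with
  | add p p' h h' => rw [map_add]; exact add_mem h h'
  | monomial s a =>
    rw [aeval_monomial, Module.End.mul_apply, Module.algebraMap_end_apply]
    refine Submodule.smul_mem _ _ ?_
    induction s with
    | zero => simpa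
    | succ s ih => rw [pow_succ', Module.End.mul_apply]; exact cas_mem ih

lemma aeval_commute {X : Module.End ℂ M} (h : Commute W.cas X) (p : Polynomial ℂ) :
    Commute (Polynomial.aeval W.cas p) X := by
  induction p using Polynomial.induction_on' with
  | add p p' h h' => rw [map_add]; exact h.add_left h'
  | monomial s a =>
    rw [Polynomial.aeval_monomial]
    exact (Algebra.commute_algebraMap_left _ _).mul_left (h.pow_left s)

lemma aeval_E_pow (p : Polynomial ℂ) (s : ℕ) (v : M) :
    Polynomial.aeval W.cas p ((W.E ^ s) v) = (W.E ^ s) (Polynomial.aeval W.cas p v) :=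
  LinearMap.congr_fun ((aeval_commute cas_comm_E p).pow_right s).eq v

lemma aeval_F_pow (p : Polynomial ℂ) (s : ℕ) (v : M) :
    Polynomial.aeval W.cas p ((W.F ^ s) v) = (W.F ^ s) (Polynomial.aeval W.cas p v) :=
  LinearMap.congr_fun ((aeval_commute cas_comm_F p).pow_right s).eq v

open Polynomial in
lemma aeval_X_sub_C (X : Module.End ℂ M) (c : ℂ) (v : M) :
    aeval X (Polynomial.X - C c) v = X v - c • v := by
  rw [map_sub, aeval_X, aeval_C, LinearMap.sub_apply, Module.algebraMap_end_apply]

-- Peel off the innermost FE, which is C minus its scalar at the current level, and use that C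
-- commutes with F.
open Polynomial in
lemma F_pow_E_pow (s : ℕ) {l : ℤ} {v : M} (hv : v ∈ W.L l) : (W.F ^ s) ((W.E ^ s) v) =
    aeval W.cas (∏ t ∈ Finset.range s, (X - C (casScalar r n (l - t)))) v := by
  induction s generalizing l v with
  | zero => simp
  | succ s ih =>
    rw [pow_succ' W.F, pow_succ W.E, Module.End.mul_apply, Module.End.mul_apply, ih (W.E_mem hv),
      Finset.prod_range_succ', map_mul, Module.End.mul_apply, aeval_X_sub_C, Nat.cast_zero,
      sub_zero, W.cas_FE hv, add_sub_cancel_right]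
    have := aeval_F_pow (W := W)
      (∏ t ∈ Finset.range s, (X - C (casScalar r n (l - 1 - t)))) 1 (W.E v)
    rw [pow_one] at this
    rw [← this]
    congr 2
    refine Finset.prod_congr rfl fun t _ => ?_
    congr 3
    push_cast; ring

open Polynomial in
lemma E_pow_F_pow (s : ℕ) {l : ℤ} {v : M} (hv : v ∈ W.L l) : (W.E ^ s) ((W.F ^ s) v) =
    aeval W.cas (∏ t ∈ Finset.range s, (X - C (casScalar r n (l + (t + 1 : ℕ))))) v := by
  induction s generalizing l v with
  | zero => simp
  | succ s ih =>
    rw [pow_succ' W.E, pow_succ W.F, Module.End.mul_apply, Module.End.mul_apply, ih (W.F_mem hv),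
      Finset.prod_range_succ', map_mul, Module.End.mul_apply, aeval_X_sub_C, zero_add,
      Nat.cast_one, W.cas_EF hv, add_sub_cancel_right]
    have := aeval_E_pow (W := W)
      (∏ t ∈ Finset.range s, (X - C (casScalar r n (l + 1 + (t + 1 : ℕ))))) 1 (W.F v)
    rw [pow_one] at this
    rw [← this]
    congr 2
    refine Finset.prod_congr rfl fun t _ => ?_
    congr 3
    push_cast; ring

open Polynomial in
/-- The polynomial annihilating the Casimir operator. -/
def casPoly (r n : ℕ) (l : ℤ) : ℂ[X] := ∏ t ∈ Finset.range r, (X - C (casScalar r n (l - t)))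

/-- Shifting the window of r consecutive levels exchanges one end for the other, and these two
levels have the same scalar. -/
lemma casPoly_succ (hr : 2 ≤ r) (l : ℤ) : casPoly r n (l + 1) = casPoly r n l := by
  obtain ⟨s, rfl⟩ : ∃ s, r = s + 1 := ⟨r - 1, by omega⟩
  rw [casPoly, casPoly, Finset.prod_range_succ', Finset.prod_range_succ]
  congr 1
  · refine Finset.prod_congr rfl fun t _ => ?_
    congr 3
    push_cast; ring
  · congr 2
    have := (casScalar_add_eq_iff (n := n) hr (l - s) (s + 1)).2 (Or.inl (by push_cast; rfl))
    rw [← this]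
    congr 1
    push_cast; ring

lemma casPoly_eq (hr : 2 ≤ r) (l : ℤ) : casPoly r n l = casPoly r n 0 := by
  induction l with
  | zero => rfl
  | succ l ih => rw [casPoly_succ hr, ih]
  | pred l ih => rw [← casPoly_succ hr, sub_add_cancel, ih]

/-- On level m the polynomial is F^r E^r = 0, and it does not depend on the level. -/
lemma aeval_casPoly (hr : 2 ≤ r) (l : ℤ) : Polynomial.aeval W.cas (casPoly r n l) = 0 :=
  W.ext_of_L fun m v hv => by
    rw [casPoly_eq hr, ← casPoly_eq hr m, casPoly, ← F_pow_E_pow r hv, E_pow_eq_zero le_rfl,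
      map_zero, LinearMap.zero_apply]

open Polynomial in
/-- The generalized eigenspace of the Casimir operator is a direct summand. -/
lemma exists_casimir_idempotent (hr : 2 ≤ r) (l : ℤ) : ∃ a : ℂ[X], ∀ v : M,
    aeval W.cas ((X - C (casScalar r n l)) ^ 2)
      (v - aeval W.cas a (aeval W.cas ((X - C (casScalar r n l)) ^ 2) v)) = 0 := by
  classical
  set c := casScalar r n l with hc
  set S := (Finset.range r).filter fun t : ℕ => casScalar r n (l - t) ≠ c with hS
  set g : ℂ[X] := ∏ t ∈ S, (X - C (casScalar r n (l - t))) with hg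
  have h1 : IsCoprime ((X - C c) ^ 2) g :=
    IsCoprime.pow_left (IsCoprime.prod_right fun t ht =>
      isCoprime_X_sub_C_of_isUnit_sub (sub_ne_zero_of_ne (Finset.mem_filter.1 ht).2.symm).isUnit)
  have h2 : casPoly r n l ∣ (X - C c) ^ 2 * g := by
    rw [casPoly, ← Finset.prod_filter_mul_prod_filter_not (Finset.range r)
      (fun t : ℕ => casScalar r n (l - t) = c)]
    refine mul_dvd_mul ?_ dvd_rfl
    rw [Finset.prod_congr rfl fun t ht => by rw [(Finset.mem_filter.1 ht).2], Finset.prod_const]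
    refine pow_dvd_pow _ ?_
    -- Within r consecutive levels ending at l, the scalar of l occurs only at l and at the next
    -- wall below. Hence it is at most a double root, which is why squares suffice.
    have hsub : (Finset.range r).filter (fun t : ℕ => casScalar r n (l - t) = c) ⊆
        {0, r - wall r n l} := by
      intro t ht
      rw [Finset.mem_filter, Finset.mem_range] at ht
      have hw := wall_lt (n := n) (by omega : 1 ≤ r) l
      have h' := ht.2
      rw [sub_eq_add_neg, hc, casScalar_add_eq_iff hr, dvd_neg, sub_neg_eq_add] at h'
      rw [Finset.mem_insert, Finset.mem_singleton]
      by_contra hcon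
      push Not at hcon
      rcases h' with h' | h'
      · have := Int.le_of_dvd (by omega) h'
        omega
      · have h3 := dvd_sub h' (dvd_refl (r : ℤ))
        have := Int.eq_zero_of_abs_lt_dvd h3 (by rw [abs_lt]; omega)
        omega
    exact (Finset.card_le_card hsub).trans Finset.card_le_two
  -- By Bézout, 1 - a (X - c)² = g b, and (X - c)² g annihilates the Casimir operator.
  obtain ⟨a, b, hab⟩ := h1
  refine ⟨a, fun v => ?_⟩
  have h3 : v - aeval W.cas a (aeval W.cas ((X - C c) ^ 2) v) = aeval W.cas (g * b) v := by
    rw [sub_eq_iff_eq_add', ← Module.End.mul_apply, ← map_mul, ← LinearMap.add_apply, ← map_add,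
      mul_comm g, hab, map_one, Module.End.one_apply]
  obtain ⟨e, he⟩ := h2
  rw [h3, ← Module.End.mul_apply, ← map_mul, ← mul_assoc, he, mul_assoc, map_mul,
    aeval_casPoly hr, zero_mul, LinearMap.zero_apply]

-- Taylor expansion to first order, as (X - c)² kills v. The scalar b depends only on p, X and c,
-- not on v.
open Polynomial in
lemma exists_aeval_eq (X : Module.End ℂ M) (p : ℂ[X]) (c : ℂ) : ∃ b : ℂ, ∀ v : M,
    X (X v - c • v) - c • (X v - c • v) = 0 → aeval X p v = p.eval c • v + b • (X v - c • v) := by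
  obtain ⟨g, hg⟩ := X_sub_C_dvd_sub_C_eval (p := p) (a := c)
  obtain ⟨h, hh⟩ := X_sub_C_dvd_sub_C_eval (p := g) (a := c)
  obtain ⟨e, he⟩ : ∃ e, g.eval c = e := ⟨_, rfl⟩
  refine ⟨e, fun v hv => ?_⟩
  rw [he] at hh
  rw [sub_eq_iff_eq_add] at hg hh
  rw [← aeval_X_sub_C, ← aeval_X_sub_C] at hv
  have h1 : aeval X ((Polynomial.X - C c) * h) (aeval X (Polynomial.X - C c) v) = 0 := by
    rw [mul_comm, map_mul, Module.End.mul_apply, hv, map_zero]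
  conv_lhs => rw [hg]
  rw [map_add, LinearMap.add_apply, aeval_C, Module.algebraMap_end_apply, mul_comm, map_mul,
    Module.End.mul_apply, hh, map_add, LinearMap.add_apply, h1, zero_add, aeval_C,
    Module.algebraMap_end_apply, aeval_X_sub_C, add_comm]

end WeightSystem

end

/-! ### Generalized Casimir eigenspaces at a given level -/

section

namespace WeightSystem

variable {r n : ℕ} {M : Type*} [AddCommGroup M] [Module ℂ M] {W : WeightSystem r n M}

variable (W) in
/-- The vectors of level `l` in the generalized eigenspace of the Casimir operator for its
eigenvalue on the highest weight vectors of this level. -/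
def A (l : ℤ) : Submodule ℂ M := W.L l ⊓ LinearMap.ker ((W.F * W.E) ^ 2)

lemma mem_A {l : ℤ} {v : M} : v ∈ W.A l ↔ v ∈ W.L l ∧ W.F (W.E (W.F (W.E v))) = 0 := by
  rw [A, Submodule.mem_inf, LinearMap.mem_ker, sq]
  rfl

lemma cas_sub {l : ℤ} {v : M} (hv : v ∈ W.L l) :
    W.cas v - casScalar r n l • v = W.F (W.E v) := by
  rw [W.cas_FE hv, add_sub_cancel_right]

lemma FE_mem {l : ℤ} {v : M} (hv : v ∈ W.L l) : W.F (W.E v) ∈ W.L l := by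
  have := W.F_mem (W.E_mem hv)
  rwa [sub_add_cancel] at this

/-- In this form membership mentions the level only through its scalar. So powers of E and F between
levels with equal scalars preserve the family of spaces A. -/
lemma mem_A_iff {l : ℤ} {v : M} {c : ℂ} (hc : casScalar r n l = c) : v ∈ W.A l ↔ v ∈ W.L l ∧
    W.cas (W.cas v - c • v) - c • (W.cas v - c • v) = 0 := by
  subst hc
  rw [mem_A]
  refine and_congr_right fun hv => ?_
  rw [cas_sub hv, cas_sub (FE_mem hv)]

lemma FE_mem_A {l : ℤ} {v : M} (hv : v ∈ W.A l) : W.F (W.E v) ∈ W.A l := by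
  rw [mem_A] at hv ⊢
  exact ⟨FE_mem hv.1, by rw [hv.2, map_zero, map_zero]⟩

lemma cas_pow_comm {X : Module.End ℂ M} (h : Commute W.cas X) (s : ℕ) (c : ℂ) (v : M) :
    W.cas ((X ^ s) v) - c • (X ^ s) v = (X ^ s) (W.cas v - c • v) := by
  rw [map_sub, map_smul]
  congr 1
  exact LinearMap.congr_fun (h.pow_right s).eq v

lemma E_pow_mem_A {l : ℤ} {s : ℕ} (hc : casScalar r n (l - s) = casScalar r n l) {v : M}
    (hv : v ∈ W.A l) : (W.E ^ s) v ∈ W.A (l - s) := by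
  rw [mem_A_iff rfl] at hv
  rw [mem_A_iff hc]
  exact ⟨E_pow_mem s hv.1, by rw [cas_pow_comm cas_comm_E, cas_pow_comm cas_comm_E, hv.2, map_zero]⟩

lemma F_pow_mem_A {l : ℤ} {s : ℕ} (hc : casScalar r n (l + s) = casScalar r n l) {v : M}
    (hv : v ∈ W.A l) : (W.F ^ s) v ∈ W.A (l + s) := by
  rw [mem_A_iff rfl] at hv
  rw [mem_A_iff hc]
  exact ⟨F_pow_mem s hv.1, by rw [cas_pow_comm cas_comm_F, cas_pow_comm cas_comm_F, hv.2, map_zero]⟩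

/-- The projection onto `A l`, up to the image of `FE`. -/
lemma exists_proj_A (hr : 2 ≤ r) (l : ℤ) : ∃ a : Polynomial ℂ, ∀ v ∈ W.L l,
    v - W.F (W.E (W.F (W.E (Polynomial.aeval W.cas a v)))) ∈ W.A l := by
  obtain ⟨a, ha⟩ := W.exists_casimir_idempotent hr l
  refine ⟨a, fun v hv => ?_⟩
  have h : ∀ w ∈ W.L l, Polynomial.aeval W.cas
      ((Polynomial.X - Polynomial.C (casScalar r n l)) ^ 2) w = W.F (W.E (W.F (W.E w))) := by
    intro w hw
    rw [sq, map_mul, Module.End.mul_apply, aeval_X_sub_C _ _ w, cas_sub hw, aeval_X_sub_C,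
      cas_sub (FE_mem hw)]
  have h1 : Polynomial.aeval W.cas a (Polynomial.aeval W.cas
      ((Polynomial.X - Polynomial.C (casScalar r n l)) ^ 2) v) =
      W.F (W.E (W.F (W.E (Polynomial.aeval W.cas a v)))) := by
    rw [← h _ (aeval_mem a hv), ← Module.End.mul_apply, ← map_mul, mul_comm, map_mul,
      Module.End.mul_apply]
  have h2 := ha v
  have h3 : v - W.F (W.E (W.F (W.E (Polynomial.aeval W.cas a v)))) ∈ W.L l :=
    sub_mem hv (FE_mem (FE_mem (aeval_mem a hv)))
  rw [h1, h _ h3] at h2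
  exact mem_A.2 ⟨h3, h2⟩

/-- A version of `exists_proj_A` which applies at all levels with the same Casimir scalar. -/
lemma exists_proj_A' (hr : 2 ≤ r) (l : ℤ) : ∃ p : Polynomial ℂ,
    (∀ l', casScalar r n l' = casScalar r n l → ∀ v ∈ W.L l', Polynomial.aeval W.cas p v ∈ W.A l') ∧
    ∀ v ∈ W.A l, Polynomial.aeval W.cas p v = v := by
  obtain ⟨a, ha⟩ := W.exists_casimir_idempotent hr l
  set b := (Polynomial.X - Polynomial.C (casScalar r n l)) ^ 2 with hb
  have h : ∀ v, Polynomial.aeval W.cas b v = W.cas (W.cas v - casScalar r n l • v) -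
      casScalar r n l • (W.cas v - casScalar r n l • v) := by
    intro v
    rw [hb, sq, map_mul, Module.End.mul_apply, aeval_X_sub_C, aeval_X_sub_C]
  have h1 : ∀ v, Polynomial.aeval W.cas (1 - a * b) v =
      v - Polynomial.aeval W.cas a (Polynomial.aeval W.cas b v) := by
    intro v
    rw [map_sub, map_one, map_mul]
    rfl
  refine ⟨1 - a * b, fun l' hl' v hv => ?_, fun v hv => ?_⟩
  · rw [mem_A_iff hl', ← h]
    refine ⟨aeval_mem _ hv, ?_⟩
    rw [h1]
    exact ha v
  · rw [mem_A_iff rfl, ← h] at hv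
    rw [h1, hv.2, map_zero, sub_zero]

/-! #### Injectivity away from the walls -/

-- On a vector killed by (C - c)², the operator F^s E^s is a nonzero scalar plus a multiple of the
-- nilpotent C - c, so E^s is injective there.
open Polynomial in
lemma F_pow_E_pow_eq {l : ℤ} {v : M} (hv : v ∈ W.L l) {c : ℂ}
    (h2 : W.cas (W.cas v - c • v) - c • (W.cas v - c • v) = 0) {s : ℕ}
    (hs : ∀ t < s, casScalar r n (l - t) ≠ c) (h0 : (W.E ^ s) v = 0) : v = 0 := by
  obtain ⟨b, hb⟩ := exists_aeval_eq W.cas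
    (∏ t ∈ Finset.range s, (X - C (casScalar r n (l - t)))) c
  have h3 := F_pow_E_pow s hv
  have ha : (∏ t ∈ Finset.range s, (X - C (casScalar r n (l - t)))).eval c ≠ 0 := by
    rw [eval_prod, Finset.prod_ne_zero_iff]
    intro t ht
    rw [eval_sub, eval_X, eval_C]
    exact sub_ne_zero_of_ne (hs t (Finset.mem_range.1 ht)).symm
  rw [h0, map_zero, hb v h2] at h3
  have h4 : W.cas v - c • v = 0 := by
    have := congr_arg (fun w => W.cas w - c • w) h3
    simp only [map_add, map_smul, smul_add] at this
    rw [add_sub_add_comm, smul_comm c (eval c _), smul_comm c b, ← smul_sub, ← smul_sub,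
      h2] at this
    simp only [smul_zero, add_zero, map_zero, sub_zero] at this
    exact (smul_eq_zero.1 this.symm).resolve_left ha
  rw [h4, smul_zero, add_zero] at h3
  exact (smul_eq_zero.1 h3.symm).resolve_left ha

/-- Applied to Ev at level l - 1: the remaining r - d - 1 steps down meet no level with the scalar
of l. This settles the first case of the theorem and drives the relations at the walls. -/
lemma E_eq_zero (hr : 2 ≤ r) {l : ℤ} {v : M} (hv : v ∈ W.A l)
    (h0 : (W.E ^ (r - wall r n l)) v = 0) : W.E v = 0 := by
  have hw := wall_lt (n := n) (by omega : 1 ≤ r) l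
  have hv' := (mem_A_iff rfl).1 hv
  have h1 := cas_pow_comm (W := W) cas_comm_E 1 (casScalar r n l)
  simp only [pow_one] at h1
  refine F_pow_E_pow_eq (c := casScalar r n l) (s := r - wall r n l - 1) (W.E_mem hv'.1) ?_ ?_ ?_
  · rw [h1, h1, hv'.2, map_zero]
  · intro t ht
    rw [sub_sub, show (1 + (t : ℤ)) = (1 + t : ℕ) by push_cast; rfl]
    exact casScalar_sub_ne hr (by omega) (by omega)
  · rw [← Module.End.mul_apply, ← pow_succ, Nat.sub_add_cancel (by omega), h0]

/-! #### Maps between neighbouring walls -/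

-- On A the square of C - c vanishes, so a polynomial multiplied by C - c only contributes its value
-- at c.
open Polynomial in
lemma exists_aeval_mul_eq (l : ℤ) (p : ℂ[X]) : ∀ v ∈ W.A l,
    aeval W.cas (p * (X - C (casScalar r n l))) v = p.eval (casScalar r n l) • W.F (W.E v) := by
  intro v hv
  obtain ⟨b, hb⟩ := exists_aeval_eq W.cas p (casScalar r n l)
  have h := (mem_A_iff rfl).1 (FE_mem_A hv)
  rw [map_mul, Module.End.mul_apply, aeval_X_sub_C, cas_sub (mem_A.1 hv).1, hb _ h.2,
    cas_sub h.1, (mem_A.1 hv).2, smul_zero, add_zero]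

-- Among the r - d factors of the polynomial, only t = 0 carries the scalar of l; the others
-- evaluate to a nonzero constant.
open Polynomial in
lemma exists_down_up (hr : 2 ≤ r) (l : ℤ) : ∃ a : ℂ, a ≠ 0 ∧ ∀ v ∈ W.A l,
    (W.F ^ (r - wall r n l)) ((W.E ^ (r - wall r n l)) v) = a • W.F (W.E v) := by
  have hw := wall_lt (n := n) (by omega : 1 ≤ r) l
  obtain ⟨s, hs⟩ : ∃ s, r - wall r n l = s + 1 := ⟨r - wall r n l - 1, by omega⟩
  refine ⟨(∏ t ∈ Finset.range s, (X - C (casScalar r n (l - (t + 1 : ℕ))))).eval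
    (casScalar r n l), ?_, fun v hv => ?_⟩
  rotate_left
  · rw [hs, F_pow_E_pow _ (mem_A.1 hv).1, Finset.prod_range_succ', Nat.cast_zero, sub_zero,
      exists_aeval_mul_eq _ _ v hv]
  · rw [eval_prod, Finset.prod_ne_zero_iff]
    intro t ht
    rw [eval_sub, eval_X, eval_C]
    rw [Finset.mem_range] at ht
    exact sub_ne_zero_of_ne (casScalar_sub_ne hr (by omega) (by omega)).symm

-- Here the factor with the scalar of l is the last one, belonging to the level l + d.
open Polynomial in
lemma exists_up_down (hr : 2 ≤ r) (l : ℤ) (hl : wall r n l ≠ 0) : ∃ a : ℂ, a ≠ 0 ∧ ∀ v ∈ W.A l,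
    (W.E ^ wall r n l) ((W.F ^ wall r n l) v) = a • W.F (W.E v) := by
  obtain ⟨s, hs⟩ : ∃ s, wall r n l = s + 1 := ⟨wall r n l - 1, by omega⟩
  refine ⟨(∏ t ∈ Finset.range s, (X - C (casScalar r n (l + (t + 1 : ℕ))))).eval
    (casScalar r n l), ?_, fun v hv => ?_⟩
  rotate_left
  · have := casScalar_add_wall (n := n) hr l
    rw [hs] at this
    rw [hs, E_pow_F_pow _ (mem_A.1 hv).1, Finset.prod_range_succ, this,
      exists_aeval_mul_eq _ _ v hv]
  · rw [eval_prod, Finset.prod_ne_zero_iff]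
    intro t ht
    rw [eval_sub, eval_X, eval_C]
    rw [Finset.mem_range] at ht
    exact sub_ne_zero_of_ne (casScalar_add_ne hr (by omega) (by omega)).symm

/-- Up to a nonzero scalar FE is F^(r-d) E^(r-d), and another F^d completes the power F^r = 0. -/
lemma F_pow_FE (hr : 2 ≤ r) {l : ℤ} {v : M} (hv : v ∈ W.A l) :
    (W.F ^ wall r n l) (W.F (W.E v)) = 0 := by
  have hw := wall_lt (n := n) (by omega : 1 ≤ r) l
  obtain ⟨a, ha, h⟩ := W.exists_down_up hr l
  refine (smul_eq_zero.1 ?_).resolve_left ha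
  rw [← map_smul, ← h v hv, pow_apply_add, F_pow_eq_zero (by omega)]

/-- Up to a nonzero scalar FEv is E^d F^d v, which E^(r-d) kills; injectivity away from the walls
then gives the claim. -/
lemma E_FE (hr : 2 ≤ r) {l : ℤ} (hl : wall r n l ≠ 0) {v : M} (hv : v ∈ W.A l) :
    W.E (W.F (W.E v)) = 0 := by
  have hw := wall_lt (n := n) (by omega : 1 ≤ r) l
  obtain ⟨a, ha, h⟩ := W.exists_up_down hr l hl
  refine E_eq_zero hr (FE_mem_A hv) ((smul_eq_zero.1 ?_).resolve_left ha)
  rw [← map_smul, ← h v hv, pow_apply_add, E_pow_eq_zero (by omega)]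

/-- At the lower wall the distance to the next one below is d, and E^d E^(r-d) = 0. -/
lemma E_E_pow (hr : 2 ≤ r) {l : ℤ} (hl : wall r n l ≠ 0) {v : M} (hv : v ∈ W.A l) :
    W.E ((W.E ^ (r - wall r n l)) v) = 0 := by
  have hw := wall_lt (n := n) (by omega : 1 ≤ r) l
  have hw' := wall_sub_wall hl (by omega : 1 ≤ r)
  refine E_eq_zero hr (E_pow_mem_A (casScalar_sub_wall hr l) hv) ?_
  rw [hw', pow_apply_add, E_pow_eq_zero (by omega)]

/-- A preimage given by freeness can be moved into the proper level and generalized eigenspace,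
since both projections are compatible with powers of E. -/
lemma exists_E_pow (hr : 2 ≤ r) {l : ℤ} {s : ℕ} (hs : s ≤ r) {v : M} (hv : v ∈ W.A l)
    (hc : casScalar r n (l + (r - s : ℕ)) = casScalar r n l) (h0 : (W.E ^ s) v = 0) :
    ∃ w ∈ W.A (l + (r - s : ℕ)), v = (W.E ^ (r - s)) w := by
  obtain ⟨w, hw⟩ := exact_pow (by omega) W.exact_E hs h0
  obtain ⟨p, hp, hp'⟩ := W.exists_proj_A' hr l
  refine ⟨Polynomial.aeval W.cas p (W.π _ w), hp _ hc _ (W.π_mem _ w), ?_⟩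
  rw [← aeval_E_pow, ← π_E_pow, ← hw, W.π_apply (mem_A.1 hv).1, hp' v hv]

lemma exists_F_pow (hr : 2 ≤ r) {l : ℤ} {s : ℕ} (hs : s ≤ r) {v : M} (hv : v ∈ W.A l)
    (hc : casScalar r n (l - (r - s : ℕ)) = casScalar r n l) (h0 : (W.F ^ s) v = 0) :
    ∃ w ∈ W.A (l - (r - s : ℕ)), v = (W.F ^ (r - s)) w := by
  obtain ⟨w, hw⟩ := exact_pow (by omega) W.exact_F hs h0
  obtain ⟨p, hp, hp'⟩ := W.exists_proj_A' hr l
  refine ⟨Polynomial.aeval W.cas p (W.π _ w), hp _ hc _ (W.π_mem _ w), ?_⟩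
  rw [← aeval_F_pow, ← π_F_pow, ← hw, W.π_apply (mem_A.1 hv).1, hp' v hv]

lemma wall_add_r (l : ℤ) (hr : 1 ≤ r) : wall r n (l + r) = wall r n l := by
  refine wall_eq_of_dvd (wall_lt hr l) ?_
  obtain ⟨e, he⟩ := dvd_wall (n := n) hr l
  refine ⟨e - 2, ?_⟩
  rw [wt_add]
  linear_combination he

/-- Exactness of the complex of the spaces `A` at successive walls. -/
lemma exists_of_FE_eq_zero (hr : 2 ≤ r) {l : ℤ} (hl : wall r n l ≠ 0) {v : M} (hv : v ∈ W.A l)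
    (h0 : W.F (W.E v) = 0) : ∃ a ∈ W.A (l + wall r n l), ∃ b ∈ W.A (l - (r - wall r n l : ℕ)),
      v = (W.E ^ wall r n l) a + (W.F ^ (r - wall r n l)) b := by
  -- The induction descends from levels beyond the top, where the space is zero, in steps of r.
  obtain ⟨K, hK⟩ : ∃ K : ℕ, n * ((r : ℤ) - 1) < l + K * r := by
    refine ⟨(n * ((r : ℤ) - 1) - l).toNat + 1, ?_⟩
    have h1 : ((n * ((r : ℤ) - 1) - l).toNat : ℤ) + 1 ≤
        ((n * ((r : ℤ) - 1) - l).toNat + 1 : ℕ) * (r : ℤ) := by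
      push_cast
      exact le_mul_of_one_le_right (by omega) (by omega)
    omega
  induction K generalizing l v with
  | zero =>
    have h1 := (mem_A.1 hv).1
    rw [W.L_eq_bot (Or.inr (by simpa using hK)), Submodule.mem_bot] at h1
    exact ⟨0, zero_mem _, 0, zero_mem _, by simp [h1]⟩
  | succ K ih =>
    have hw := wall_lt (n := n) (by omega : 1 ≤ r) l
    have hw' := wall_add_wall hl (by omega : 1 ≤ r)
    have hlr : l + wall r n l + (r - wall r n l : ℕ) = l + r := by
      push_cast [Nat.cast_sub hw.le]; ring
    set d := wall r n l with hd
    have hcd : casScalar r n (l + d) = casScalar r n l := casScalar_add_wall hr l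
    have hcr : casScalar r n (l + r) = casScalar r n l :=
      (casScalar_add_eq_iff hr l r).2 (Or.inl dvd_rfl)
    have hwr : wall r n (l + r) = d := wall_add_r l (by omega)
    obtain ⟨a₁, ha₁, h1⟩ := W.exists_up_down hr l hl
    -- As FEv = 0, also E^d F^d v = 0, so freeness of E gives F^d v = E^(r-d) z with z at level l +
    -- r.
    obtain ⟨z, hz, hvz⟩ := exists_E_pow hr hw.le (F_pow_mem_A hcd hv)
      (by rw [hlr, hcr, hcd]) (by rw [h1 v hv, h0, smul_zero])
    rw [hlr] at hz
    obtain ⟨a₂, ha₂, h2⟩ := W.exists_down_up hr (l + r)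
    rw [hwr] at h2
    -- A nonzero multiple of FEz is F^(r-d) E^(r-d) z = F^r v = 0, so the induction hypothesis
    -- applies to z.
    have hz0 : W.F (W.E z) = 0 := by
      refine (smul_eq_zero.1 ?_).resolve_left ha₂
      rw [← h2 z hz, ← hvz, pow_apply_add, F_pow_eq_zero (by omega)]
    obtain ⟨x, hx, y, hy, hzxy⟩ := ih (by rwa [hwr]) hz hz0 (by push_cast at hK ⊢; linarith)
    rw [hwr, show l + r - (r - d : ℕ) = l + d by push_cast [Nat.cast_sub hw.le]; ring] at hy
    rw [hwr] at hzxy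
    obtain ⟨a₃, ha₃, h3⟩ := W.exists_up_down hr (l + d) (by rw [hw']; omega)
    obtain ⟨a₄, ha₄, h4⟩ := W.exists_down_up hr (l + d)
    rw [hw'] at h3 h4
    rw [show r - (r - d) = d by omega] at h4
    have hEy : (W.E ^ d) y ∈ W.A l := by
      have := E_pow_mem_A (s := d) (by rw [add_sub_cancel_right, hcd]) hy
      rwa [add_sub_cancel_right] at this
    -- Writing z = E^d x + F^(r-d) y gives F^d v = E^(r-d) F^(r-d) y = a₃ FEy, since E^r = 0. But
    -- F^d E^d y = a₄ FEy, so subtracting (a₃/a₄) E^d y from v puts the rest into the kernel of F^d,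
    -- where freeness of F applies.
    have hkey : (W.F ^ d) (v - (a₃ * a₄⁻¹) • (W.E ^ d) y) = 0 := by
      rw [map_sub, map_smul, h4 y hy, smul_smul, mul_assoc, inv_mul_cancel₀ ha₄, mul_one,
        ← h3 y hy, hvz, hzxy, map_add, pow_apply_add, E_pow_eq_zero (by omega), zero_add, sub_self]
    obtain ⟨b, hb, hvb⟩ := exists_F_pow hr hw.le
      (sub_mem hv (Submodule.smul_mem _ (a₃ * a₄⁻¹) hEy)) (casScalar_sub_wall hr l) hkey
    refine ⟨(a₃ * a₄⁻¹) • y, Submodule.smul_mem _ _ hy, b, hb, ?_⟩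
    rw [map_smul, ← hvb]
    abel

end WeightSystem

end

section

namespace WeightSystem

variable {r n : ℕ} {M : Type*} [AddCommGroup M] [Module ℂ M] {W : WeightSystem r n M}

/-! #### Homomorphisms from the indecomposable projective modules -/

variable (W) in
/-- The operator `α² F = α⁻² F` for the summands with head at level `l`. -/
def G (l : ℤ) : Module.End ℂ M := wallSign r n l • W.F

lemma G_pow_apply (l : ℤ) (s : ℕ) (v : M) :
    (W.G l ^ s) v = wallSign r n l ^ s • (W.F ^ s) v := by
  rw [G, smul_pow, LinearMap.smul_apply]

lemma G_pow_mem {l m : ℤ} (s : ℕ) {v : M} (hv : v ∈ W.L m) : (W.G l ^ s) v ∈ W.L (m + s) := by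
  rw [G_pow_apply]
  exact Submodule.smul_mem _ _ (F_pow_mem s hv)

lemma smul_G_pow_succ (hr : 1 ≤ r) (l : ℤ) (s : ℕ) (v : M) :
    wallSign r n l • (W.G l ^ (s + 1)) v = W.F ((W.G l ^ s) v) := by
  rw [pow_succ', Module.End.mul_apply, G, LinearMap.smul_apply, smul_smul, wallSign_mul_self hr,
    one_smul]

/-- Compare the two expressions for C on G^s x. The coefficient is the difference of the scalars at
l and l + s + 1, freed of its sign by the normalization of G. -/
lemma E_G_pow (hr : 2 ≤ r) {l : ℤ} {x : M} (hx : x ∈ W.L l) (s : ℕ) :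
    W.E ((W.G l ^ (s + 1)) x) = (W.G l ^ (s + 1)) (W.E x) +
      (qInt r (s + 1) * qInt r (wall r n l - (s + 1))) • (W.G l ^ s) x := by
  have h1 := W.cas_EF (G_pow_mem (l := l) s hx)
  have h2 : W.cas ((W.G l ^ s) x) = (W.G l ^ s) (W.cas x) := by
    rw [G_pow_apply, G_pow_apply, map_smul]
    congr 1
    exact LinearMap.congr_fun (cas_comm_F.pow_right s).eq x
  have h3 : wallSign r n l • (W.E (W.F ((W.G l ^ s) x))) = W.E ((W.G l ^ (s + 1)) x) := by
    rw [pow_succ', Module.End.mul_apply, G, LinearMap.smul_apply, map_smul]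
  have h4 : wallSign r n l • (W.G l ^ s) (W.F (W.E x)) = (W.G l ^ (s + 1)) (W.E x) := by
    rw [pow_succ, Module.End.mul_apply, G, LinearMap.smul_apply, map_smul]
  have h5 := casScalar_sub (n := n) hr l (s + 1)
  have h6 : W.E (W.F ((W.G l ^ s) x)) = (W.G l ^ s) (W.F (W.E x)) +
      (casScalar r n l - casScalar r n (l + (s + 1))) • (W.G l ^ s) x := by
    rw [h2, W.cas_FE hx, map_add, map_smul, ← sub_eq_iff_eq_add] at h1
    rw [← h1, sub_smul, add_sub_assoc, add_assoc]
  rw [← h3, ← h4, h6, smul_add, smul_smul, h5, ← mul_assoc, wallSign_mul_self (by omega), one_mul]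

/-- Since s ≥ 1 and EFEx = 0, the Casimir operator acts on E^s x by the scalar of l, and FE acts
there by a difference of scalars. -/
lemma F_E_pow (hr : 2 ≤ r) {l : ℤ} (hl : wall r n l ≠ 0) {x : M} (hx : x ∈ W.A l) {s : ℕ}
    (hs : 1 ≤ s) : W.F ((W.E ^ (s + 1)) x) =
      (wallSign r n l * (qInt r (-s) * qInt r (wall r n l + s))) • (W.E ^ s) x := by
  have hx' := (mem_A.1 hx).1
  have h1 := W.cas_FE (E_pow_mem s hx')
  have h2 : W.cas ((W.E ^ s) x) = (W.E ^ s) (W.cas x) :=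
    LinearMap.congr_fun (cas_comm_E.pow_right s).eq x
  obtain ⟨t, rfl⟩ : ∃ t, s = t + 1 := ⟨s - 1, by omega⟩
  have h3 : (W.E ^ (t + 1)) (W.F (W.E x)) = 0 := by
    rw [pow_succ, Module.End.mul_apply, E_FE hr hl hx, map_zero]
  rw [h2, W.cas_FE hx', map_add, map_smul, h3, zero_add, ← sub_eq_iff_eq_add] at h1
  have h5 := casScalar_sub (n := n) hr l (-(t + 1 : ℕ))
  rw [sub_neg_eq_add, ← sub_eq_add_neg] at h5
  rw [pow_succ' W.E, Module.End.mul_apply, ← h1, ← sub_smul, h5]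

variable (W) in
/-- The homomorphism from `P_i^α` taking `w_0^H` to `x`. -/
def headHom (l : ℤ) (i : ℕ) (x : M) : P r i →ₗ[ℂ] M :=
  Finsupp.linearCombination ℂ fun
    | .H m => (W.G l ^ (m : ℕ)) x
    | .S m => (W.G l ^ ((m : ℕ) + 1)) (W.E x)
    | .L m => (W.G l ^ (i + 1 + m)) x
    | .R m => (W.E ^ (r - 2 - i + 1 - m)) x

section

variable {l : ℤ} {i : ℕ} {x : M}

lemma headHom_wH {m : ℕ} (h : m ≤ i) : W.headHom l i x (wH r i m) = (W.G l ^ m) x := by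
  rw [wH_of_lt (by omega : m < i + 1)]
  exact (Finsupp.linearCombination_single ℂ _ _).trans (one_smul ℂ _)

lemma headHom_wR {m : ℕ} (h : m ≤ r - 2 - i) :
    W.headHom l i x (wR r i m) = (W.E ^ (r - 2 - i + 1 - m)) x := by
  rw [wR_of_lt (by omega : m < r - 2 - i + 1)]
  exact (Finsupp.linearCombination_single ℂ _ _).trans (one_smul ℂ _)

/-- This realizes the convention that w_m^S is 0 for m > i, so the relations at the end of the socle
chain need no special case. -/
lemma G_pow_E_eq_zero (hr : 2 ≤ r) (hi : wall r n l = i + 1) (hx : x ∈ W.A l) {m : ℕ}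
    (h : i < m) : (W.G l ^ (m + 1)) (W.E x) = 0 := by
  have := F_pow_FE hr hx
  rw [hi] at this
  obtain ⟨t, rfl⟩ : ∃ t, m = t + (i + 1) := ⟨m - (i + 1), by omega⟩
  rw [G_pow_apply, pow_succ W.F, Module.End.mul_apply, pow_add W.F, Module.End.mul_apply, this,
    map_zero, smul_zero]

lemma headHom_wS (hr : 2 ≤ r) (hi : wall r n l = i + 1) (hx : x ∈ W.A l) (m : ℕ) :
    W.headHom l i x (wS r i m) = (W.G l ^ (m + 1)) (W.E x) := by
  by_cases h : m < i + 1
  · rw [wS_of_lt h]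
    exact (Finsupp.linearCombination_single ℂ _ _).trans (one_smul ℂ _)
  · rw [wS, dif_neg h, map_zero, G_pow_E_eq_zero hr hi hx (by omega)]

lemma headHom_wL (hi2 : i + 2 ≤ r) (m : ℕ) :
    W.headHom l i x (wL r i m) = (W.G l ^ (i + 1 + m)) x := by
  by_cases h : m < r - 2 - i + 1
  · rw [wL_of_lt h]
    exact (Finsupp.linearCombination_single ℂ _ _).trans (one_smul ℂ _)
  · rw [wL, dif_neg h, map_zero, G_pow_apply, F_pow_eq_zero (by omega), smul_zero]

lemma headHom_E (hr : 2 ≤ r) (hi : wall r n l = i + 1) (hx : x ∈ W.A l) :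
    W.headHom l i x ∘ₗ (proj r i (wallRoot r n l)).E = W.E ∘ₗ W.headHom l i x := by
  have hx' := (mem_A.1 hx).1
  have hw := wall_lt (n := n) (by omega : 1 ≤ r) l
  have hl : wall r n l ≠ 0 := by omega
  refine P_hom_ext (fun m hm => ?_) (fun m hm => ?_) (fun m hm => ?_) (fun m hm => ?_) <;>
    rw [LinearMap.comp_apply, LinearMap.comp_apply]
  · rw [proj_E_wH _ hm, headHom_wH hm]
    rcases m with _ | m
    · rw [if_pos rfl, headHom_wR le_rfl, pow_zero, Module.End.one_apply,
        Nat.add_sub_cancel_left, pow_one]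
    · rw [if_neg (by omega), Nat.add_sub_cancel, map_add, map_smul, headHom_wH (by omega),
        headHom_wS hr hi hx, E_G_pow hr hx', add_comm, gam, hi]
      congr 4; push_cast; ring
  · rw [proj_E_wS _ hm, headHom_wS hr hi hx]
    have h1 := E_G_pow hr (FE_mem hx')
    have h2 : ∀ s, (W.G l ^ (s + 1)) (W.E x) = wallSign r n l • (W.G l ^ s) (W.F (W.E x)) := by
      intro s
      rw [pow_succ, Module.End.mul_apply, G, LinearMap.smul_apply, map_smul]
    rw [h2]
    rcases m with _ | m
    · rw [if_pos rfl, map_zero, pow_zero, Module.End.one_apply, map_smul, E_FE hr hl hx, smul_zero]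
    · rw [if_neg (by omega), Nat.add_sub_cancel, map_smul, headHom_wS hr hi hx, h2, map_smul,
        h1, E_FE hr hl hx, map_zero, zero_add, smul_comm, gam, hi]
      congr 4; push_cast; ring
  · rw [proj_E_wL _ hm, headHom_wL (by omega), show i + 1 + m = i + m + 1 by ring, E_G_pow hr hx']
    rcases m with _ | m
    · rw [if_pos rfl, headHom_wS hr hi hx, hi]
      have : qInt r (((i + 1 : ℕ) : ℤ) - (((i + 0 : ℕ) : ℤ) + 1)) = 0 := by
        rw [qInt_eq_zero_iff hr]; simp
      rw [this, mul_zero, zero_smul, add_zero, Nat.add_zero]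
    · rw [if_neg (by omega), Nat.add_sub_cancel, map_smul, headHom_wL (by omega),
        G_pow_E_eq_zero hr hi hx (by omega), zero_add, hi, gam,
        show i + 1 + m = i + (m + 1) by ring]
      congr 1
      -- The symmetry [r - x] = [x] matches γ_{i',m+1} with the factors coming from the Casimir
      -- scalars.
      rw [← neg_mul, ← qInt_neg, mul_comm]
      congr 1
      · rw [← qInt_sub (by omega : 1 ≤ r)]
        congr 1
        push_cast [Nat.cast_sub (by omega : i ≤ r - 2), Nat.cast_sub (by omega : 2 ≤ r)]
        ring
      · congr 1; push_cast; ring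
  · rw [proj_E_wR _ hm, headHom_wR hm]
    rcases m with _ | m
    · rw [if_pos rfl, map_zero, Nat.sub_zero]
      have := E_E_pow hr hl hx
      rw [hi] at this
      rw [show r - 2 - i + 1 = r - (i + 1) by omega, this]
    · rw [if_neg (by omega), Nat.add_sub_cancel, headHom_wR (by omega), ← Module.End.mul_apply,
        ← pow_succ']
      congr 2; omega

lemma headHom_F (hr : 2 ≤ r) (hi : wall r n l = i + 1) (hx : x ∈ W.A l) :
    W.headHom l i x ∘ₗ (proj r i (wallRoot r n l)).F = W.F ∘ₗ W.headHom l i x := by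
  have hw := wall_lt (n := n) (by omega : 1 ≤ r) l
  have hl : wall r n l ≠ 0 := by omega
  have hr1 : 1 ≤ r := by omega
  refine P_hom_ext (fun m hm => ?_) (fun m hm => ?_) (fun m hm => ?_) (fun m hm => ?_) <;>
    rw [LinearMap.comp_apply, LinearMap.comp_apply]
  · rw [proj_F_wH _ hm, headHom_wH hm, wallRoot_sq, map_smul, ← smul_G_pow_succ hr1]
    congr 1
    split_ifs with h
    · rw [h, headHom_wL (by omega), Nat.add_zero]
    · rw [headHom_wH (by omega)]
  · rw [proj_F_wS _ hm, headHom_wS hr hi hx, wallRoot_sq, map_smul, ← smul_G_pow_succ hr1,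
      headHom_wS hr hi hx]
  · rw [proj_F_wL _ hm, headHom_wL (by omega), wallRoot_sq, map_smul, ← smul_G_pow_succ hr1,
      headHom_wL (by omega)]
    rfl
  · rw [proj_F_wR _ hm, headHom_wR hm, wallRoot_sq, map_smul]
    split_ifs with h
    · subst h
      rw [headHom_wS hr hi hx, smul_G_pow_succ hr1, pow_zero, Module.End.one_apply,
        Nat.add_sub_cancel_left, pow_one]
    · obtain ⟨s, hs⟩ : ∃ s, r - 2 - i + 1 - m = s + 1 := ⟨r - 2 - i - m, by omega⟩
      rw [map_smul, headHom_wR (by omega), hs, F_E_pow hr hl hx (by omega), smul_smul,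
        show r - 2 - i + 1 - (m + 1) = s by omega, hi, gam]
      congr 2
      have h1 : ((r - 2 - i : ℕ) : ℤ) - ((m + 1 : ℕ) : ℤ) + 1 = s := by omega
      have h2 : (((i + 1 : ℕ) : ℤ) + s) = r - ((m + 1 : ℕ) : ℤ) := by omega
      rw [h1, h2, qInt_sub hr1, qInt_neg]
      ring

lemma headHom_k (hr : 2 ≤ r) (hi : wall r n l = i + 1) (hx : x ∈ W.A l) :
    W.headHom l i x ∘ₗ (proj r i (wallRoot r n l)).k = W.k ∘ₗ W.headHom l i x := by
  have hx' := (mem_A.1 hx).1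
  have hw := wall_lt (n := n) (by omega : 1 ≤ r) l
  have hq := qHalf_ne_zero r
  refine P_hom_ext (fun m hm => ?_) (fun m hm => ?_) (fun m hm => ?_) (fun m hm => ?_) <;>
    rw [LinearMap.comp_apply, LinearMap.comp_apply]
  · rw [proj_k_wH _ hm, map_smul, map_smul, headHom_wH hm, W.k_apply (G_pow_mem m hx'), wallRoot,
      smul_smul, ← zpow_add₀ hq, wt_add, hi]
    congr 2; push_cast; ring
  · rw [proj_k_wS _ hm, map_smul, map_smul, headHom_wS hr hi hx,
      W.k_apply (G_pow_mem (m + 1) (W.E_mem hx')), wallRoot,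
      smul_smul, ← zpow_add₀ hq, hi]
    congr 2
    simp only [wt]
    push_cast; ring
  · rw [proj_k_wL _ hm, map_smul, map_smul, headHom_wL (by omega), W.k_apply (G_pow_mem _ hx'),
      wallRoot, smul_smul, ← zpow_add₀ hq, wt_add, hi]
    congr 2; push_cast; ring
  · rw [proj_k_wR _ hm, map_smul, map_smul, headHom_wR hm, W.k_apply (E_pow_mem _ hx'),
      wallRoot, smul_smul, ← zpow_add₀ hq, sub_eq_add_neg l, wt_add, hi]
    congr 2
    push_cast [Nat.cast_sub (by omega : m ≤ r - 2 - i + 1), Nat.cast_sub (by omega : i ≤ r - 2),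
      Nat.cast_sub (by omega : 2 ≤ r)]
    ring

end

/-! #### Homomorphisms from the Steinberg modules -/

variable (W) in
/-- The homomorphism from `V_{r-1}^α` taking `u_{r-1}` to `z`. -/
def steinbergHom (z : M) : V r →ₗ[ℂ] M :=
  (Pi.basisFun ℂ (Fin r)).constr ℂ fun m : Fin r => (W.E ^ (r - 1 - (m : ℕ))) z

/-- The scalar `α` for the Steinberg summands with highest weight vector at level `l`. -/
def steinbergRoot (r n : ℕ) (l : ℤ) : ℂ := qHalf r ^ (wt r n l + 1 - r)

lemma steinbergRoot_pow_four (hr : 1 ≤ r) {l : ℤ} (hl : wall r n l = 0) :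
    steinbergRoot r n l ^ 4 = 1 := by
  obtain ⟨e, he⟩ := dvd_wall (n := n) hr l
  rw [hl, Nat.cast_zero, sub_zero] at he
  rw [steinbergRoot, ← zpow_natCast, ← zpow_mul, qHalf_zpow_eq_one_iff hr]
  exact ⟨e - 1, by push_cast; linear_combination 4 * he⟩

lemma steinbergHom_u (z : M) {m : ℕ} (h : m < r) :
    W.steinbergHom z (u r m) = (W.E ^ (r - 1 - m)) z :=
  constr_u (fun m => (W.E ^ (r - 1 - m)) z) h

lemma steinbergHom_E (z : M) (α : ℂ) :
    W.steinbergHom z ∘ₗ (steinberg r α).E = W.E ∘ₗ W.steinbergHom z :=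
  V_hom_ext fun m hm => by
    rw [LinearMap.comp_apply, LinearMap.comp_apply, steinberg_E_u _ _ hm, steinbergHom_u z hm]
    split_ifs with h
    · rw [map_zero, ← Module.End.mul_apply, ← pow_succ', E_pow_eq_zero (by omega)]
    · rw [steinbergHom_u z (by omega), ← Module.End.mul_apply, ← pow_succ']
      congr 2; omega

/-- The sign is q^(-r) = -1: the root is normalized at distance r, whereas `wall` records that
distance as 0. -/
lemma steinbergRoot_sq (hr : 1 ≤ r) {l : ℤ} (hl : wall r n l = 0) :
    steinbergRoot r n l ^ 2 = -wallSign r n l := by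
  rw [steinbergRoot, wallSign, hl, q_zpow_eq, ← zpow_natCast, ← zpow_mul, Nat.cast_zero,
    sub_zero, show (wt r n l + 1 - (r : ℤ)) * (2 : ℕ) = 2 * (wt r n l + 1) + 2 * (-r) by
      push_cast; ring, zpow_add₀ (qHalf_ne_zero r), ← q_zpow_eq r (-r), zpow_neg,
    q_pow_r hr, inv_neg, inv_one, mul_neg_one]

/-- As z is a genuine eigenvector of C, FE acts on E^s z by a difference of Casimir scalars, which
supplies the coefficients of F; Fz = 0 covers the lowest vector. -/
lemma steinbergHom_F (hr : 2 ≤ r) {l : ℤ} (hl : wall r n l = 0) {z : M}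
    (hz : z ∈ W.L (l + (r - 1 : ℕ))) (hc : W.cas z = casScalar r n l • z) (hF : W.F z = 0) :
    W.steinbergHom z ∘ₗ (steinberg r (steinbergRoot r n l)).F = W.F ∘ₗ W.steinbergHom z :=
  V_hom_ext fun m hm => by
    rw [LinearMap.comp_apply, LinearMap.comp_apply, steinberg_F_u, steinbergHom_u z hm, map_smul]
    by_cases h : m = r - 1
    · rw [u_of_le (by omega), h, Nat.sub_self, pow_zero, Module.End.one_apply, hF, map_zero,
        smul_zero]
    · obtain ⟨s, hs⟩ : ∃ s, r - 1 - m = s + 1 := ⟨r - 2 - m, by omega⟩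
      rw [steinbergHom_u z (by omega), hs, show r - 1 - (m + 1) = s by omega]
      have h1 := W.cas_FE (E_pow_mem s hz)
      have h2 : W.cas ((W.E ^ s) z) = (W.E ^ s) (W.cas z) :=
        LinearMap.congr_fun (cas_comm_E.pow_right s).eq z
      have h3 : (l + (r - 1 : ℕ) - s : ℤ) = l + (m + 1) := by omega
      rw [h2, hc, map_smul, h3, ← sub_eq_iff_eq_add, ← sub_smul, casScalar_sub hr, hl] at h1
      rw [pow_succ' W.E, Module.End.mul_apply, ← h1, steinbergRoot_sq (by omega) hl]
      congr 1
      rw [Nat.cast_zero, zero_sub, qInt_neg, show ((r : ℤ) - 1 - m) = r - (m + 1) by ring,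
        qInt_sub (by omega)]
      ring

lemma steinbergHom_k {l : ℤ} {z : M} (hz : z ∈ W.L (l + (r - 1 : ℕ))) :
    W.steinbergHom z ∘ₗ (steinberg r (steinbergRoot r n l)).k = W.k ∘ₗ W.steinbergHom z :=
  V_hom_ext fun m hm => by
    rw [LinearMap.comp_apply, LinearMap.comp_apply, steinberg_k_u, map_smul, steinbergHom_u z hm,
      W.k_apply (E_pow_mem _ hz), steinbergRoot, ← zpow_add₀ (qHalf_ne_zero r)]
    congr 2
    simp only [wt]
    push_cast [Nat.cast_sub (by omega : m ≤ r - 1), Nat.cast_sub (by omega : 1 ≤ r)]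
    ring

end WeightSystem

end

/-! ### Generators of the summands and generation of the whole space -/

section

namespace WeightSystem

variable {r n : ℕ} {M : Type*} [AddCommGroup M] [Module ℂ M] {W : WeightSystem r n M}

lemma isHom_act {N : Type*} [AddCommMonoid N] [Module ℂ N] {B : DAction N} {f : N →ₗ[ℂ] M}
    (hE : f ∘ₗ B.E = W.E ∘ₗ f) (hF : f ∘ₗ B.F = W.F ∘ₗ f) (hk : f ∘ₗ B.k = W.k ∘ₗ f) :
    B.IsHom W.act f where
  map_E := LinearMap.congr_fun hE
  map_F := LinearMap.congr_fun hF
  map_k := LinearMap.congr_fun hk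

lemma steinbergHom_isHom (hr : 2 ≤ r) {l : ℤ} (hl : wall r n l = 0) {z : M}
    (hz : z ∈ W.L (l + (r - 1 : ℕ))) (hc : W.cas z = casScalar r n l • z) (hF : W.F z = 0) :
    (steinberg r (steinbergRoot r n l)).IsHom W.act (W.steinbergHom z) :=
  isHom_act (steinbergHom_E z _) (steinbergHom_F hr hl hz hc hF) (steinbergHom_k hz)

lemma headHom_isHom (hr : 2 ≤ r) {l : ℤ} {i : ℕ} (hi : wall r n l = i + 1) {x : M}
    (hx : x ∈ W.A l) : (proj r i (wallRoot r n l)).IsHom W.act (W.headHom l i x) :=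
  isHom_act (headHom_E hr hi hx) (headHom_F hr hi hx) (headHom_k hr hi hx)

open Polynomial in
/-- Each vector of `A l` is the highest weight vector of a Steinberg module if no other level at
distance less than `r` has the same Casimir scalar. -/
lemma exists_steinberg (hr : 2 ≤ r) {l : ℤ} (hl : wall r n l = 0) : ∃ c : ℂ, ∀ y ∈ W.A l,
    W.E y = 0 ∧ (W.E ^ (r - 1)) (c • (W.F ^ (r - 1)) y) = y ∧
    W.cas (c • (W.F ^ (r - 1)) y) = casScalar r n l • c • (W.F ^ (r - 1)) y := by
  set p : ℂ[X] := ∏ t ∈ Finset.range (r - 1), (X - C (casScalar r n (l + (t + 1 : ℕ)))) with hp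
  have ha : p.eval (casScalar r n l) ≠ 0 := by
    rw [hp, eval_prod, Finset.prod_ne_zero_iff]
    intro t ht
    rw [eval_sub, eval_X, eval_C]
    rw [Finset.mem_range] at ht
    exact sub_ne_zero_of_ne (casScalar_add_ne hr (by omega) (by omega)).symm
  obtain ⟨b, hb⟩ := exists_aeval_eq W.cas p (casScalar r n l)
  refine ⟨(p.eval (casScalar r n l))⁻¹, fun y hy => ?_⟩
  have hE : W.E y = 0 := E_eq_zero hr hy (by rw [hl, Nat.sub_zero, E_pow_eq_zero le_rfl])
  have hy' := (mem_A_iff rfl).1 hy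
  have hc : W.cas y - casScalar r n l • y = 0 := by rw [cas_sub hy'.1, hE, map_zero]
  refine ⟨hE, ?_, ?_⟩
  · rw [map_smul, E_pow_F_pow _ hy'.1, hb y hy'.2, hc, smul_zero, add_zero, smul_smul,
      inv_mul_cancel₀ ha, one_smul]
  · rw [map_smul, smul_comm]
    congr 1
    rw [sub_eq_zero] at hc
    rw [← map_smul, ← hc]
    exact LinearMap.congr_fun (cas_comm_F.pow_right (r - 1)).eq y

/-! #### Adapted bases -/

/-- A complement of the kernel of FE in A l supplies the heads: modulo that kernel it represents
everything, and FE maps it injectively to socle vectors. -/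
lemma exists_complement (W : WeightSystem r n M) : ∃ X : ℤ → Submodule ℂ M, (∀ l, X l ≤ W.A l) ∧
    (∀ l, ∀ v ∈ W.A l, ∃ x ∈ X l, W.F (W.E (v - x)) = 0) ∧
    ∀ l, ∀ x ∈ X l, W.F (W.E x) = 0 → x = 0 := by
  choose Z hZ using fun l => Submodule.exists_isCompl (W.A l ⊓ LinearMap.ker (W.F * W.E))
  refine ⟨fun l => W.A l ⊓ Z l, fun l => inf_le_left, fun l v hv => ?_, fun l x hx h0 => ?_⟩
  · obtain ⟨y, hy, x, hx, hxy⟩ := Submodule.mem_sup.1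
      ((hZ l).sup_eq_top ▸ Submodule.mem_top : v ∈ (W.A l ⊓ LinearMap.ker (W.F * W.E)) ⊔ Z l)
    refine ⟨x, ⟨?_, hx⟩, ?_⟩
    · rw [← hxy] at hv
      exact (Submodule.add_mem_iff_right _ hy.1).1 hv
    · rw [← hxy, add_sub_cancel_right]
      exact hy.2
  · exact Submodule.disjoint_def.1 (hZ l).disjoint x ⟨hx.1, h0⟩ hx.2

/-- Bases chosen level by level are jointly independent because the projections `W.π` separate
levels. -/
lemma exists_adapted_basis [Module.Finite ℂ M] (S : Finset ℤ) {Z : ℤ → Submodule ℂ M}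
    (hZ : ∀ l, Z l ≤ W.L l) : ∃ (k : ℕ) (y : Fin k → M) (lev : Fin k → ℤ), (∀ a, lev a ∈ S) ∧
      (∀ a, y a ∈ Z (lev a)) ∧ (∀ m ∈ S, Z m ≤ Submodule.span ℂ {v | ∃ a, lev a = m ∧ v = y a}) ∧
      LinearIndependent ℂ y := by
  classical
  let ι := Σ l : S, Fin (Module.finrank ℂ (Z l))
  let y₀ : ι → M := fun x => (Module.finBasis ℂ (Z x.1) x.2 : M)
  let e : Fin (Fintype.card ι) ≃ ι := (Fintype.equivFin ι).symm
  refine ⟨Fintype.card ι, y₀ ∘ e, fun a => (e a).1, fun a => (e a).1.2,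
    fun a => (Module.finBasis ℂ (Z (e a).1) (e a).2).2, fun m hm v hv => ?_, ?_⟩
  · have h1 := congr_arg (Submodule.subtype (Z m))
      ((Module.finBasis ℂ (Z m)).sum_repr ⟨v, hv⟩)
    rw [map_sum] at h1
    simp only [map_smul, Submodule.subtype_apply] at h1
    rw [← h1]
    refine Submodule.sum_mem _ fun a _ => Submodule.smul_mem _ _ (Submodule.subset_span ?_)
    refine ⟨e.symm ⟨⟨m, hm⟩, a⟩, by simp, ?_⟩
    exact (congr_arg y₀ (e.apply_symm_apply ⟨⟨m, hm⟩, a⟩)).symm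
  · refine LinearIndependent.comp ?_ e e.injective
    rw [Fintype.linearIndependent_iff]
    rintro g hg ⟨l, a⟩
    have h1 := congr_arg (W.π l) hg
    rw [Fintype.sum_sigma, map_sum, map_zero, Finset.sum_eq_single l] at h1
    · have h2 : W.π l (∑ b, g ⟨l, b⟩ • y₀ ⟨l, b⟩) =
          ((∑ b, g ⟨l, b⟩ • Module.finBasis ℂ (Z l) b : Z l) : M) := by
        rw [W.π_apply (Submodule.sum_mem _ fun b _ => Submodule.smul_mem _ _
          (hZ l (Module.finBasis ℂ (Z l) b).2))]
        simp
      rw [h2, Submodule.coe_eq_zero] at h1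
      exact Fintype.linearIndependent_iff.1 (Module.finBasis ℂ (Z l)).linearIndependent _ h1 a
    · intro l' _ hl'
      rw [W.π_apply_of_ne (m' := (l' : ℤ)) (fun h => hl' (Subtype.ext h))]
      exact Submodule.sum_mem _ fun b _ => Submodule.smul_mem _ _
          (hZ l' (Module.finBasis ℂ (Z l') b).2)
    · exact fun h => absurd (Finset.mem_univ l) h

/-! #### Generation -/

/-- A submodule which is stable under `E` and `F` and contains enough vectors is everything. -/
lemma eq_top_of_stable (hr : 2 ≤ r) {Q : Submodule ℂ M}
    (hE : ∀ v ∈ Q, W.E v ∈ Q) (hF : ∀ v ∈ Q, W.F v ∈ Q) {X : ℤ → Submodule ℂ M}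
    (h0 : ∀ l, wall r n l = 0 → W.A l ≤ Q) (hX : ∀ l, wall r n l ≠ 0 → X l ≤ Q)
    (hXA : ∀ l, X l ≤ W.A l) (hXs : ∀ l, ∀ v ∈ W.A l, ∃ x ∈ X l, W.F (W.E (v - x)) = 0) :
    Q = ⊤ := by
  have hEp : ∀ s : ℕ, ∀ v ∈ Q, (W.E ^ s) v ∈ Q := by
    intro s v hv
    induction s with
    | zero => simpa
    | succ s ih => rw [pow_succ', Module.End.mul_apply]; exact hE _ ih
  have hFp : ∀ s : ℕ, ∀ v ∈ Q, (W.F ^ s) v ∈ Q := by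
    intro s v hv
    induction s with
    | zero => simpa
    | succ s ih => rw [pow_succ', Module.End.mul_apply]; exact hF _ ih
  have hFE : ∀ l, wall r n l ≠ 0 → ∀ v ∈ W.A l, W.F (W.E v) ∈ Q := by
    intro l hl v hv
    obtain ⟨x, hx, hvx⟩ := hXs l v hv
    rw [map_sub, map_sub, sub_eq_zero] at hvx
    rw [hvx]
    exact hF _ (hE _ (hX l hl hx))
  have hdec : ∀ l, wall r n l ≠ 0 → ∀ v ∈ W.A l, ∃ x ∈ X l, ∃ a ∈ W.A (l + wall r n l),
      ∃ b ∈ W.A (l - (r - wall r n l : ℕ)),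
        v = x + ((W.E ^ wall r n l) a + (W.F ^ (r - wall r n l)) b) := by
    intro l hl v hv
    obtain ⟨x, hx, hvx⟩ := hXs l v hv
    obtain ⟨a, ha, b, hb, h⟩ := exists_of_FE_eq_zero hr hl (sub_mem hv (hXA l hx)) hvx
    exact ⟨x, hx, a, ha, b, hb, by rw [← h, add_sub_cancel]⟩
  have hA : ∀ l, W.A l ≤ Q := by
    intro l v hv
    by_cases hl : wall r n l = 0
    · exact h0 l hl hv
    have hw := wall_lt (n := n) (by omega : 1 ≤ r) l
    have hw1 := wall_add_wall hl (by omega : 1 ≤ r)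
    have hw2 := wall_sub_wall hl (by omega : 1 ≤ r)
    obtain ⟨x, hx, a, ha, b, hb, rfl⟩ := hdec l hl v hv
    refine add_mem (hX l hl hx) (add_mem ?_ ?_)
    -- The decomposition is applied a second time, to a. E^d sends its head part into Q, kills the
    -- part E^(r-d) a' since E^r = 0, and turns F^d b' into a multiple of FEb', which is in Q. The
    -- part from b is treated symmetrically.
    · obtain ⟨x', hx', a', -, b', hb', rfl⟩ := hdec _ (by rw [hw1]; omega) a ha
      rw [hw1] at hb' ⊢
      rw [show r - (r - wall r n l) = wall r n l by omega] at hb' ⊢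
      rw [add_sub_cancel_right] at hb'
      rw [map_add, map_add, pow_apply_add,
        E_pow_eq_zero (by omega : r ≤ wall r n l + (r - wall r n l)), zero_add]
      obtain ⟨c, -, hc⟩ := W.exists_up_down hr l hl
      rw [hc b' hb']
      exact add_mem (hEp _ _ (hX _ (by rw [hw1]; omega) hx')) (Submodule.smul_mem _ _
        (hFE l hl b' hb'))
    · obtain ⟨x', hx', a', ha', b', -, rfl⟩ := hdec _ (by rw [hw2]; omega) b hb
      rw [hw2] at ha' ⊢
      rw [show r - (r - wall r n l) = wall r n l by omega]
      rw [sub_add_cancel] at ha'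
      rw [map_add, map_add, pow_apply_add (X := W.F),
        F_pow_eq_zero (by omega : r ≤ r - wall r n l + wall r n l), add_zero]
      obtain ⟨c, -, hc⟩ := W.exists_down_up hr l
      rw [hc a' ha']
      exact add_mem (hFp _ _ (hX _ (by rw [hw2]; omega) hx')) (Submodule.smul_mem _ _
        (hFE l hl a' ha'))
  -- Induction on the level, starting at -1 where the space is zero: modulo A each vector is F
  -- applied to a vector one level lower.
  have hL : ∀ m : ℕ, W.L (m - 1) ≤ Q := by
    intro m
    induction m with
    | zero => rw [W.L_eq_bot (Or.inl (by norm_num))]; exact bot_le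
    | succ m ih =>
      intro v hv
      obtain ⟨a, ha⟩ := W.exists_proj_A hr ((m + 1 : ℕ) - 1)
      have h1 := add_mem (hA _ (ha v hv)) (hF _ (ih (x := W.E (W.F (W.E
        (Polynomial.aeval W.cas a v)))) (by
          have := W.E_mem (FE_mem (aeval_mem a hv))
          convert this using 2
          push_cast; ring)))
      rwa [sub_add_cancel] at h1
  refine eq_top_iff.2 fun v _ => ?_
  rw [← W.sum_π v]
  refine Submodule.sum_mem _ fun m hm => hL (m + 1).toNat ?_
  have := W.π_mem m v
  rw [Finset.mem_Icc] at hm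
  rwa [Int.toNat_of_nonneg (by omega), add_sub_cancel_right]

end WeightSystem

end

section

variable {r n : ℕ}

/-! ### Injectivity can be tested on the kernel of `E` -/

lemma pow_apply_eq_zero_of_le {M : Type*} [AddCommMonoid M] [Module ℂ M] {X : Module.End ℂ M}
    {a b : ℕ} (h : a ≤ b) {v : M} (hv : (X ^ a) v = 0) : (X ^ b) v = 0 := by
  rw [← Nat.sub_add_cancel h, pow_add, Module.End.mul_apply, hv, map_zero]

/-- Only nilpotency matters for the later induction; the exponent is a crude bound. -/
lemma proj_E_pow {i : ℕ} (hi : i + 2 ≤ r) (α : ℂ) : (proj r i α).E ^ (2 * r) = 0 := by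
  have hR : ∀ m ≤ r - 2 - i, ((proj r i α).E ^ (m + 1)) (wR r i m) = 0 := by
    intro m
    induction m with
    | zero => intro h; rw [zero_add, pow_one, proj_E_wR α h, if_pos rfl]
    | succ m ih =>
      intro h
      rw [pow_succ, Module.End.mul_apply, proj_E_wR α h, if_neg (by omega), Nat.add_sub_cancel,
        ih (by omega)]
  have hS : ∀ m ≤ i, ((proj r i α).E ^ (m + 1)) (wS r i m) = 0 := by
    intro m
    induction m with
    | zero => intro h; rw [zero_add, pow_one, proj_E_wS α h, if_pos rfl]
    | succ m ih =>
      intro h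
      rw [pow_succ, Module.End.mul_apply, proj_E_wS α h, if_neg (by omega), Nat.add_sub_cancel,
        map_smul, ih (by omega), smul_zero]
  have hL : ∀ m ≤ r - 2 - i, ((proj r i α).E ^ (i + 1 + m + 1)) (wL r i m) = 0 := by
    intro m
    induction m with
    | zero =>
      intro h
      rw [pow_succ, Module.End.mul_apply, proj_E_wL α h, if_pos rfl, Nat.add_zero, hS i le_rfl]
    | succ m ih =>
      intro h
      rw [pow_succ, Module.End.mul_apply, proj_E_wL α h, if_neg (by omega), Nat.add_sub_cancel,
        map_smul, ← add_assoc, ih (by omega), smul_zero]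
  have hH : ∀ m ≤ i, ((proj r i α).E ^ (r + m + 1)) (wH r i m) = 0 := by
    intro m
    induction m with
    | zero =>
      intro h
      rw [pow_succ, Module.End.mul_apply, proj_E_wH α h, if_pos rfl]
      exact pow_apply_eq_zero_of_le (by omega) (hR _ le_rfl)
    | succ m ih =>
      intro h
      rw [pow_succ, Module.End.mul_apply, proj_E_wH α h, if_neg (by omega), Nat.add_sub_cancel,
        map_add, map_smul, ← add_assoc, ih (by omega), smul_zero, zero_add]
      exact pow_apply_eq_zero_of_le (by omega) (hS m (by omega))
  refine P_hom_ext (fun m hm => ?_) (fun m hm => ?_) (fun m hm => ?_) (fun m hm => ?_) <;>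
    rw [LinearMap.zero_apply]
  · exact pow_apply_eq_zero_of_le (by omega) (hH m hm)
  · exact pow_apply_eq_zero_of_le (by omega) (hS m hm)
  · exact pow_apply_eq_zero_of_le (by omega) (hL m hm)
  · exact pow_apply_eq_zero_of_le (by omega) (hR m hm)

lemma steinberg_E_pow (r : ℕ) (α : ℂ) : (steinberg r α).E ^ r = 0 := opE_pow r

section Summands

variable {M : Type*} [AddCommGroup M] [Module ℂ M] {B : DAction M} {ιS ιP : Type*} [Fintype ιS]
  [Fintype ιP] {αS : ιS → ℂ} {αP : ιP → ℂ} {idx : ιP → ℕ} {st : ιS → (V r →ₗ[ℂ] M)}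
  {pr : ∀ b : ιP, P r (idx b) →ₗ[ℂ] M}

/-- Since E is nilpotent, a relation can be pushed by E until its components are killed by E. There
only u_0, w_0^S and w_0^R occur, and for these independence is assumed in `hsoc`. -/
lemma eq_zero_of_sum_eq_zero (hr : 2 ≤ r) (hαS : ∀ a, αS a ^ 4 = 1) (hαP : ∀ b, αP b ^ 4 = 1)
    (hidx : ∀ b, idx b + 2 ≤ r) (hst : ∀ a, (steinberg r (αS a)).IsHom B (st a))
    (hpr : ∀ b, (proj r (idx b) (αP b)).IsHom B (pr b))
    (hsoc : ∀ (p : ιS → ℂ) (ξ η : ιP → ℂ), ∑ a, p a • st a (u r 0) +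
      ∑ b, (ξ b • pr b (wS r (idx b) 0) + η b • pr b (wR r (idx b) 0)) = 0 →
      (∀ a, p a = 0) ∧ ∀ b, ξ b = 0 ∧ η b = 0)
    {w : ιS → V r} {w' : ∀ b, P r (idx b)} (h : ∑ a, st a (w a) + ∑ b, pr b (w' b) = 0) :
    w = 0 ∧ w' = 0 := by
  have key : ∀ s : ℕ, ∀ (w : ιS → V r) (w' : ∀ b, P r (idx b)),
      ∑ a, st a (w a) + ∑ b, pr b (w' b) = 0 → (∀ a, ((steinberg r (αS a)).E ^ s) (w a) = 0) →
      (∀ b, ((proj r (idx b) (αP b)).E ^ s) (w' b) = 0) → w = 0 ∧ w' = 0 := by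
    intro s
    induction s with
    | zero => exact fun w w' _ h1 h2 => ⟨funext h1, funext h2⟩
    | succ s ih =>
      intro w w' h h1 h2
      obtain ⟨h3, h4⟩ := ih (fun a => (steinberg r (αS a)).E (w a))
        (fun b => (proj r (idx b) (αP b)).E (w' b)) (by
          simp only [(hst _).map_E, (hpr _).map_E]
          rw [← map_sum, ← map_sum, ← map_add, h, map_zero])
        (fun a => by rw [← Module.End.mul_apply, ← pow_succ]; exact h1 a)
        (fun b => by rw [← Module.End.mul_apply, ← pow_succ]; exact h2 b)
      have h5 : ∀ a, w a = w a ⟨0, by omega⟩ • u r 0 := by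
        intro a
        refine steinberg_ker_FE_sq hr (hαS a) ?_
        have h3' : (steinberg r (αS a)).E (w a) = 0 := congr_fun h3 a
        rw [h3', map_zero, map_zero, map_zero]
      have h6 : ∀ b, w' b = w' b (.S 0) • wS r (idx b) 0 + w' b (.R 0) • wR r (idx b) 0 :=
        fun b => proj_ker_E (hidx b) (hαP b) (congr_fun h4 b)
      have h7 := hsoc (fun a => w a ⟨0, by omega⟩) (fun b => w' b (.S 0)) (fun b => w' b (.R 0)) (by
        rw [← h]
        congr 1
        · exact Finset.sum_congr rfl fun a _ => by rw [← map_smul, ← h5]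
        · exact Finset.sum_congr rfl fun b _ => by rw [← map_smul, ← map_smul, ← map_add, ← h6])
      refine ⟨funext fun a => ?_, funext fun b => ?_⟩
      · rw [h5, h7.1, zero_smul]; rfl
      · rw [h6, (h7.2 b).1, (h7.2 b).2, zero_smul, zero_smul, add_zero]; rfl
  refine key (2 * r) w w' h (fun a => ?_) fun b => ?_
  · rw [pow_eq_zero_of_le (by omega) (steinberg_E_pow r (αS a)), LinearMap.zero_apply]
  · rw [proj_E_pow (hidx b), LinearMap.zero_apply]

lemma injective_of_eq_zero
    (h : ∀ (w : ιS → V r) (w' : ∀ b, P r (idx b)), ∑ a, st a (w a) + ∑ b, pr b (w' b) = 0 →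
      w = 0 ∧ w' = 0) :
    (∀ a, Function.Injective (st a)) ∧ (∀ b, Function.Injective (pr b)) ∧
      iSupIndep (Sum.elim (fun a => LinearMap.range (st a)) fun b => LinearMap.range (pr b)) := by
  classical
  refine ⟨fun a => (injective_iff_map_eq_zero _).2 fun x hx => ?_,
    fun b => (injective_iff_map_eq_zero _).2 fun x hx => ?_, ?_⟩
  · have := (h (Pi.single a x) 0 (by
      rw [Finset.sum_eq_single a (fun a' _ ha' => by rw [Pi.single_eq_of_ne ha', map_zero])
        (fun h => absurd (Finset.mem_univ a) h), Pi.single_eq_same, hx]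
      simp)).1
    simpa using congr_fun this a
  · have := (h 0 (Pi.single b x) (by
      rw [Finset.sum_eq_single (s := Finset.univ) (f := fun b' => pr b' _) b
        (fun b' _ hb' => by rw [Pi.single_eq_of_ne hb', map_zero])
        (fun h => absurd (Finset.mem_univ b) h), Pi.single_eq_same, hx]
      simp)).2
    simpa using congr_fun this b
  · rw [iSupIndep_iff_finsetSum_eq_zero_imp_eq_zero]
    intro s v hv h0
    have hv' : ∀ c, (if c ∈ s then v c else 0) ∈
        Sum.elim (fun a => LinearMap.range (st a)) (fun b => LinearMap.range (pr b)) c := by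
      intro c
      split_ifs with hc
      exacts [hv c hc, zero_mem _]
    choose w hw using fun a => hv' (Sum.inl a)
    choose w' hw' using fun b => hv' (Sum.inr b)
    have h1 := h w w' (by
      rw [Finset.sum_congr rfl fun a _ => hw a, Finset.sum_congr rfl fun b _ => hw' b,
        ← Fintype.sum_sum_type (fun c => if c ∈ s then v c else 0)]
      simpa using h0)
    rintro (a | b) hc
    · have := hw a
      rw [if_pos hc, h1.1] at this
      rw [← this]
      exact map_zero (st a)
    · have := hw' b
      rw [if_pos hc, h1.2] at this
      rw [← this]
      exact map_zero (pr b)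

end Summands

end

/-! ### Independence of the kernels of E and existence of a decomposition -/

section

namespace WeightSystem

variable {r n : ℕ} {M : Type*} [AddCommGroup M] [Module ℂ M] {W : WeightSystem r n M}

lemma π_sum {ι : Type*} [Fintype ι] {v : ι → M} {lev : ι → ℤ} (hv : ∀ b, v b ∈ W.L (lev b))
    (c : ι → ℂ) (m : ℤ) :
    W.π m (∑ b, c b • v b) = ∑ b, (if lev b = m then c b else 0) • v b := by
  rw [map_sum]
  refine Finset.sum_congr rfl fun b _ => ?_
  rw [map_smul]
  split_ifs with h
  · rw [W.π_apply (h ▸ hv b)]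
  · rw [W.π_apply_of_ne h (hv b), smul_zero, zero_smul]

/-- The three sums are the images of u_0, w_0^S (up to a scalar) and w_0^R. Socle vectors at a level
may meet vectors w_0^R of heads one wall above, so the coefficients η are treated first. Afterwards
the wall distinguishes the levels of y from those of x. -/
lemma socle_independent (hr : 2 ≤ r) {ιS ιP : Type*} [Fintype ιS] [Fintype ιP] {y : ιS → M}
    {x : ιP → M} {lS : ιS → ℤ} {lP : ιP → ℤ} {X : ℤ → Submodule ℂ M} (hXA : ∀ l, X l ≤ W.A l)
    (hX0 : ∀ l, ∀ x ∈ X l, W.F (W.E x) = 0 → x = 0) (hy : ∀ a, y a ∈ W.L (lS a))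
    (hx : ∀ b, x b ∈ X (lP b)) (hlS : ∀ a, wall r n (lS a) = 0) (hlP : ∀ b, wall r n (lP b) ≠ 0)
    (hyi : LinearIndependent ℂ y) (hxi : LinearIndependent ℂ x) (p : ιS → ℂ) (ξ η : ιP → ℂ)
    (h : ∑ a, p a • y a + (∑ b, ξ b • W.F (W.E (x b)) +
      ∑ b, η b • (W.E ^ (r - wall r n (lP b))) (x b)) = 0) :
    (∀ a, p a = 0) ∧ ∀ b, ξ b = 0 ∧ η b = 0 := by
  classical
  have hr1 : 1 ≤ r := by omega
  have hxA : ∀ b, x b ∈ W.A (lP b) := fun b => hXA _ (hx b)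
  have hxL : ∀ b, x b ∈ W.L (lP b) := fun b => (mem_A.1 (hxA b)).1
  have hsum : ∀ (c : ιP → ℂ) (m : ℤ),
      ∑ b, (if lP b = m then c b else 0) • x b ∈ X m := fun c m =>
    Submodule.sum_mem _ fun b _ => by
      split_ifs with hb
      · exact Submodule.smul_mem _ _ (hb ▸ hx b)
      · rw [zero_smul]; exact zero_mem _
  have hFE : ∀ (c : ιP → ℂ), ∑ b, c b • W.F (W.E (x b)) = W.F (W.E (∑ b, c b • x b)) := by
    intro c
    rw [map_sum, map_sum]
    exact Finset.sum_congr rfl fun b _ => by rw [map_smul, map_smul]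
  have hη : ∀ b, η b = 0 := by
    intro b₀
    have hw := wall_lt (n := n) hr1 (lP b₀)
    have hw2 := wall_sub_wall (hlP b₀) hr1
    set w₀ := wall r n (lP b₀) with hw₀
    set m := lP b₀ - (r - w₀ : ℕ) with hm
    have h1 := congr_arg (W.π m) h
    rw [map_add, map_add, π_sum hy, π_sum (fun b => FE_mem (hxL b)),
      π_sum (fun b => E_pow_mem _ (hxL b)), map_zero, hFE] at h1
    have h2 : ∑ a, (if lS a = m then p a else 0) • y a = 0 :=
      Finset.sum_eq_zero fun a _ => by
        rw [if_neg, zero_smul]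
        intro ha
        have := hlS a
        rw [ha, hw2] at this
        omega
    have h3 : ∑ b, (if lP b - (r - wall r n (lP b) : ℕ) = m then η b else 0) •
        (W.E ^ (r - wall r n (lP b))) (x b) =
        (W.E ^ (r - w₀)) (∑ b, (if lP b = lP b₀ then η b else 0) • x b) := by
      rw [map_sum]
      refine Finset.sum_congr rfl fun b _ => ?_
      rw [map_smul]
      by_cases hb : lP b = lP b₀
      · rw [if_pos hb, hb, if_pos rfl]
      · rw [if_neg hb, if_neg, zero_smul, zero_smul]
        intro hb'
        have hwb := wall_lt (n := n) hr1 (lP b)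
        have h4 := wall_sub_wall (hlP b) hr1
        rw [hb', hw2] at h4
        refine hb ?_
        rw [hm, h4] at hb'
        omega
    rw [h2, h3, zero_add] at h1
    -- At level m the wall is r - w₀, so this power of F kills the image of FE. On the other sum it
    -- completes E^(r-w₀) to a nonzero multiple of FE at level `lP b₀`, which is injective on X.
    have h4 := congr_arg (W.F ^ (r - w₀)) h1
    have h5 := F_pow_FE hr (hXA _ (hsum ξ m))
    rw [hw2] at h5
    obtain ⟨a, ha, h6⟩ := W.exists_down_up hr (lP b₀)
    rw [map_add, h5, zero_add, map_zero, h6 _ (hXA _ (hsum η _)), smul_eq_zero, or_iff_right ha]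
      at h4
    have h7 := Fintype.linearIndependent_iff.1 hxi _ (hX0 _ _ (hsum η _) h4) b₀
    simpa using h7
  have h0 : ∑ a, p a • y a + ∑ b, ξ b • W.F (W.E (x b)) = 0 := by
    simpa [hη] using h
  refine ⟨fun a₀ => ?_, fun b₀ => ⟨?_, hη b₀⟩⟩
  · have h1 := congr_arg (W.π (lS a₀)) h0
    rw [map_add, π_sum hy, π_sum (fun b => FE_mem (hxL b)), map_zero, Finset.sum_eq_zero
      (s := Finset.univ) (f := fun b => (if lP b = lS a₀ then ξ b else 0) • W.F (W.E (x b)))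
      (fun b _ => by
        rw [if_neg, zero_smul]
        intro hb
        exact hlP b (hb ▸ hlS a₀)), add_zero] at h1
    simpa using Fintype.linearIndependent_iff.1 hyi _ h1 a₀
  · have h1 := congr_arg (W.π (lP b₀)) h0
    rw [map_add, π_sum hy, π_sum (fun b => FE_mem (hxL b)), map_zero, hFE, Finset.sum_eq_zero
      (s := Finset.univ) (f := fun a => (if lS a = lP b₀ then p a else 0) • y a)
      (fun a _ => by
        rw [if_neg, zero_smul]
        intro ha
        exact hlP b₀ (ha ▸ hlS a)), zero_add] at h1
    simpa using Fintype.linearIndependent_iff.1 hxi _ (hX0 _ _ (hsum ξ _) h1) b₀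

/-- A weight system is a direct sum of indecomposable projective modules with homogeneous
generators. -/
theorem exists_decomposition [Module.Finite ℂ M] (W : WeightSystem r n M) (hr : 2 ≤ r) :
    ∃ (kS kP : ℕ) (lS : Fin kS → ℤ) (lP : Fin kP → ℤ) (αS : Fin kS → ℂ) (αP : Fin kP → ℂ)
      (idx : Fin kP → ℕ) (st : Fin kS → (V r →ₗ[ℂ] M)) (pr : ∀ b, P r (idx b) →ₗ[ℂ] M),
      (∀ a, 0 ≤ lS a) ∧ (∀ b, 0 ≤ lP b) ∧ (∀ a, αS a ^ 4 = 1) ∧ (∀ b, αP b ^ 4 = 1) ∧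
      (∀ b, idx b + 2 ≤ r) ∧ (∀ a, (steinberg r (αS a)).IsHom W.act (st a)) ∧
      (∀ b, (proj r (idx b) (αP b)).IsHom W.act (pr b)) ∧
      ((∀ a, Function.Injective (st a)) ∧ (∀ b, Function.Injective (pr b)) ∧
        iSupIndep (Sum.elim (fun a => LinearMap.range (st a)) fun b => LinearMap.range (pr b))) ∧
      (⨆ c, Sum.elim (fun a => LinearMap.range (st a)) (fun b => LinearMap.range (pr b)) c) = ⊤ ∧
      (∀ a, st a (u r 0) ∈ W.L (lS a)) ∧ ∀ b, pr b (wH r (idx b) 0) ∈ W.L (lP b) := by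
  classical
  have hr1 : 1 ≤ r := by omega
  obtain ⟨X, hXA, hXs, hX0⟩ := W.exists_complement
  -- Levels of wall 0 supply the Steinberg summands from all of A; at the other levels the
  -- complement of the kernel of FE supplies the heads of the summands P_i^α.
  obtain ⟨kS, y, lS, hlS, hy, hyS, hyi⟩ := exists_adapted_basis (W := W)
    ((Finset.Icc (0 : ℤ) (n * ((r : ℤ) - 1))).filter fun l => wall r n l = 0) (Z := W.A)
    (fun l => inf_le_left)
  obtain ⟨kP, x, lP, hlP, hx, hxS, hxi⟩ := exists_adapted_basis (W := W)
    ((Finset.Icc (0 : ℤ) (n * ((r : ℤ) - 1))).filter fun l => wall r n l ≠ 0) (Z := X)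
    (fun l => (hXA l).trans inf_le_left)
  simp only [Finset.mem_filter, Finset.mem_Icc] at hlS hlP hyS hxS
  choose c hc using fun a => W.exists_steinberg hr (hlS a).2
  have hyL : ∀ a, y a ∈ W.L (lS a) := fun a => (mem_A.1 (hy a)).1
  have hxA : ∀ b, x b ∈ W.A (lP b) := fun b => hXA _ (hx b)
  have hidx : ∀ b, wall r n (lP b) = wall r n (lP b) - 1 + 1 := fun b => by
    have := (hlP b).2; omega
  have hidx2 : ∀ b, wall r n (lP b) - 1 + 2 ≤ r := fun b => by
    have := (hlP b).2; have := wall_lt (n := n) hr1 (lP b); omega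
  set st : Fin kS → (V r →ₗ[ℂ] M) := fun a => W.steinbergHom (c a • (W.F ^ (r - 1)) (y a)) with hst
  set pr : ∀ b, P r (wall r n (lP b) - 1) →ₗ[ℂ] M := fun b =>
    W.headHom (lP b) (wall r n (lP b) - 1) (x b) with hpr
  have hst0 : ∀ a, st a (u r 0) = y a := fun a => by
    rw [hst]
    exact (steinbergHom_u _ (by omega)).trans ((hc a (y a) (hy a)).2.1)
  have hpr0 : ∀ b, pr b (wH r _ 0) = x b := fun b => by
    rw [hpr]
    exact (headHom_wH (Nat.zero_le _)).trans (by rw [pow_zero, Module.End.one_apply])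
  have hprS : ∀ b, pr b (wS r _ 0) = wallSign r n (lP b) • W.F (W.E (x b)) := fun b => by
    rw [hpr]
    exact (headHom_wS hr (hidx b) (hxA b) 0).trans (by rw [zero_add, pow_one]; rfl)
  have hprR : ∀ b, pr b (wR r _ 0) = (W.E ^ (r - wall r n (lP b))) (x b) := fun b => by
    rw [hpr]
    refine (headHom_wR (Nat.zero_le _)).trans ?_
    congr 2
    have := hidx2 b; have := hidx b
    omega
  have hsth : ∀ a, (steinberg r (steinbergRoot r n (lS a))).IsHom W.act (st a) := fun a =>
    steinbergHom_isHom hr (hlS a).2 (Submodule.smul_mem _ _ (F_pow_mem _ (hyL a)))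
      (hc a (y a) (hy a)).2.2 (by
        rw [map_smul, ← Module.End.mul_apply, ← pow_succ', F_pow_eq_zero (by omega), smul_zero])
  have hprh : ∀ b, (proj r _ (wallRoot r n (lP b))).IsHom W.act (pr b) := fun b =>
    headHom_isHom hr (hidx b) (hxA b)
  have hαS := fun a => steinbergRoot_pow_four hr1 (hlS a).2
  have hαP := fun b => wallRoot_pow_four (n := n) hr1 (lP b)
  refine ⟨kS, kP, lS, lP, fun a => steinbergRoot r n (lS a), fun b => wallRoot r n (lP b),
    fun b => wall r n (lP b) - 1, st, pr, fun a => (hlS a).1.1, fun b => (hlP b).1.1,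
    hαS, hαP, hidx2, hsth, hprh, ?_, ?_, fun a => ?_, fun b => ?_⟩
  · refine injective_of_eq_zero fun w w' h => eq_zero_of_sum_eq_zero hr hαS hαP hidx2 hsth hprh
      (fun p ξ η h => ?_) h
    simp only [hst0, hprS, hprR, smul_smul, Finset.sum_add_distrib] at h
    obtain ⟨h1, h2⟩ := socle_independent hr hXA hX0 hyL hx (fun a => (hlS a).2)
      (fun b => (hlP b).2) hyi hxi p (fun b => ξ b * wallSign r n (lP b)) η h
    exact ⟨h1, fun b => ⟨(mul_eq_zero.1 (h2 b).1).resolve_right (wallSign_ne_zero _), (h2 b).2⟩⟩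
  · set Q := ⨆ d, Sum.elim (fun a => LinearMap.range (st a)) (fun b => LinearMap.range (pr b)) d
      with hQ
    have hQS : ∀ a v, st a v ∈ Q := fun a v => le_iSup (Sum.elim
      (fun a => LinearMap.range (st a)) (fun b => LinearMap.range (pr b))) (Sum.inl a) ⟨v, rfl⟩
    have hQP : ∀ b v, pr b v ∈ Q := fun b v => le_iSup (Sum.elim
      (fun a => LinearMap.range (st a)) (fun b => LinearMap.range (pr b))) (Sum.inr b) ⟨v, rfl⟩
    have hQE : Q ≤ Q.comap W.E := by
      refine iSup_le ?_
      rintro (a | b) _ ⟨v, rfl⟩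
      · exact Submodule.mem_comap.2 ((hsth a).map_E v ▸ hQS a _)
      · exact Submodule.mem_comap.2 ((hprh b).map_E v ▸ hQP b _)
    have hQF : Q ≤ Q.comap W.F := by
      refine iSup_le ?_
      rintro (a | b) _ ⟨v, rfl⟩
      · exact Submodule.mem_comap.2 ((hsth a).map_F v ▸ hQS a _)
      · exact Submodule.mem_comap.2 ((hprh b).map_F v ▸ hQP b _)
    have hrange : ∀ l, ¬ (0 ≤ l ∧ l ≤ n * ((r : ℤ) - 1)) → W.A l ≤ Q := by
      intro l hl
      refine inf_le_left.trans ?_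
      rw [W.L_eq_bot (by omega)]
      exact bot_le
    refine eq_top_of_stable hr hQE hQF (X := X) (fun l hl => ?_) (fun l hl => ?_) hXA hXs
    · by_cases hl' : 0 ≤ l ∧ l ≤ n * ((r : ℤ) - 1)
      · refine (hyS l ⟨hl', hl⟩).trans (Submodule.span_le.2 ?_)
        rintro _ ⟨a, -, rfl⟩
        exact hst0 a ▸ hQS a _
      · exact hrange l hl'
    · by_cases hl' : 0 ≤ l ∧ l ≤ n * ((r : ℤ) - 1)
      · refine (hxS l ⟨hl', hl⟩).trans (Submodule.span_le.2 ?_)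
        rintro _ ⟨b, -, rfl⟩
        exact hpr0 b ▸ hQP b _
      · exact (hXA l).trans (hrange l hl')
  · exact hst0 a ▸ hyL a
  · exact hpr0 b ▸ (mem_A.1 (hxA b)).1

end WeightSystem

/-! ### Existence of decompositions of tensor powers -/

variable {r n : ℕ}

instance : Module.Finite ℂ (TP r n) := Module.Finite.of_basis (tbasis r n)

/-- The weight system of a tensor power. -/
def tensorWeightSystem (hn : 1 ≤ n) (hr : 2 ≤ r) : WeightSystem r n (TP r n) where
  E := (tensorPower r n).E
  F := (tensorPower r n).F
  k := (tensorPower r n).k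
  cas := casimir r n
  L := Lev r n
  π := levProj r n
  E_mem := E_mem_Lev
  F_mem := F_mem_Lev (by omega)
  k_apply := k_apply_of_mem_Lev
  cas_FE := casimir_eq_FE
  cas_EF := casimir_eq_EF hr
  E_pow := tensorPower_E_pow (by omega)
  F_pow := tensorPower_F_pow (by omega)
  exact_E := tensorPower_E_exact hn hr
  exact_F := tensorPower_F_exact hn hr
  π_mem := levProj_mem
  π_apply := levProj_apply
  π_apply_of_ne h hv := levProj_apply_of_ne h hv
  sum_π := sum_levProj
  L_eq_bot := Lev_eq_bot

theorem nonempty_decomposition (hn : 1 ≤ n) (hr : 2 ≤ r) : Nonempty (Decomposition r n) := by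
  obtain ⟨kS, kP, lS, lP, αS, αP, idx, st, pr, h0S, h0P, hαS, hαP, hidx, hst, hpr, ⟨hi1, hi2, hi3⟩,
    htop, hwS, hwP⟩ := (tensorWeightSystem hn hr).exists_decomposition hr
  refine ⟨⟨kS, kP, αS, hαS, αP, hαP, idx, hidx, st, pr, hst, hpr, hi1, hi2, hi3, htop,
    fun a => ⟨(lS a).toNat, ?_⟩, fun b => ⟨(lP b).toNat, ?_⟩⟩⟩
  · rw [← Lev_natCast, Int.toNat_of_nonneg (h0S a)]
    exact hwS a
  · rw [← Lev_natCast, Int.toNat_of_nonneg (h0P b)]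
    exact hwP b

end

section

namespace WeightSystem

variable {r n : ℕ} {M : Type*} [AddCommGroup M] [Module ℂ M] {W : WeightSystem r n M}

/-! ### Decompositions of weight systems -/

variable (W) in
/-- A decomposition of a weight system into indecomposable projective modules with homogeneous
generators, the generators `u_0` and `w_0^H` of the summands having levels `mS` and `mP`. -/
structure Splitting (ιS ιP : Type*) [Fintype ιS] [Fintype ιP] where
  αS : ιS → ℂ
  αP : ιP → ℂ
  αS_pow : ∀ a, αS a ^ 4 = 1
  αP_pow : ∀ b, αP b ^ 4 = 1
  idx : ιP → ℕ
  idx_le : ∀ b, idx b + 2 ≤ r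
  st : ιS → (V r →ₗ[ℂ] M)
  pr : ∀ b, P r (idx b) →ₗ[ℂ] M
  st_hom : ∀ a, (steinberg r (αS a)).IsHom W.act (st a)
  pr_hom : ∀ b, (proj r (idx b) (αP b)).IsHom W.act (pr b)
  mS : ιS → ℤ
  mP : ιP → ℤ
  st_mem : ∀ a, st a (u r 0) ∈ W.L (mS a)
  pr_mem : ∀ b, pr b (wH r (idx b) 0) ∈ W.L (mP b)
  eq_zero : ∀ (w : ιS → V r) (w' : ∀ b, P r (idx b)),
    ∑ a, st a (w a) + ∑ b, pr b (w' b) = 0 → w = 0 ∧ w' = 0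
  exists_rep : ∀ v, ∃ (w : ιS → V r) (w' : ∀ b, P r (idx b)), v = ∑ a, st a (w a) + ∑ b, pr b (w' b)

namespace Splitting

variable {ιS ιP : Type*} [Fintype ιS] [Fintype ιP] (S : W.Splitting ιS ιP)

lemma pr_E (b : ιP) (w : P r (S.idx b)) :
    S.pr b ((proj r (S.idx b) (S.αP b)).E w) = W.E (S.pr b w) := (S.pr_hom b).map_E w

lemma pr_F (b : ιP) (w : P r (S.idx b)) :
    S.pr b ((proj r (S.idx b) (S.αP b)).F w) = W.F (S.pr b w) := (S.pr_hom b).map_F w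

lemma pr_k (b : ιP) (w : P r (S.idx b)) :
    S.pr b ((proj r (S.idx b) (S.αP b)).k w) = W.k (S.pr b w) := (S.pr_hom b).map_k w

lemma st_E (a : ιS) (w : V r) : S.st a ((steinberg r (S.αS a)).E w) = W.E (S.st a w) :=
  (S.st_hom a).map_E w

lemma st_F (a : ιS) (w : V r) : S.st a ((steinberg r (S.αS a)).F w) = W.F (S.st a w) :=
  (S.st_hom a).map_F w

lemma st_k (a : ιS) (w : V r) : S.st a ((steinberg r (S.αS a)).k w) = W.k (S.st a w) :=
  (S.st_hom a).map_k w

lemma smul_wS (b : ιP) :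
    S.pr b (wS r (S.idx b) 0) = S.αP b ^ 2 • W.F (W.E (S.pr b (wH r (S.idx b) 0))) := by
  have h : S.αP b ^ 2 * S.αP b ^ 2 = 1 := by rw [← S.αP_pow b]; ring
  rw [← pr_E, ← pr_F, proj_FE_wH _ (Nat.zero_le _), gam_zero, zero_smul, zero_add, map_smul,
    smul_smul, h, one_smul]

lemma wS_mem (b : ιP) : S.pr b (wS r (S.idx b) 0) ∈ W.L (S.mP b) := by
  rw [smul_wS]
  exact Submodule.smul_mem _ _ (FE_mem (S.pr_mem b))

/-- E w_0^H = w_{i'}^R, and then E runs down the R chain. This locates w_0^R at r - (i + 1) levels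
below the head. -/
lemma wR_eq (b : ιP) : S.pr b (wR r (S.idx b) 0) =
    (W.E ^ (r - (S.idx b + 1))) (S.pr b (wH r (S.idx b) 0)) := by
  have hi := S.idx_le b
  have h : ∀ s ≤ r - 2 - S.idx b, S.pr b (wR r (S.idx b) (r - 2 - S.idx b - s)) =
      (W.E ^ (s + 1)) (S.pr b (wH r (S.idx b) 0)) := by
    intro s
    induction s with
    | zero =>
      intro _
      rw [zero_add, pow_one, ← pr_E, proj_E_wH _ (Nat.zero_le _), if_pos rfl, Nat.sub_zero]
    | succ s ih =>
      intro hs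
      rw [pow_succ', Module.End.mul_apply, ← ih (by omega), ← pr_E, proj_E_wR _ (by omega),
        if_neg (by omega), Nat.sub_sub (r - 2 - S.idx b)]
  have := h (r - 2 - S.idx b) le_rfl
  rwa [Nat.sub_self, show r - 2 - S.idx b + 1 = r - (S.idx b + 1) by omega] at this

lemma wR_mem (b : ιP) :
    S.pr b (wR r (S.idx b) 0) ∈ W.L (S.mP b - (r - (S.idx b + 1) : ℕ)) := by
  rw [wR_eq]
  exact E_pow_mem _ (S.pr_mem b)

lemma wL_mem (b : ιP) : S.pr b (wL r (S.idx b) 0) ∈ W.L (S.mP b + (S.idx b + 1 : ℕ)) := by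
  have hα : S.αP b ^ 2 ≠ 0 := fun h => by
    have := S.αP_pow b
    rw [show S.αP b ^ 4 = S.αP b ^ 2 * S.αP b ^ 2 by ring, h, zero_mul] at this
    exact zero_ne_one this
  have hH : ∀ m ≤ S.idx b, S.pr b (wH r (S.idx b) m) ∈ W.L (S.mP b + m) := by
    intro m
    induction m with
    | zero => intro _; simpa using S.pr_mem b
    | succ m ih =>
      intro hm
      have h1 := W.F_mem (ih (by omega))
      rw [← pr_F, proj_F_wH _ (by omega), if_neg (by omega), map_smul,
        Submodule.smul_mem_iff _ hα] at h1
      convert h1 using 2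
      push_cast; ring
  have h1 := W.F_mem (hH _ le_rfl)
  rw [← pr_F, proj_F_wH _ le_rfl, if_pos rfl, map_smul, Submodule.smul_mem_iff _ hα] at h1
  convert h1 using 2
  push_cast; ring

lemma linearIndependent_pr {f : ∀ b, P r (S.idx b)} (hf : ∀ b, f b ≠ 0) :
    LinearIndependent ℂ fun b => S.pr b (f b) := by
  rw [Fintype.linearIndependent_iff]
  intro g hg b
  have h := (S.eq_zero 0 (fun b => g b • f b) (by
    simp only [map_smul, hg, Pi.zero_apply, map_zero, Finset.sum_const_zero, add_zero])).2
  exact (smul_eq_zero.1 (congr_fun h b)).resolve_right (hf b)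

lemma wH_zero_ne (i : ℕ) : wH r i 0 ≠ 0 := by
  rw [wH_of_lt (by omega)]; simp

lemma wS_zero_ne (i : ℕ) : wS r i 0 ≠ 0 := by
  rw [wS_of_lt (by omega)]; simp

lemma wR_ne {i m : ℕ} (h : m ≤ r - 2 - i) : wR r i m ≠ 0 := by
  rw [wR_of_lt (by omega)]; simp

lemma u_ne {m : ℕ} (h : m < r) : u r m ≠ 0 := by
  rw [u_of_lt h]; simp

lemma pr_ne_zero (b : ιP) {w : P r (S.idx b)} (hw : w ≠ 0) : S.pr b w ≠ 0 := by
  classical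
  intro h
  have := (S.eq_zero 0 (Pi.single b w) (by
    rw [Finset.sum_eq_single (s := Finset.univ) (f := fun b' => S.pr b' _) b
      (fun b' _ hb' => by rw [Pi.single_eq_of_ne hb', map_zero])
      (fun h => absurd (Finset.mem_univ b) h), Pi.single_eq_same, h]
    simp)).2
  exact hw (by simpa using congr_fun this b)

lemma wS_mem_iff (b : ιP) (l : ℤ) : S.pr b (wS r (S.idx b) 0) ∈ W.L l ↔ S.mP b = l := by
  refine ⟨fun h => ?_, fun h => h ▸ S.wS_mem b⟩
  by_contra hl
  exact S.pr_ne_zero b (wS_zero_ne _) ((W.π_apply h).symm.trans (W.π_apply_of_ne hl (S.wS_mem b)))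

lemma st_ne_zero (a : ιS) {w : V r} (hw : w ≠ 0) : S.st a w ≠ 0 := by
  classical
  intro h
  have := (S.eq_zero (Pi.single a w) 0 (by
    rw [Finset.sum_eq_single a (fun a' _ ha' => by rw [Pi.single_eq_of_ne ha', map_zero])
      (fun h => absurd (Finset.mem_univ a) h), Pi.single_eq_same, h]
    simp)).1
  exact hw (by simpa using congr_fun this a)

/-- The head of a summand `P_i^α` lies at a level at least `r - 1 - i`. -/
lemma le_mP (b : ιP) : ((r - (S.idx b + 1) : ℕ) : ℤ) ≤ S.mP b := by
  by_contra h
  have h1 := S.wR_mem b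
  rw [W.L_eq_bot (Or.inl (by omega)), Submodule.mem_bot] at h1
  exact S.pr_ne_zero b (wR_ne (Nat.zero_le _)) h1

/-- Taking fourth powers removes the root of unity α, and q^(1/2) has order 4r. -/
lemma dvd_of_root {α : ℂ} (hr : 1 ≤ r) (hα : α ^ 4 = 1) {x y : ℤ}
    (h : α * qHalf r ^ x = qHalf r ^ y) : (r : ℤ) ∣ y - x := by
  have h1 : (qHalf r ^ y) ^ 4 = (qHalf r ^ x) ^ 4 := by rw [← h, mul_pow, hα, one_mul]
  rw [← zpow_natCast, ← zpow_natCast, ← zpow_mul, ← zpow_mul, qHalf_zpow_eq_iff hr] at h1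
  obtain ⟨e, he⟩ := h1
  refine ⟨e, ?_⟩
  push_cast at he
  linarith

/-- The eigenvalue of k on the head, known up to a fourth root of unity, determines its weight
modulo r. Consequently all summands with head at the same level have the same index i. -/
lemma wall_mP (b : ιP) : wall r n (S.mP b) = S.idx b + 1 := by
  have hi := S.idx_le b
  have h1 := W.k_apply (S.pr_mem b)
  rw [← pr_k, proj_k_wH _ (Nat.zero_le _), map_smul, map_smul, smul_smul] at h1
  have h2 := dvd_of_root (by omega) (S.αP_pow b)
    (smul_left_injective ℂ (S.pr_ne_zero b (wH_zero_ne _)) h1)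
  refine wall_eq_of_dvd (by omega) ?_
  convert h2 using 1
  push_cast; ring

lemma wall_mS (hr : 1 ≤ r) (a : ιS) : wall r n (S.mS a) = 0 := by
  have h1 := W.k_apply (S.st_mem a)
  rw [← st_k, steinberg_k_u, map_smul] at h1
  have h2 := dvd_of_root hr (S.αS_pow a)
    (smul_left_injective ℂ (S.st_ne_zero a (u_ne (by omega))) h1)
  refine wall_eq_of_dvd (by omega) ?_
  obtain ⟨e, he⟩ := h2
  refine ⟨e + 1, ?_⟩
  push_cast at he ⊢
  linear_combination he

lemma E_wS (b : ιP) : W.E (S.pr b (wS r (S.idx b) 0)) = 0 := by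
  rw [← pr_E, proj_E_wS _ (Nat.zero_le _), if_pos rfl, map_zero]

lemma E_wR (b : ιP) : W.E (S.pr b (wR r (S.idx b) 0)) = 0 := by
  rw [← pr_E, proj_E_wR _ (Nat.zero_le _), if_pos rfl, map_zero]

lemma E_u (hr : 1 ≤ r) (a : ιS) : W.E (S.st a (u r 0)) = 0 := by
  rw [← st_E, steinberg_E_u _ _ (by omega), if_pos rfl, map_zero]

lemma wH_mem_A {b : ιP} : S.pr b (wH r (S.idx b) 0) ∈ W.A (S.mP b) := by
  refine mem_A.2 ⟨S.pr_mem b, ?_⟩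
  rw [← pr_E, ← pr_F, proj_FE_wH _ (Nat.zero_le _), gam_zero, zero_smul, zero_add, map_smul,
    map_smul, E_wS, smul_zero, map_zero]

/-- Below level `r`, the kernel of `(F E)^2` is the sum of the kernel of `E` and the span of the
dominant head vectors. -/
lemma exists_head (hr : 2 ≤ r) {l : ℤ} (hl : l < r) {v : M} (hv : v ∈ W.A l) :
    ∃ y ∈ W.L l, W.E y = 0 ∧ ∃ c : ιP → ℂ,
      v = y + ∑ b, (if S.mP b = l then c b else 0) • S.pr b (wH r (S.idx b) 0) := by
  classical
  obtain ⟨w, w', hw⟩ := S.exists_rep v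
  rw [mem_A] at hv
  have h0 := hv.2
  rw [hw] at h0
  simp only [map_add, map_sum, ← pr_E, ← st_E, ← pr_F, ← st_F] at h0
  obtain ⟨h1, h2⟩ := S.eq_zero _ _ h0
  have h3 : ∀ a, S.st a (w a) = w a ⟨0, by omega⟩ • S.st a (u r 0) := fun a => by
    rw [← map_smul, ← steinberg_ker_FE_sq hr (S.αS_pow a) (congr_fun h1 a)]
  have h4 : ∀ b, S.pr b (w' b) = w' b (.H 0) • S.pr b (wH r (S.idx b) 0) +
      w' b (.S 0) • S.pr b (wS r (S.idx b) 0) + w' b (.L 0) • S.pr b (wL r (S.idx b) 0) +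
      w' b (.R 0) • S.pr b (wR r (S.idx b) 0) := fun b => by
    rw [← map_smul, ← map_smul, ← map_smul, ← map_smul, ← map_add, ← map_add, ← map_add,
      ← proj_ker_FE_sq (S.idx_le b) (S.αP_pow b) (congr_fun h2 b)]
  have h5 := W.π_apply hv.1
  -- Project to level l. The vectors w_0^L disappear: their level is i + 1 above the head, hence at
  -- least r by `le_mP`, while l < r.
  rw [hw, Finset.sum_congr rfl fun a _ => h3 a, Finset.sum_congr rfl fun b _ => h4 b,
    Finset.sum_add_distrib, Finset.sum_add_distrib, Finset.sum_add_distrib, map_add, map_add,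
    map_add, map_add, π_sum S.st_mem, π_sum S.pr_mem, π_sum S.wS_mem, π_sum S.wL_mem,
    π_sum S.wR_mem, Finset.sum_eq_zero (s := Finset.univ) (f := fun b =>
      (if S.mP b + (S.idx b + 1 : ℕ) = l then w' b (.L 0) else 0) • S.pr b (wL r (S.idx b) 0))
      (fun b _ => by
        have := S.le_mP b
        have := S.idx_le b
        rw [if_neg (by omega), zero_smul]), add_zero] at h5
  refine ⟨∑ a, (if S.mS a = l then w a ⟨0, by omega⟩ else 0) • S.st a (u r 0) +
    (∑ b, (if S.mP b = l then w' b (.S 0) else 0) • S.pr b (wS r (S.idx b) 0) +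
      ∑ b, (if S.mP b - (r - (S.idx b + 1) : ℕ) = l then w' b (.R 0) else 0) •
        S.pr b (wR r (S.idx b) 0)), ?_, ?_, fun b => w' b (.H 0), ?_⟩
  · have smul_mem : ∀ {m : ℤ} {x : M} {c : ℂ}, x ∈ W.L m → (if m = l then c else 0) • x ∈ W.L l := by
      intro m x c hx
      split_ifs with h
      · exact Submodule.smul_mem _ _ (h ▸ hx)
      · rw [zero_smul]; exact Submodule.zero_mem _
    exact Submodule.add_mem _ (Submodule.sum_mem _ fun a _ => smul_mem (S.st_mem a))
      (Submodule.add_mem _ (Submodule.sum_mem _ fun b _ => smul_mem (S.wS_mem b))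
        (Submodule.sum_mem _ fun b _ => smul_mem (S.wR_mem b)))
  · simp only [map_add, map_sum, map_smul, S.E_u (by omega), E_wS, E_wR, smul_zero,
      Finset.sum_const_zero, add_zero]
  · have h6 := hw
    rw [Finset.sum_congr rfl fun a _ => h3 a, Finset.sum_congr rfl fun b _ => h4 b,
      Finset.sum_add_distrib, Finset.sum_add_distrib, Finset.sum_add_distrib, ← h5] at h6
    rw [h6]
    abel

/-- The vectors of the kernel of `E` at the level `l - (r - wall l)` are spanned by the images of
the vectors `w_0^R` of the summands `P_i^α` with head at level `l`. -/
lemma exists_rep_of_E_eq_zero (hr : 2 ≤ r) {l : ℤ} (hl : l < r) (hw0 : wall r n l ≠ 0) {v : M}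
    (hv : v ∈ W.L (l - (r - wall r n l : ℕ))) (hE : W.E v = 0) :
    ∃ c : ιP → ℂ, v = ∑ b, (if S.mP b = l then c b else 0) • S.pr b (wR r (S.idx b) 0) := by
  classical
  obtain ⟨w, w', hw⟩ := S.exists_rep v
  have hlt := wall_lt (n := n) (show 1 ≤ r by omega) l
  have hwall := wall_sub_wall hw0 (by omega)
  rw [hw] at hE
  simp only [map_add, map_sum, ← pr_E, ← st_E] at hE
  obtain ⟨h1, h2⟩ := S.eq_zero _ _ hE
  have h3 : ∀ a, S.st a (w a) = w a ⟨0, by omega⟩ • S.st a (u r 0) := fun a => by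
    rw [← map_smul, ← steinberg_ker_FE_sq hr (S.αS_pow a) (by
      rw [show (steinberg r (S.αS a)).E (w a) = 0 from congr_fun h1 a]; simp)]
  have h4 : ∀ b, S.pr b (w' b) = w' b (.S 0) • S.pr b (wS r (S.idx b) 0) +
      w' b (.R 0) • S.pr b (wR r (S.idx b) 0) := fun b => by
    rw [← map_smul, ← map_smul, ← map_add,
      ← proj_ker_E (S.idx_le b) (S.αP_pow b) (congr_fun h2 b)]
  rw [Finset.sum_congr rfl fun a _ => h3 a, Finset.sum_congr rfl fun b _ => h4 b,
    Finset.sum_add_distrib] at hw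
  have h5 := W.π_apply hv
  rw [hw, map_add, map_add, π_sum S.st_mem, π_sum S.wS_mem, π_sum S.wR_mem, ← hw] at h5
  -- Steinberg generators need wall 0, but the wall at this level is r - `wall r n l`, which is
  -- positive.
  have h6 : ∀ a, S.mS a ≠ l - (r - wall r n l : ℕ) := fun a h => by
    have := S.wall_mS (by omega) a
    rw [h] at this
    omega
  -- A head, and with it a socle vector, at this level would have i + 1 = r - d with d the wall of
  -- l. Then its level is at least d by `le_mP`, which forces l ≥ r.
  have h7 : ∀ b, S.mP b ≠ l - (r - wall r n l : ℕ) := fun b h => by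
    have h1 := S.wall_mP b
    have h2 := S.le_mP b
    rw [h] at h1 h2
    omega
  simp only [h6, h7, if_false, zero_smul, Finset.sum_const_zero, zero_add] at h5
  refine ⟨fun b => w' b (.R 0), ?_⟩
  rw [← h5]
  refine Finset.sum_congr rfl fun b _ => ?_
  congr 1
  -- A vector w_0^R at this level determines its index through the wall, and hence the level of its
  -- head.
  refine if_congr ⟨fun h => ?_, fun h => ?_⟩ rfl rfl
  · have h1 := S.wall_mP b
    have h2 := wall_sub_wall (r := r) (n := n) (l := S.mP b) (by omega) (by omega)
    rw [h1, h, hwall] at h2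
    have := S.idx_le b
    omega
  · rw [← S.wall_mP b, h]

lemma wR_mem_of_eq {b : ιP} {l : ℤ} (h : S.mP b = l) :
    S.pr b (wR r (S.idx b) 0) ∈ W.L (l - (r - wall r n l : ℕ)) := by
  have := S.wR_mem b
  rwa [← S.wall_mP b, h] at this

variable (l : ℤ)

/-- The span of the dominant head vectors at level `l`. -/
def headSpan : Submodule ℂ M :=
  Submodule.span ℂ (Set.range fun b : {b // S.mP b = l} => S.pr b (wH r (S.idx b) 0))

/-- The span of the socle highest weight vectors at level `l`. -/
def socleSpan : Submodule ℂ M :=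
  Submodule.span ℂ (Set.range fun b : {b // S.mP b = l} => S.pr b (wS r (S.idx b) 0))

lemma finrank_span_pr {f : ∀ b, P r (S.idx b)} (hf : ∀ b, f b ≠ 0) :
    Module.finrank ℂ (Submodule.span ℂ (Set.range fun b : {b // S.mP b = l} => S.pr b (f b))) =
      Fintype.card {b // S.mP b = l} :=
  finrank_span_eq_card ((S.linearIndependent_pr hf).comp _ Subtype.val_injective)

lemma finrank_headSpan : Module.finrank ℂ (S.headSpan l) = Module.finrank ℂ (S.socleSpan l) :=
  (S.finrank_span_pr l fun _ => wH_zero_ne _).trans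
    (S.finrank_span_pr l fun _ => wS_zero_ne _).symm

lemma sum_ite_mem_span {f : ∀ b, P r (S.idx b)} (c : ιP → ℂ) :
    ∑ b, (if S.mP b = l then c b else 0) • S.pr b (f b) ∈
      Submodule.span ℂ (Set.range fun b : {b // S.mP b = l} => S.pr b (f b)) := by
  refine Submodule.sum_mem _ fun b _ => ?_
  split_ifs with h
  · exact Submodule.smul_mem _ _ (Submodule.subset_span
      (Set.mem_range_self (f := fun b : {b // S.mP b = l} => S.pr b (f b)) ⟨b, h⟩))
  · rw [zero_smul]; exact Submodule.zero_mem _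

/-- The heads at level l and the vectors w_0^R of the same summands are equinumerous and
independent, and the latter span the kernel of E at the lower level. -/
lemma finrank_headSpan_eq (hr : 2 ≤ r) {l : ℤ} (hl : l < r) (hw0 : wall r n l ≠ 0) :
    Module.finrank ℂ (S.headSpan l) =
      Module.finrank ℂ (LinearMap.ker W.E ⊓ W.L (l - (r - wall r n l : ℕ)) : Submodule ℂ M) := by
  have h : (LinearMap.ker W.E ⊓ W.L (l - (r - wall r n l : ℕ)) : Submodule ℂ M) =
      Submodule.span ℂ (Set.range fun b : {b // S.mP b = l} => S.pr b (wR r (S.idx b) 0)) := by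
    refine le_antisymm (fun v hv => ?_) (Submodule.span_le.2 ?_)
    · obtain ⟨c, hc⟩ := S.exists_rep_of_E_eq_zero hr hl hw0 hv.2 hv.1
      rw [hc]
      exact S.sum_ite_mem_span l (f := fun b => wR r (S.idx b) 0) c
    · rintro _ ⟨⟨b, hb⟩, rfl⟩
      exact ⟨S.E_wR b, S.wR_mem_of_eq hb⟩
  rw [h]
  exact (S.finrank_span_pr l fun _ => wH_zero_ne _).trans
    (S.finrank_span_pr l fun _ => wR_ne (Nat.zero_le _)).symm

/-- E sends the heads to the vectors w_{i'}^R of distinct summands, which are independent. -/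
lemma disjoint_headSpan : Disjoint (LinearMap.ker W.E ⊓ W.L l) (S.headSpan l) := by
  classical
  rw [Submodule.disjoint_def]
  intro v hv hv'
  obtain ⟨c, rfl⟩ := (Submodule.mem_span_range_iff_exists_fun ℂ).1 hv'
  have h1 := (S.linearIndependent_pr (f := fun b => wR r (S.idx b) (r - 2 - S.idx b))
    fun b => wR_ne le_rfl).comp (Subtype.val : {b // S.mP b = l} → ιP) Subtype.val_injective
  have h2 : c = 0 := by
    refine funext (Fintype.linearIndependent_iff.1 h1 c ?_)
    rw [← show W.E _ = 0 from hv.1, map_sum]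
    refine Finset.sum_congr rfl fun b _ => ?_
    rw [map_smul, ← pr_E, proj_E_wH _ (Nat.zero_le _), if_pos rfl]
    rfl
  simp [h2]

lemma sup_headSpan (hr : 2 ≤ r) {l : ℤ} (hl : l < r) :
    LinearMap.ker W.E ⊓ W.L l ⊔ S.headSpan l = W.A l := by
  refine le_antisymm (sup_le (fun v hv => ?_) (Submodule.span_le.2 ?_)) fun v hv => ?_
  · rw [mem_A, show W.E v = 0 from hv.1]
    exact ⟨hv.2, by simp⟩
  · rintro _ ⟨⟨b, rfl⟩, rfl⟩
    exact S.wH_mem_A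
  · obtain ⟨y, hy, hE, c, rfl⟩ := S.exists_head hr hl hv
    exact Submodule.add_mem_sup ⟨hE, hy⟩
      (S.sum_ite_mem_span l (f := fun b => wH r (S.idx b) 0) c)

end Splitting

end WeightSystem

end

/-! ### Transfer to tensor powers and the final count -/

section

variable {r n : ℕ}

section DirectSum

variable {M ι : Type*} [AddCommGroup M] [Module ℂ M] [Fintype ι] {p : ι → Submodule ℂ M}

lemma eq_zero_of_iSupIndep (hp : iSupIndep p) {x : ι → M} (hx : ∀ i, x i ∈ p i)
    (h : ∑ i, x i = 0) (i : ι) : x i = 0 := by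
  classical
  refine (Submodule.disjoint_def.1 (hp i)) _ (hx i) ?_
  rw [← Finset.add_sum_erase _ _ (Finset.mem_univ i)] at h
  rw [eq_neg_of_add_eq_zero_left h]
  refine Submodule.neg_mem _ (Submodule.sum_mem _ fun j hj => ?_)
  exact Submodule.mem_iSup_of_mem j (Submodule.mem_iSup_of_mem (Finset.ne_of_mem_erase hj) (hx j))

lemma exists_sum_of_iSup_eq_top (hp : (⨆ i, p i) = ⊤) (v : M) :
    ∃ x : ι → M, (∀ i, x i ∈ p i) ∧ v = ∑ i, x i := by
  obtain ⟨f, hf, hv⟩ := (Submodule.mem_iSup_iff_exists_finsupp p v).1 (hp ▸ Submodule.mem_top)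
  exact ⟨f, hf, by rw [← hv, Finsupp.sum_fintype _ _ fun _ => rfl]⟩

variable {ιS ιP : Type*} [Fintype ιS] [Fintype ιP] {NS : ιS → Type*} {NP : ιP → Type*}
  [∀ a, AddCommGroup (NS a)] [∀ a, Module ℂ (NS a)] [∀ b, AddCommGroup (NP b)]
  [∀ b, Module ℂ (NP b)] {f : ∀ a, NS a →ₗ[ℂ] M} {g : ∀ b, NP b →ₗ[ℂ] M}

lemma eq_zero_of_iSupIndep_range (hf : ∀ a, Function.Injective (f a))
    (hg : ∀ b, Function.Injective (g b))
    (hp : iSupIndep (Sum.elim (fun a => LinearMap.range (f a)) fun b => LinearMap.range (g b)))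
    (w : ∀ a, NS a) (w' : ∀ b, NP b) (h : ∑ a, f a (w a) + ∑ b, g b (w' b) = 0) :
    w = 0 ∧ w' = 0 := by
  have h1 := eq_zero_of_iSupIndep hp (x := Sum.elim (fun a => f a (w a)) fun b => g b (w' b))
    (by rintro (a | b) <;> exact LinearMap.mem_range_self _ _) (by rw [Fintype.sum_sum_type]; exact h)
  exact ⟨funext fun a => hf a ((h1 (.inl a)).trans (map_zero _).symm),
    funext fun b => hg b ((h1 (.inr b)).trans (map_zero _).symm)⟩

lemma exists_sum_of_iSup_range_eq_top
    (hp : (⨆ c, Sum.elim (fun a => LinearMap.range (f a)) (fun b => LinearMap.range (g b)) c) = ⊤)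
    (v : M) : ∃ (w : ∀ a, NS a) (w' : ∀ b, NP b), v = ∑ a, f a (w a) + ∑ b, g b (w' b) := by
  obtain ⟨x, hx, rfl⟩ := exists_sum_of_iSup_eq_top hp v
  choose w hw using fun a => LinearMap.mem_range.1 (hx (.inl a))
  choose w' hw' using fun b => LinearMap.mem_range.1 (hx (.inr b))
  exact ⟨w, w', by simp only [Fintype.sum_sum_type, hw, hw']⟩

end DirectSum

namespace Decomposition

variable (𝒟 : Decomposition r n)

/-- The level of the generator of a summand `P_i^α`. -/
def level (b : Fin 𝒟.numPr) : ℕ := (𝒟.pr_weight b).choose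

/-- The splitting of the weight system of a tensor power given by a decomposition. -/
def splitting (hn : 1 ≤ n) (hr : 2 ≤ r) : (tensorWeightSystem (n := n) hn hr).Splitting (Fin 𝒟.numSt) (Fin 𝒟.numPr) where
  αS := 𝒟.αSt
  αP := 𝒟.αPr
  αS_pow := 𝒟.αSt_pow
  αP_pow := 𝒟.αPr_pow
  idx := 𝒟.idx
  idx_le := 𝒟.idx_le
  st := 𝒟.st
  pr := 𝒟.pr
  st_hom := 𝒟.st_hom
  pr_hom := 𝒟.pr_hom
  mS a := ((𝒟.st_weight a).choose : ℕ)
  mP b := (𝒟.level b : ℕ)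
  st_mem a := by
    have := (𝒟.st_weight a).choose_spec
    rwa [← Lev_natCast] at this
  pr_mem b := by
    have := (𝒟.pr_weight b).choose_spec
    rwa [← Lev_natCast] at this
  eq_zero w w' h := eq_zero_of_iSupIndep_range 𝒟.st_inj 𝒟.pr_inj 𝒟.indep w w' h
  exists_rep v := exists_sum_of_iSup_range_eq_top 𝒟.spans v

lemma Lev_eq (hn : 1 ≤ n) (hr : 2 ≤ r) (l : ℕ) : (tensorWeightSystem (n := n) hn hr).L l = strongWeightSpace r n l :=
  Lev_natCast l

lemma wS_mem_iff (hn : 1 ≤ n) (hr : 2 ≤ r) (b : Fin 𝒟.numPr) (l : ℕ) :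
    𝒟.pr b (wS r (𝒟.idx b) 0) ∈ strongWeightSpace r n l ↔ (𝒟.splitting hn hr).mP b = l := by
  rw [← Lev_eq hn hr]
  exact (𝒟.splitting hn hr).wS_mem_iff b l

lemma socleSpace_eq (hn : 1 ≤ n) (hr : 2 ≤ r) (l : ℕ) : 𝒟.socleSpace l = (𝒟.splitting hn hr).socleSpan l := by
  refine le_antisymm (Submodule.span_le.2 ?_) (Submodule.span_le.2 ?_)
  · rintro _ ⟨b, hb, rfl⟩
    exact Submodule.subset_span ⟨⟨b, (𝒟.wS_mem_iff hn hr b l).1 hb⟩, rfl⟩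
  · rintro _ ⟨⟨b, hb⟩, rfl⟩
    exact Submodule.subset_span ⟨b, (𝒟.wS_mem_iff hn hr b l).2 hb, rfl⟩

lemma socleSpace_le (l : ℕ) : 𝒟.socleSpace l ≤ strongWeightSpace r n l :=
  Submodule.span_le.2 (by rintro _ ⟨b, hb, rfl⟩; exact hb)

lemma headSpace_eq (hn : 1 ≤ n) (hr : 2 ≤ r) (l : ℕ) : 𝒟.headSpace l = (𝒟.splitting hn hr).headSpan l := by
  refine le_antisymm (Submodule.span_le.2 ?_) (Submodule.span_le.2 ?_)
  · rintro _ ⟨b, hb, rfl⟩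
    exact Submodule.subset_span ⟨⟨b, (𝒟.wS_mem_iff hn hr b l).1 (𝒟.socleSpace_le l hb)⟩, rfl⟩
  · rintro _ ⟨⟨b, hb⟩, rfl⟩
    exact Submodule.subset_span
      ⟨b, Submodule.subset_span ⟨b, (𝒟.wS_mem_iff hn hr b l).2 hb, rfl⟩, rfl⟩

lemma finrank_headSpace (hn : 1 ≤ n) (hr : 2 ≤ r) (l : ℕ) :
    Module.finrank ℂ (𝒟.headSpace l) = Module.finrank ℂ (𝒟.socleSpace l) := by
  rw [𝒟.headSpace_eq hn hr, 𝒟.socleSpace_eq hn hr]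
  exact (𝒟.splitting hn hr).finrank_headSpan l

lemma disjoint_headSpace (hn : 1 ≤ n) (hr : 2 ≤ r) (l : ℕ) : Disjoint (Wspace r n l) (𝒟.headSpace l) := by
  rw [𝒟.headSpace_eq hn hr, Wspace, ← Lev_natCast]
  exact (𝒟.splitting hn hr).disjoint_headSpan l

lemma sup_headSpace (hn : 1 ≤ n) (hr : 2 ≤ r) {l : ℕ} (hl : l < r) :
    Wspace r n l ⊔ 𝒟.headSpace l = Nspace r n l := by
  rw [𝒟.headSpace_eq hn hr, Wspace, ← Lev_natCast]
  refine ((𝒟.splitting hn hr).sup_headSpan hr (by exact_mod_cast hl)).trans ?_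
  ext v
  rw [WeightSystem.mem_A, mem_Nspace, Lev_eq, and_comm]
  rfl

lemma finrank_headSpace_eq (hn : 1 ≤ n) (hr : 2 ≤ r) {l : ℕ} (hl : l < r)
    (hw : wall r n l ≠ 0) (hle : r - wall r n l ≤ l) : Module.finrank ℂ (𝒟.headSpace l) =
      Module.finrank ℂ (Wspace r n (l - (r - wall r n l))) := by
  rw [𝒟.headSpace_eq hn hr, Wspace, ← Lev_natCast, Nat.cast_sub hle]
  exact (𝒟.splitting hn hr).finrank_headSpan_eq hr (by exact_mod_cast hl) hw

end Decomposition

lemma Wspace_le_Nspace (l : ℕ) : Wspace r n l ≤ Nspace r n l := fun v hv => by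
  rw [mem_Wspace] at hv
  rw [mem_Nspace, hv.1]
  exact ⟨by simp only [map_zero], hv.2⟩

/-- Modulo r the weight plus one is -n - 2l + 1, hence -j - 1. So the distance down to the next wall
is j + 1, and l' is that wall. -/
lemma wall_eq_of_modEq (hr : 1 ≤ r) {l j : ℕ} (hj : j ≤ r - 1)
    (hmod : (j : ℤ) ≡ n + 2 * ((l : ℤ) - 1) [ZMOD r]) : wall r n l = r - 1 - j := by
  refine wall_eq_of_dvd (by omega) ?_
  obtain ⟨e, he⟩ := hmod.dvd
  refine ⟨n - 1 - e, ?_⟩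
  rw [wt]
  push_cast [show ((r - 1 - j : ℕ) : ℤ) = r - 1 - j by omega]
  linear_combination -he

/-- The power E^(r-d) leads to a negative level and hence vanishes, and there is no coincidence of
scalars on the way. For r = 1 already E = 0. -/
lemma Nspace_eq_Wspace (hn : 1 ≤ n) (hr : 1 ≤ r) {l : ℕ} (h : l < r - wall r n l) :
    Nspace r n l = Wspace r n l := by
  refine le_antisymm (fun v hv => ?_) (Wspace_le_Nspace l)
  rw [mem_Nspace] at hv
  rw [mem_Wspace]
  refine ⟨?_, hv.2⟩
  rcases hr.eq_or_lt with rfl | hr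
  · have := tensorPower_E_pow (n := n) (r := 1) le_rfl
    rw [pow_one] at this
    rw [this, LinearMap.zero_apply]
  · have hA : v ∈ (tensorWeightSystem (n := n) hn hr).A l := by
      rw [WeightSystem.mem_A, Decomposition.Lev_eq]
      exact ⟨hv.2, hv.1⟩
    refine WeightSystem.E_eq_zero hr hA ?_
    have h1 := WeightSystem.E_pow_mem (r - wall r n l) (WeightSystem.mem_A.1 hA).1
    rwa [WeightSystem.L_eq_bot _ (Or.inl (by omega)), Submodule.mem_bot] at h1

lemma finrank_sup_eq_of_disjoint {M : Type*} [AddCommGroup M] [Module ℂ M] [Module.Finite ℂ M]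
    {X Y : Submodule ℂ M} (h : Disjoint X Y) :
    Module.finrank ℂ (X ⊔ Y : Submodule ℂ M) = Module.finrank ℂ X + Module.finrank ℂ Y := by
  rw [← Submodule.finrank_sup_add_finrank_inf_eq, h.eq_bot, finrank_bot, add_zero]

lemma exists_basis_of_finrank_eq {M : Type*} [AddCommGroup M] [Module ℂ M] [Module.Finite ℂ M]
    {N : Submodule ℂ M} {d : ℕ} (h : Module.finrank ℂ N = d) :
    Nonempty (Module.Basis (Fin d) ℂ N) :=
  ⟨Module.finBasisOfFinrankEq ℂ N h⟩

section Restriction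

variable {G M ι : Type*} [Group G] [AddCommGroup M] [Module ℂ M] [Fintype ι] [DecidableEq ι]

/-- The matrices of a representation on an invariant subspace. -/
lemma exists_matrix_of_invariant (ρ : Representation ℂ G M) {N : Submodule ℂ M}
    (hN : ∀ g, ∀ v ∈ N, ρ g v ∈ N) (b : Module.Basis ι ℂ N) :
    ∃ ρN : G →* Matrix.GeneralLinearGroup ι ℂ,
      ∀ g k, ρ g (b k : M) = ∑ m, (ρN g) m k • (b m : M) := by
  let φ : G →* Module.End ℂ N :=
    { toFun g := (ρ g).restrict (hN g)
      map_one' := by ext v; simp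
      map_mul' g h := by ext v; simp }
  refine ⟨(((LinearMap.toMatrixAlgEquiv b).toAlgHom : _ →* Matrix ι ι ℂ).comp φ).toHomUnits,
    fun g k => ?_⟩
  have h := congrArg N.subtype (b.sum_repr (φ g (b k)))
  rw [map_sum] at h
  refine Eq.trans h.symm (Finset.sum_congr rfl fun m _ => ?_)
  rw [map_smul]
  congr 1
  exact (LinearMap.toMatrixAlgEquiv_apply b (φ g) m k).symm

end Restriction

end

end SteinbergBraid

end

open SteinbergBraid in
theorem mainTheorem4 (n r l j : ℕ) (hn : 1 ≤ n) (hr : 1 ≤ r) (hl : l < r) (hj : j ≤ r - 1)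
    (hmod : (j : ℤ) ≡ n + 2 * ((l : ℤ) - 1) [ZMOD r]) :
    ∃ ρ : Representation ℂ (BraidGroup n) (TP r n),
      (∀ t, ρ (braidGen n t) = braidOp r n t) ∧
      (∀ g, ∀ v ∈ Wspace r n l, ρ g v ∈ Wspace r n l) ∧
      (∀ g, ∀ v ∈ Nspace r n l, ρ g v ∈ Nspace r n l) ∧
      (l ≤ j → Nspace r n l = Wspace r n l) ∧
      (j < l →
        Nonempty (Decomposition r n) ∧
        (∀ 𝒟 : Decomposition r n,
          Disjoint (Wspace r n l) (𝒟.headSpace l) ∧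
          Wspace r n l ⊔ 𝒟.headSpace l = Nspace r n l ∧
          Module.finrank ℂ (𝒟.headSpace l) = Module.finrank ℂ (𝒟.socleSpace l) ∧
          Module.finrank ℂ (𝒟.headSpace l) = Module.finrank ℂ (Wspace r n (l - 1 - j))) ∧
        ∃ (b : Module.Basis
              (Fin (Module.finrank ℂ (Wspace r n l) + Module.finrank ℂ (Wspace r n (l - 1 - j))))
              ℂ (Nspace r n l))
          (ρN : BraidGroup n →*
            Matrix.GeneralLinearGroup
              (Fin (Module.finrank ℂ (Wspace r n l) + Module.finrank ℂ (Wspace r n (l - 1 - j))))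
              ℂ),
          ∀ g k, ρ g (b k : TP r n) = ∑ m, (ρN g) m k • (b m : TP r n)) := by
  have hwall : wall r n l = r - 1 - j := wall_eq_of_modEq hr hj hmod
  refine ⟨braidRep hr n, braidRep_braidGen hr, fun g v hv => Wspace_invariant hr l g hv,
    fun g v hv => Nspace_invariant hr l g hv, fun h => Nspace_eq_Wspace hn hr (by omega),
    fun h => ?_⟩
  -- The chain j < l < r excludes r = 1 and also makes the wall nonzero.
  have hr2 : 2 ≤ r := by omega
  have hl' : l - 1 - j = l - (r - wall r n l) := by omega
  have hfin : ∀ 𝒟 : Decomposition r n,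
      Module.finrank ℂ (𝒟.headSpace l) = Module.finrank ℂ (Wspace r n (l - 1 - j)) := fun 𝒟 => by
    rw [hl']
    exact 𝒟.finrank_headSpace_eq hn hr2 hl (by omega) (by omega)
  obtain ⟨𝒟⟩ := nonempty_decomposition hn hr2
  have hN : Module.finrank ℂ (Nspace r n l) =
      Module.finrank ℂ (Wspace r n l) + Module.finrank ℂ (Wspace r n (l - 1 - j)) := by
    rw [← hfin 𝒟, ← 𝒟.sup_headSpace hn hr2 hl]
    exact finrank_sup_eq_of_disjoint (𝒟.disjoint_headSpace hn hr2 l)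
  obtain ⟨b⟩ := exists_basis_of_finrank_eq hN
  exact ⟨⟨𝒟⟩, fun 𝒟 => ⟨𝒟.disjoint_headSpace hn hr2 l, 𝒟.sup_headSpace hn hr2 hl,
    𝒟.finrank_headSpace hn hr2 l, hfin 𝒟⟩, b,
    exists_matrix_of_invariant (braidRep hr n) (fun g v hv => Nspace_invariant hr l g hv) b⟩
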